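/- Let $\ell\ge 1$ be an integer and let $U:\mathbb R^2\to[0,\infty)$ be a fixed $C^2$ function with $U(x)\to+\infty$ as $|x|\to\infty$, with $U(x)\le |x|^s$ and $|\nabla U(x)|\le |x|^t$ for $|x|$ large enough, for some $s,t>0$, and such that every level set $\{U=e\}$, $e\ge 0$, has Lebesgue measure zero. Let $e_0$ be the smallest $e$ with $|\{U\le e\}|\ge \pi\ell$, let $\Omega_0$ be a measurable set with $\{U<e_0\}\subseteq\Omega_0\subseteq\{U\le e_0\}$ and $|\Omega_0|=\pi\ell$ (it is unique up to a null set), and let $R$ be such that the disk $D(0,R)$ contains $\Omega_0$. Identify $\mathbb R^2$ with $\mathbb C$. For an integer $N\ge 1$ consider a square grid (in arbitrary position and orientation) of side length $\delta=\sqrt{\pi/N}$, let $a_1,\dots,a_M$ be the midpoints of those closed squares of the grid that are contained in $D(0,R)\setminus\Omega_0$ and do not meet its boundary, and put $$f(z)=f_\delta(z)=c_N\prod_{j=1}^M\bigl(z-\sqrt N\,a_j\bigr).$$ Let $$\Psi_f(z_1,\dots,z_N)=c\,\prod_{j=1}^N f(z_j)\prod_{i<j}(z_i-z_j)^\ell\,e^{-\sum_{i}|z_i|^2/2}$$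 be normalized in $L^2(\mathbb R^{2N})$, let $\rho_f(z)=N\int_{\mathbb R^{2(N-1)}}|\Psi_f(z,z_2,\dots,z_N)|^2\,dz_2\cdots dz_N$ be its one-particle density, and let $\mu^{(1)}_f(x)=\rho_f(\sqrt N x)$. Let $$\mathcal E^{\rm el}_f[\rho]=\int_{\mathbb R^2}\Bigl(\frac2N\sum_{j=1}^M\log\frac1{|x-a_j|}+|x|^2\Bigr)\rho(x)\,dx+\ell\iint_{\mathbb R^2\times\mathbb R^2}\rho(x)\log\frac1{|x-y|}\rho(y)\,dx\,dy$$ be the electrostatic energy functional on the probability densities $\rho$ of finite energy, i.e. those for which both integrals converge absolutely. Then there are constants $C,c>0$ depending only on $\ell$, $U$ and $R$ such that the following holds for all $N\ge 1$. The functional $\mathcal E^{\rm el}_f$ has a minimizer $\rho^{\rm el}_f$ among these densities, unique up to equality almost everywhere, and for every compactly supported $C^1$ function $\chi:\mathbb R^2\to\mathbb R$, $$\left|\int_{\mathbb R^2}\bigl(\mu^{(1)}_f(x)-\rho^{\rm el}_f(x)\bigr)\chi(x)\,dx\right|\le C\left(\frac{\log N}{N}\right)^{1/2}\|\nabla\chi\|_{L^2}+C\,N^{-1/2}\,\|\nabla\chi\|_{L^\infty}.$$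 Moreover, for every $x\in\mathbb R^2$, $$0\le\mu^{(1)}_f(x)\le C\,e^{-cN(|x|^2-\log N)}.$$ -/

import Mathlib

open MeasureTheory Filter
open scoped Polynomial

noncomputable section

/-! The plane `ℝ²` is identified with `ℂ`, whose norm is the Euclidean norm and whose `volume` is
Lebesgue measure. For `g : ℂ → ℝ`, `‖fderiv ℝ g x‖` is the Euclidean norm of the gradient. -/

/-- The assumptions on the scaled external potential `U : ℝ² → [0, ∞)`: it is twice continuously
differentiable, tends to infinity at infinity, has at most polynomial growth together with its
gradient, and has no flat pieces. -/
structure IsTrappingPotential (U : ℂ → ℝ) : Prop where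
  nonneg : ∀ x, 0 ≤ U x
  contDiff : ContDiff ℝ 2 U
  tendsto_atTop : Tendsto U (cocompact ℂ) atTop
  growth : ∃ s : ℝ, 0 < s ∧ ∀ᶠ x in cocompact ℂ, |U x| ≤ ‖x‖ ^ s
  growth_grad : ∃ t : ℝ, 0 < t ∧ ∀ᶠ x in cocompact ℂ, ‖fderiv ℝ U x‖ ≤ ‖x‖ ^ t
  no_flat : ∀ e : ℝ, 0 ≤ e → volume {x : ℂ | U x = e} = 0

/-- `Ω` is a bathtub set for `U` at filling factor `1 / ℓ`: with `e₀` the smallest energy whose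
sublevel set has area at least `π ℓ`, one has `{U < e₀} ⊆ Ω ⊆ {U ≤ e₀}` and `|Ω| = π ℓ`. Then
`(π ℓ)⁻¹ 1_Ω` is the bathtub minimizer. Without flat pieces `Ω` is unique up to a null set. -/
def IsBathtubSet (ℓ : ℕ) (U : ℂ → ℝ) (Ω : Set ℂ) : Prop :=
  MeasurableSet Ω ∧ volume Ω = ENNReal.ofReal (Real.pi * ℓ) ∧
    ∃ e₀ : ℝ, IsLeast {e : ℝ | ENNReal.ofReal (Real.pi * ℓ) ≤ volume {x : ℂ | U x ≤ e}} e₀ ∧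
      {x : ℂ | U x < e₀} ⊆ Ω ∧ Ω ⊆ {x : ℂ | U x ≤ e₀}

/-! ### The grid of quasi-holes -/

/-- The lattice constant `δ_N = (π / N)^{1/2}`. -/
def gridSpacing (N : ℕ) : ℝ := √(Real.pi / N)

/-- The midpoint of the cell with integer coordinates `(m, n)` in the square grid of spacing `δ`,
with reference point `b` and direction `u` (a complex number of modulus one). -/
def cellCenter (δ : ℝ) (b u : ℂ) (m n : ℤ) : ℂ := b + δ * u * (m + n * Complex.I)

/-- The closed square of side `δ`, with sides parallel to `u` and `i u`, centred at `a`. -/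
def closedCell (δ : ℝ) (u a : ℂ) : Set ℂ :=
  {x | ∃ s t : ℝ, |s| ≤ 1 / 2 ∧ |t| ≤ 1 / 2 ∧ x = a + δ * u * (s + t * Complex.I)}

/-- The midpoints of those cells of the grid of spacing `δ_N` that are fully included in
`Ω' = D(0, R) \ Ω` and do not meet its boundary. -/
def quasiHoleSet (N : ℕ) (R : ℝ) (Ω : Set ℂ) (b u : ℂ) : Set ℂ :=
  {a | (∃ m n : ℤ, a = cellCenter (gridSpacing N) b u m n) ∧
    closedCell (gridSpacing N) u a ⊆ interior (Metric.closedBall 0 R \ Ω)}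

theorem quasiHoleSet_subset_closedBall (N : ℕ) (R : ℝ) (Ω : Set ℂ) (b u : ℂ) :
    quasiHoleSet N R Ω b u ⊆ Metric.closedBall 0 R := by
  rintro a ⟨-, ha⟩
  exact (interior_subset (ha ⟨0, 0, by norm_num, by norm_num, by simp⟩)).1

theorem quasiHoleSet_finite (N : ℕ) (R : ℝ) (Ω : Set ℂ) (b u : ℂ) :
    (quasiHoleSet N R Ω b u).Finite := by
  set w : ℂ := gridSpacing N * u with hw
  by_cases hw0 : w = 0
  · refine (Set.finite_singleton b).subset ?_
    rintro a ⟨⟨m, n, rfl⟩, -⟩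
    simp [cellCenter, ← hw, hw0]
  · obtain ⟨K, hK⟩ := exists_nat_ge ((R + ‖b‖) / ‖w‖)
    have hfin : ((fun p : ℤ × ℤ => cellCenter (gridSpacing N) b u p.1 p.2) ''
        (Set.Icc (-(K : ℤ)) K ×ˢ Set.Icc (-(K : ℤ)) K)).Finite :=
      ((Set.finite_Icc _ _).prod (Set.finite_Icc _ _)).image _
    refine hfin.subset ?_
    intro a ha
    have hR := quasiHoleSet_subset_closedBall N R Ω b u ha
    obtain ⟨⟨m, n, rfl⟩, -⟩ := ha
    rw [mem_closedBall_zero_iff] at hR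
    have h1 : ‖w‖ * ‖(m + n * Complex.I : ℂ)‖ ≤ R + ‖b‖ := by
      rw [← norm_mul]
      have : w * (m + n * Complex.I) = cellCenter (gridSpacing N) b u m n - b := by
        simp [cellCenter, hw]
      rw [this]
      exact (norm_sub_le _ _).trans (by linarith)
    have h2 : ‖(m + n * Complex.I : ℂ)‖ ≤ K :=
      le_trans (by rw [le_div_iff₀ (norm_pos_iff.2 hw0)]; linarith) hK
    have hm : |(m : ℝ)| ≤ K := by
      simpa using (Complex.abs_re_le_norm (m + n * Complex.I : ℂ)).trans h2
    have hn : |(n : ℝ)| ≤ K := by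
      simpa using (Complex.abs_im_le_norm (m + n * Complex.I : ℂ)).trans h2
    rw [abs_le] at hm hn
    refine ⟨(m, n), ⟨⟨?_, ?_⟩, ⟨?_, ?_⟩⟩, rfl⟩
    · exact_mod_cast hm.1
    · exact_mod_cast hm.2
    · exact_mod_cast hn.1
    · exact_mod_cast hn.2

/-- The polynomial `f_δ(z) = ∏_j (z - √N a_j)`, where the `a_j` are the quasi-hole positions. The
constant factor `c_N` is left to the normalization of the wave function. -/
def quasiHolePolynomial (N : ℕ) (R : ℝ) (Ω : Set ℂ) (b u : ℂ) : ℂ[X] :=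
  ∏ a ∈ (quasiHoleSet_finite N R Ω b u).toFinset, (Polynomial.X - Polynomial.C (√(N : ℝ) * a))

/-! ### The quantum mechanical one-particle density -/

/-- The wave function `∏_j f(z_j) ∏_{i<j} (z_i - z_j)^ℓ exp(- ∑_i |z_i|² / 2)`, not normalized. -/
def laughlinAmplitude (ℓ N : ℕ) (f : ℂ[X]) (z : Fin N → ℂ) : ℂ :=
  (∏ j, f.eval (z j)) * (∏ i, ∏ j ∈ Finset.Ioi i, (z i - z j) ^ ℓ) *
    ((Real.exp (-(∑ i, ‖z i‖ ^ 2) / 2) : ℝ) : ℂ)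

/-- The quasi-hole Laughlin state `Ψ_f`, normalized in `L²(ℝ^{2N})`. -/
def laughlinState (ℓ N : ℕ) (f : ℂ[X]) (z : Fin N → ℂ) : ℂ :=
  (((√(∫ w : Fin N → ℂ, ‖laughlinAmplitude ℓ N f w‖ ^ 2))⁻¹ : ℝ) : ℂ) * laughlinAmplitude ℓ N f z

/-- The one-particle density
`ρ_f(z) = N ∫ |Ψ_f(z, z_2, …, z_N)|² dz_2 … dz_N`, of total mass `N` (and `0` for `N = 0`). -/
def oneParticleDensity (ℓ : ℕ) : (N : ℕ) → ℂ[X] → ℂ → ℝ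
  | 0, _, _ => 0
  | n + 1, f, z =>
      ((n + 1 : ℕ) : ℝ) *
        ∫ w : Fin n → ℂ, ‖laughlinState ℓ (n + 1) f (Fin.cons z w : Fin (n + 1) → ℂ)‖ ^ 2

/-- The scaled one-particle density `μ_f^{(1)}(x) = ρ_f(√N x)`. -/
def scaledOneParticleDensity (ℓ N : ℕ) (f : ℂ[X]) (x : ℂ) : ℝ :=
  oneParticleDensity ℓ N f (√(N : ℝ) * x)

/-! ### The electrostatic functional -/

/-- The potential `Φ_{qh,f}(x) = ∑_j q_j log (1 / |x - a_j|)` of the quasi-hole charges of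
`f(z) = c ∏_j (z - √N a_j)^{N q_j / 2}`: a root `z` of `f`, counted with multiplicity, carries the
charge `2 / N` at `z / √N`. -/
def quasiHolePotential (N : ℕ) (f : ℂ[X]) (x : ℂ) : ℝ :=
  (f.roots.map fun z => (2 / (N : ℝ)) * Real.log (1 / ‖x - z / √(N : ℝ)‖)).sum

/-- The electrostatic energy `ℰ^el_f[ρ]`. -/
def electrostaticEnergy (ℓ N : ℕ) (f : ℂ[X]) (ρ : ℂ → ℝ) : ℝ :=
  (∫ x : ℂ, (quasiHolePotential N f x + ‖x‖ ^ 2) * ρ x) +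
    ℓ * ∫ p : ℂ × ℂ, ρ p.1 * Real.log (1 / ‖p.1 - p.2‖) * ρ p.2

/-- The probability densities of finite electrostatic energy. -/
structure IsFiniteEnergyDensity (N : ℕ) (f : ℂ[X]) (ρ : ℂ → ℝ) : Prop where
  nonneg : ∀ᵐ x, 0 ≤ ρ x
  integrable : Integrable ρ
  integral_eq_one : ∫ x, ρ x = 1
  integrable_potential : Integrable fun x : ℂ => (quasiHolePotential N f x + ‖x‖ ^ 2) * ρ x
  integrable_interaction :
    Integrable fun p : ℂ × ℂ => ρ p.1 * Real.log (1 / ‖p.1 - p.2‖) * ρ p.2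

/-- `ρ` is a normalized minimizer of the electrostatic energy. -/
def IsElectrostaticMinimizer (ℓ N : ℕ) (f : ℂ[X]) (ρ : ℂ → ℝ) : Prop :=
  IsFiniteEnergyDensity N f ρ ∧
    ∀ σ : ℂ → ℝ, IsFiniteEnergyDensity N f σ →
      electrostaticEnergy ℓ N f ρ ≤ electrostaticEnergy ℓ N f σ

end

/-! Plasma analogy. After scaling lengths by √N, |Ψ_f|² is, up to a constant, the Gibbs weight
exp(−H) with H(X) = N ∑ V(X_i) + ℓ ∑_{i≠j} log(1/|X_i − X_j|) and V(x) = |x|² + (2/N) ∑ log(1/|x −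
a_j|) (`norm_sq_laughlinAmplitude`). The mean-field version of H is N² times the electrostatic
functional. The claim is that under this weight the empirical density stays close to the minimizer
ρ, with closeness measured by the logarithmic energy D(σ) = ∬ σ(x) log(1/|x − y|) σ(y).

Equilibrium. A minimizer ρ is first found among densities bounded by Λ in a disc of radius T. The
bathtub principle shows that ρ equals Λ where the total potential Φ is below some level e and
vanishes where Φ > e. If Λ is large, a point with Φ < e contradicts superharmonicity near a minimum
of Φ (`level_le_totalPotential`); if T is large, Φ > e outside the disc. So Φ ≥ e off the charges
and Φ = e on the support of ρ, with Λ and T independent of N (`exists_equilibrium`). These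
conditions, together with D ≥ 0 on neutral densities (`logEnergy_self_nonneg`), give minimality and
uniqueness among all densities of finite energy.

Fluctuations. Smearing each point over a disc of radius N^(−1/2) lowers the pair interaction, by
Newton's argument, and costs O(log N) of self-energy per particle. Hence H(X) is at least N² times
the minimal energy plus ℓ N² D(smeared X − ρ), up to O(N log N) and a term giving Gaussian decay
(`IsEquilibrium.le_gibbsEnergy`). Jensen's inequality with the product trial state ρ^⊗N bounds the
partition function from below up to e^(O(N)). Together they give a mean value of D of order log N /
N.

Test functions. Any χ is the logarithmic potential of −Δχ/(2π), so Cauchy–Schwarz for D gives |∫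
σχ|² ≤ D(σ) ‖∇χ‖₂² for neutral σ (`sq_integral_mul_le`). Undoing the smearing costs N^(−1/2) ‖∇χ‖_∞.
For N = 1, where log N = 0, the two densities are compared directly through first moments.

Decay. In one variable the wave function is a polynomial of degree O(N) times a Gaussian, and such
functions are bounded pointwise by their L² norm (`Polynomial.norm_sq_eval_mul_gaussian_le`). -/

/-! ### The logarithmic kernel -/

/-- The logarithmic interaction `log (1 / |x - y|)`. -/
noncomputable def logKernel (x y : ℂ) : ℝ := Real.log (1 / ‖x - y‖)

theorem logKernel_eq_neg_log (x y : ℂ) : logKernel x y = -Real.log ‖x - y‖ := by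
  simp [logKernel]

theorem logKernel_comm (x y : ℂ) : logKernel x y = logKernel y x := by
  simp [logKernel, norm_sub_rev]

@[fun_prop]
theorem Measurable.logKernel {α : Type*} [MeasurableSpace α] {f g : α → ℂ} (hf : Measurable f)
    (hg : Measurable g) : Measurable fun a => logKernel (f a) (g a) := by
  unfold _root_.logKernel
  fun_prop

/-- The repulsive part `log⁺ (1 / |w|)` of the logarithmic kernel. -/
noncomputable def nearKernel (w : ℂ) : ℝ := Real.posLog ‖w‖⁻¹

theorem nearKernel_nonneg (w : ℂ) : 0 ≤ nearKernel w := Real.posLog_nonneg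

/-- In polar coordinates the integrand is y log(1/y) on (0, 1], which is at most 1. -/
theorem integrable_nearKernel : Integrable nearKernel := by
  refine (integrable_fun_norm_addHaar volume (f := fun y : ℝ => Real.posLog y⁻¹)).2 ?_
  simp only [Complex.finrank_real_complex, Nat.add_one_sub_one, pow_one, smul_eq_mul]
  have hb : Integrable ((Set.Ioc (0 : ℝ) 1).indicator fun _ => (1 : ℝ)) := by
    rw [integrable_indicator_iff measurableSet_Ioc]
    exact integrableOn_const (by simp)
  refine hb.integrableOn.mono' (by unfold Real.posLog; fun_prop) ?_
  rw [ae_restrict_iff' measurableSet_Ioi]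
  refine Eventually.of_forall fun y hy => ?_
  have hy : 0 < y := hy
  rw [Real.norm_of_nonneg (mul_nonneg hy.le Real.posLog_nonneg)]
  by_cases h1 : y ≤ 1
  · rw [Set.indicator_of_mem (show y ∈ Set.Ioc (0 : ℝ) 1 from ⟨hy, h1⟩), Real.posLog_eq_log (by
      rw [abs_of_pos (by positivity)]; exact (one_le_inv₀ hy).2 h1)]
    have := Real.log_le_self (x := y⁻¹) (by positivity)
    calc y * Real.log y⁻¹ ≤ y * y⁻¹ := by gcongr
      _ = 1 := mul_inv_cancel₀ hy.ne'
  · rw [Set.indicator_of_notMem (fun h : y ∈ Set.Ioc (0 : ℝ) 1 => h1 h.2), (Real.posLog_eq_zero_iff _).2 (by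
      rw [abs_of_pos (by positivity)]; exact inv_le_one_of_one_le₀ (not_le.1 h1).le), mul_zero]

/-- The total mass of the repulsive part of the logarithmic kernel. -/
noncomputable def nearMass : ℝ := ∫ w, nearKernel w

/-- Only finiteness and positivity of this constant matter; its value is never computed. -/
theorem nearMass_pos : 0 < nearMass := by
  unfold nearMass
  rw [integral_pos_iff_support_of_nonneg nearKernel_nonneg integrable_nearKernel]
  have h : Metric.ball (1 / 2 : ℂ) (1 / 4) ⊆ Function.support nearKernel := by
    intro w hw
    rw [mem_ball_iff_norm] at hw
    have h1 : ‖w‖ < 3 / 4 := by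
      have := norm_add_le (w - 1 / 2) (1 / 2)
      simp at this hw
      linarith
    have h2 : 0 < ‖w‖ := by
      have := norm_sub_norm_le (1 / 2 : ℂ) (1 / 2 - w)
      rw [norm_sub_rev (1 / 2 : ℂ) w] at this
      simp at this hw
      linarith
    have h3 : (1 : ℝ) < ‖w‖⁻¹ := (one_lt_inv₀ h2).2 (by linarith)
    have h4 : nearKernel w = Real.log ‖w‖⁻¹ := Real.posLog_eq_log (by
      rw [abs_of_pos (by positivity)]; exact h3.le)
    exact (h4 ▸ Real.log_pos h3).ne'
  exact (Metric.measure_ball_pos volume _ (by norm_num)).trans_le (measure_mono h)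

theorem abs_log_norm_le (w : ℂ) : |Real.log ‖w‖| ≤ nearKernel w + ‖w‖ := by
  rcases (norm_nonneg w).eq_or_lt with h | h
  · simp [← h]
    exact nearKernel_nonneg w
  have h0 := nearKernel_nonneg w
  have h1 := Real.log_le_self h.le
  have h2 : -Real.log ‖w‖ ≤ nearKernel w := by
    rw [← Real.log_inv]; exact le_max_right _ _
  rw [abs_le]
  constructor <;> linarith

theorem abs_logKernel_le (x y : ℂ) : |logKernel x y| ≤ nearKernel (x - y) + ‖x - y‖ := by
  rw [logKernel_eq_neg_log, abs_neg]
  exact abs_log_norm_le _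

theorem logKernel_le_nearKernel (x y : ℂ) : logKernel x y ≤ nearKernel (x - y) := by
  rw [logKernel_eq_neg_log, ← Real.log_inv]
  exact le_max_right _ _

theorem neg_norm_le_logKernel (x y : ℂ) : -‖x - y‖ ≤ logKernel x y := by
  rw [logKernel_eq_neg_log]
  have := Real.log_le_self (norm_nonneg (x - y))
  linarith

theorem integrable_nearKernel_sub (x : ℂ) : Integrable fun y => nearKernel (x - y) :=
  integrable_nearKernel.comp_sub_left x

theorem integral_nearKernel_sub (x : ℂ) : ∫ y, nearKernel (x - y) = nearMass :=
  integral_sub_left_eq_self nearKernel volume x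

theorem integrable_bdd_mul_logKernel {β : ℂ → ℝ} (hβ : Measurable β) {Λ T : ℝ}
    (hb : ∀ y, |β y| ≤ Λ) (hs : ∀ y, T < ‖y‖ → β y = 0) (x : ℂ) :
    Integrable fun y => logKernel x y * β y := by
  have hΛ : 0 ≤ Λ := (abs_nonneg _).trans (hb 0)
  have h1 : Integrable fun y => Λ * nearKernel (x - y) +
      (Metric.closedBall (0 : ℂ) T).indicator (fun _ => (‖x‖ + T) * Λ) y := by
    refine ((integrable_nearKernel_sub x).const_mul Λ).add ?_
    rw [integrable_indicator_iff measurableSet_closedBall]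
    exact integrableOn_const measure_closedBall_lt_top.ne
  refine h1.mono' (by fun_prop) (Eventually.of_forall fun y => ?_)
  rw [norm_mul, Real.norm_eq_abs, Real.norm_eq_abs]
  by_cases hy : T < ‖y‖
  · simp only [hs y hy, abs_zero, mul_zero]
    rw [Set.indicator_of_notMem (by simpa using hy), add_zero]
    exact mul_nonneg hΛ (nearKernel_nonneg _)
  · rw [Set.indicator_of_mem (by simpa using hy)]
    have h2 := abs_logKernel_le x y
    have h3 := norm_sub_le x y
    have h4 := nearKernel_nonneg (x - y)
    calc |logKernel x y| * |β y| ≤ (nearKernel (x - y) + (‖x‖ + T)) * Λ := by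
          have h5 : ‖y‖ ≤ T := not_lt.1 hy
          exact mul_le_mul (by linarith) (hb y) (abs_nonneg _)
            (by linarith [norm_nonneg y, norm_nonneg x])
      _ = _ := by ring

/-- The scaled repulsive kernel `log⁺ (r / |w|)` has integral `r ^ 2` times that of `log⁺ (1 / |w|)`. -/
theorem integral_nearKernel_scaled {r : ℝ} (hr : 0 < r) :
    ∫ w : ℂ, nearKernel (r⁻¹ • w) = r ^ 2 * nearMass := by
  rw [Measure.integral_comp_smul]
  simp [nearMass, abs_of_pos hr]

theorem integrable_nearKernel_scaled {r : ℝ} (hr : 0 < r) (x : ℂ) :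
    Integrable fun y : ℂ => nearKernel (r⁻¹ • (x - y)) :=
  ((integrable_comp_smul_iff volume nearKernel (inv_ne_zero hr.ne')).2
    integrable_nearKernel).comp_sub_left x

/-- Writes log(1/|x − y|) = log(1/r) + log(r/|x − y|), so that the singular part is measured at
scale r. For r > 1 the convention `Real.log 0 = 0` breaks the bound on the diagonal. -/
theorem logKernel_le_scaled {r : ℝ} (hr : 0 < r) {x y : ℂ} (hxy : x ≠ y) :
    logKernel x y ≤ Real.log (1 / r) + nearKernel (r⁻¹ • (x - y)) := by
  have h : 0 < ‖x - y‖ := norm_pos_iff.2 (sub_ne_zero.2 hxy)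
  have h1 : Real.log (‖r⁻¹ • (x - y)‖⁻¹) ≤ nearKernel (r⁻¹ • (x - y)) := le_max_right _ _
  have h2 : Real.log (‖r⁻¹ • (x - y)‖⁻¹) = Real.log r - Real.log ‖x - y‖ := by
    rw [norm_smul, norm_inv, Real.norm_of_nonneg hr.le, mul_inv, inv_inv,
      Real.log_mul hr.ne' (inv_ne_zero h.ne'), Real.log_inv]; ring
  rw [logKernel_eq_neg_log, one_div, Real.log_inv]
  linarith

/-! ### Averages over discs and superharmonicity of the kernel. -/

theorem volume_real_ball (a : ℂ) {r : ℝ} (hr : 0 ≤ r) :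
    volume.real (Metric.ball a r) = Real.pi * r ^ 2 := by
  rw [Measure.real, Complex.volume_ball]
  simp [hr, mul_comm]

theorem integrableOn_logKernel_ball (x a : ℂ) (r : ℝ) :
    IntegrableOn (fun y => logKernel x y) (Metric.ball a r) := by
  have h := integrable_bdd_mul_logKernel (β := (Metric.ball a r).indicator fun _ => 1)
    (measurable_const.indicator measurableSet_ball) (Λ := 1) (T := ‖a‖ + r)
    (fun y => by by_cases hy : y ∈ Metric.ball a r <;> simp [hy]) (fun y hy => by
      rw [Set.indicator_of_notMem]
      intro hy'
      rw [mem_ball_iff_norm] at hy'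
      have := norm_sub_norm_le y a
      linarith) x
  rw [← integrable_indicator_iff measurableSet_ball]
  refine h.congr (Eventually.of_forall fun y => ?_)
  by_cases hy : y ∈ Metric.ball a r <;> simp [hy]

/-- The average of `log (1 / |x - ·|)` over a disk of radius `r` is at most `log (1 / r) + C`. -/
theorem setIntegral_logKernel_ball_le (x a : ℂ) {r : ℝ} (hr : 0 < r) :
    ∫ y in Metric.ball a r, logKernel x y ≤
      Real.pi * r ^ 2 * (Real.log (1 / r) + nearMass / Real.pi) := by
  have h1 : ∫ y in Metric.ball a r, logKernel x y ≤
      ∫ y in Metric.ball a r, (Real.log (1 / r) + nearKernel (r⁻¹ • (x - y))) := by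
    refine setIntegral_mono_ae (integrableOn_logKernel_ball x a r)
      ((integrableOn_const measure_ball_lt_top.ne).add
        (integrable_nearKernel_scaled hr x).integrableOn) ?_
    filter_upwards [compl_mem_ae_iff.2 (measure_singleton (μ := volume) x)] with y hy
    exact logKernel_le_scaled hr (Ne.symm hy)
  have hc : IntegrableOn (fun _ : ℂ => Real.log (1 / r)) (Metric.ball a r) :=
    integrableOn_const measure_ball_lt_top.ne
  rw [integral_add hc (integrable_nearKernel_scaled hr x).integrableOn, setIntegral_const,
    volume_real_ball a hr.le] at h1
  have h2 : ∫ y in Metric.ball a r, nearKernel (r⁻¹ • (x - y)) ≤ r ^ 2 * nearMass := by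
    rw [← integral_nearKernel_scaled hr,
      ← integral_sub_left_eq_self (fun w : ℂ => nearKernel (r⁻¹ • w)) volume x]
    exact setIntegral_le_integral (integrable_nearKernel_scaled hr x)
      (Eventually.of_forall fun _ => nearKernel_nonneg _)
  have h3 : Real.pi * r ^ 2 * (nearMass / Real.pi) = r ^ 2 * nearMass := by
    field_simp
  rw [mul_add, h3]
  simp only [smul_eq_mul] at h1
  linarith

/-- By Jensen's formula the average is log max(|x|, |z|) when x ≠ 0, since it equals log|x| plus the
average of log|w − z/x|. -/
theorem log_norm_le_circleAverage {x z : ℂ} (hz : z ≠ 0) :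
    Real.log ‖z‖ ≤ Real.circleAverage (fun w => Real.log ‖w * x - z‖) 0 1 := by
  by_cases hx : x = 0
  · simp [hx, Real.circleAverage_const]
  -- The factorization of the logarithm can fail only at the single point w = z / x, where an
  -- argument is 0.
  have h : (fun w : ℂ => Real.log ‖w * x - z‖) =ᶠ[codiscreteWithin (Metric.sphere (0 : ℂ) |1|)]
      fun w => Real.log ‖x‖ + Real.log ‖w - z / x‖ := by
    have : {w : ℂ | w ≠ z / x} ∈ codiscreteWithin (Metric.sphere (0 : ℂ) |1|) := by
      apply codiscreteWithin_iff_locallyFiniteComplementWithin.2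
      intro w hw
      refine ⟨Set.univ, univ_mem, Set.Subsingleton.finite ?_⟩
      intro w₁ h₁ w₂ h₂
      simp_all
    filter_upwards [this] with w hw
    rw [← Real.log_mul (norm_ne_zero_iff.2 hx) (norm_ne_zero_iff.2 (sub_ne_zero.2 hw)),
      ← norm_mul]
    congr 2
    field_simp
  rw [Real.circleAverage_congr_codiscreteWithin h (by norm_num), ← Pi.add_def,
    Real.circleAverage_add (circleIntegrable_const (Real.log ‖x‖) 0 1)
      (MeromorphicOn.circleIntegrable_log_norm (fun _ _ ↦ by fun_prop)),
    Real.circleAverage_const, circleAverage_log_norm_sub_const_eq_posLog]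
  have h1 : Real.log ‖z / x‖ ≤ Real.posLog ‖z / x‖ := le_max_right _ _
  rw [norm_div, Real.log_div (norm_ne_zero_iff.2 hz) (norm_ne_zero_iff.2 hx)] at h1
  rw [norm_div]
  linarith

/-- The logarithm is subharmonic: its average over a disk dominates its value at the centre. -/
theorem log_norm_le_setIntegral_ball {z : ℂ} (hz : z ≠ 0) {r : ℝ} (hr : 0 < r) :
    Real.pi * r ^ 2 * Real.log ‖z‖ ≤ ∫ x in Metric.ball (0 : ℂ) r, Real.log ‖x - z‖ := by
  set g : ℂ → ℝ := (Metric.ball (0 : ℂ) r).indicator fun x => Real.log ‖x - z‖ with hg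
  have hgm : Measurable g := by
    refine Measurable.indicator (by fun_prop) measurableSet_ball
  have hgi : Integrable g := by
    rw [hg, integrable_indicator_iff measurableSet_ball]
    refine (integrableOn_logKernel_ball z 0 r).neg.congr (Eventually.of_forall fun y => ?_)
    simp [logKernel_eq_neg_log, norm_sub_rev]
  -- Rotations preserve area, so the disc integral equals its mean over all rotations. After Fubini
  -- the inner integral is a circle average.
  have hrot : ∀ θ : ℝ, MeasurePreserving (fun x : ℂ => circleMap 0 1 θ * x) := by
    intro θ
    have := (rotation (Circle.exp θ)).measurePreserving
    convert! this using 2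
    simp [circleMap]
  have hint : ∀ θ : ℝ, Integrable fun x : ℂ => g (circleMap 0 1 θ * x) := fun θ =>
    ((hrot θ).integrable_comp hgi.aestronglyMeasurable).2 hgi
  have heq : ∀ θ : ℝ, ∀ h : ℂ → ℝ, AEStronglyMeasurable h volume →
      ∫ x, h (circleMap 0 1 θ * x) = ∫ x, h x := fun θ h hh => by
    rw [← integral_map (hrot θ).measurable.aemeasurable (by rwa [(hrot θ).map_eq]),
      (hrot θ).map_eq]
  set μ := (volume : Measure ℝ).restrict (Set.Ioc 0 (2 * Real.pi)) with hμ
  have hprod : Integrable (fun p : ℝ × ℂ => g (circleMap 0 1 p.1 * p.2)) (μ.prod volume) := by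
    rw [integrable_prod_iff]
    · refine ⟨Eventually.of_forall fun θ => hint θ, ?_⟩
      simp only
      have : (fun θ : ℝ => ∫ y : ℂ, ‖g (circleMap 0 1 θ * y)‖) = fun _ => ∫ y : ℂ, ‖g y‖ := by
        funext θ
        exact heq θ (fun y => ‖g y‖) hgm.norm.aestronglyMeasurable
      rw [this]
      exact integrable_const _
    · exact (hgm.comp (by fun_prop)).aestronglyMeasurable
  have hswap := integral_integral_swap (f := fun (θ : ℝ) (x : ℂ) => g (circleMap 0 1 θ * x)) hprod
  have hleft : ∫ θ, ∫ x, g (circleMap 0 1 θ * x) ∂volume ∂μ =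
      2 * Real.pi * ∫ x in Metric.ball (0 : ℂ) r, Real.log ‖x - z‖ := by
    simp_rw [fun θ => heq θ g hgm.aestronglyMeasurable]
    rw [integral_const, hg, integral_indicator measurableSet_ball, smul_eq_mul]
    congr 1
    simp [hμ, Measure.real, Real.pi_pos.le]
  have hright : 2 * Real.pi * (Real.pi * r ^ 2 * Real.log ‖z‖) ≤
      ∫ x : ℂ, ∫ θ, g (circleMap 0 1 θ * x) ∂μ := by
    have h1 : 2 * Real.pi * (Real.pi * r ^ 2 * Real.log ‖z‖) =
        ∫ x : ℂ, (Metric.ball (0 : ℂ) r).indicator (fun _ => 2 * Real.pi * Real.log ‖z‖) x := by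
      rw [integral_indicator measurableSet_ball, setIntegral_const, volume_real_ball _ hr.le,
        smul_eq_mul]
      ring
    rw [h1]
    refine integral_mono ?_ hprod.integral_prod_right fun x => ?_
    · rw [integrable_indicator_iff measurableSet_ball]
      exact integrableOn_const measure_ball_lt_top.ne
    · by_cases hx : x ∈ Metric.ball (0 : ℂ) r
      · have h2 : ∀ θ, g (circleMap 0 1 θ * x) = Real.log ‖circleMap 0 1 θ * x - z‖ := by
          intro θ
          rw [hg, Set.indicator_of_mem]
          simpa [circleMap] using hx
        have h3 := log_norm_le_circleAverage (x := x) hz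
        rw [Real.circleAverage, intervalIntegral.integral_of_le (by positivity)] at h3
        simp only [h2, Set.indicator_of_mem hx]
        rw [smul_eq_mul, inv_mul_eq_div, le_div_iff₀ (by positivity)] at h3
        linarith
      · have h2 : ∀ θ, g (circleMap 0 1 θ * x) = 0 := by
          intro θ
          rw [hg, Set.indicator_of_notMem]
          simpa [circleMap] using hx
        simp [h2, Set.indicator_of_notMem hx]
  rw [← hswap, hleft] at hright
  exact le_of_mul_le_mul_left hright (by positivity)

theorem setIntegral_ball_eq (f : ℂ → ℝ) (a : ℂ) (r : ℝ) :
    ∫ x in Metric.ball a r, f x = ∫ x in Metric.ball (0 : ℂ) r, f (a + x) := by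
  rw [← integral_indicator measurableSet_ball, ← integral_indicator measurableSet_ball,
    ← integral_add_left_eq_self _ a]
  refine integral_congr_ae (Eventually.of_forall fun x => ?_)
  by_cases hx : x ∈ Metric.ball (0 : ℂ) r
  · have : a + x ∈ Metric.ball a r := by simpa using hx
    simp only [Set.indicator_of_mem hx, Set.indicator_of_mem this]
  · have : a + x ∉ Metric.ball a r := by simpa using hx
    simp only [Set.indicator_of_notMem hx, Set.indicator_of_notMem this]

/-- Superharmonicity of the kernel. The case a = z has to be excluded because the kernel is 0 on the
diagonal by convention, while its averages over small discs are positive. -/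
theorem setIntegral_logKernel_ball_le_center {a z : ℂ} (hz : a ≠ z) {r : ℝ} (hr : 0 < r) :
    ∫ x in Metric.ball a r, logKernel x z ≤ Real.pi * r ^ 2 * logKernel a z := by
  have h := log_norm_le_setIntegral_ball (sub_ne_zero.2 hz.symm) hr
  rw [setIntegral_ball_eq]
  simp_rw [logKernel_eq_neg_log]
  rw [integral_neg, mul_neg, neg_le_neg_iff, norm_sub_rev a z]
  refine h.trans_eq (integral_congr_ae (Eventually.of_forall fun x => ?_))
  dsimp only
  congr 2
  ring

/-- In the expansion of |a + x|² the cross term is odd and integrates to zero. -/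
theorem setIntegral_norm_sq_ball (a : ℂ) {r : ℝ} (hr : 0 < r) :
    Real.pi * r ^ 2 * ‖a‖ ^ 2 ≤ ∫ x in Metric.ball a r, ‖x‖ ^ 2 ∧
    ∫ x in Metric.ball a r, ‖x‖ ^ 2 ≤ Real.pi * r ^ 2 * (‖a‖ ^ 2 + r ^ 2) := by
  have hc : ∀ f : ℂ → ℝ, Continuous f → IntegrableOn f (Metric.ball 0 r) := fun f hf =>
    (hf.continuousOn.integrableOn_compact (isCompact_closedBall (0 : ℂ) r)).mono_set
      Metric.ball_subset_closedBall
  have hodd : ∫ x in Metric.ball (0 : ℂ) r, inner ℝ a x = 0 := by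
    have h : ∫ x in Metric.ball (0 : ℂ) r, inner ℝ a x =
        - ∫ x in Metric.ball (0 : ℂ) r, inner ℝ a x := by
      rw [← integral_neg, ← integral_indicator measurableSet_ball,
        ← integral_indicator measurableSet_ball, ← integral_neg_eq_self]
      refine integral_congr_ae (Eventually.of_forall fun x => ?_)
      by_cases hx : x ∈ Metric.ball (0 : ℂ) r
      · have : -x ∈ Metric.ball (0 : ℂ) r := by simpa using hx
        simp only [Set.indicator_of_mem hx, Set.indicator_of_mem this, inner_neg_right]
      · have : -x ∉ Metric.ball (0 : ℂ) r := by simpa using hx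
        simp only [Set.indicator_of_notMem hx, Set.indicator_of_notMem this]
    linarith
  have hexp : ∫ x in Metric.ball a r, ‖x‖ ^ 2 =
      Real.pi * r ^ 2 * ‖a‖ ^ 2 + ∫ x in Metric.ball (0 : ℂ) r, ‖x‖ ^ 2 := by
    rw [setIntegral_ball_eq]
    simp_rw [norm_add_sq_real]
    rw [integral_add (hc _ (by fun_prop)) (hc _ (by fun_prop)),
      integral_add (hc _ (by fun_prop)) (hc _ (by fun_prop)), integral_const_mul, hodd,
      setIntegral_const, volume_real_ball _ hr.le, smul_eq_mul]
    ring
  have h1 : ∫ x in Metric.ball (0 : ℂ) r, ‖x‖ ^ 2 ≤ Real.pi * r ^ 2 * r ^ 2 := by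
    rw [← volume_real_ball (0 : ℂ) hr.le, ← smul_eq_mul (a := volume.real _), ← setIntegral_const]
    refine setIntegral_mono_on (hc _ (by fun_prop)) (hc _ (by fun_prop)) measurableSet_ball ?_
    intro x hx
    rw [mem_ball_zero_iff] at hx
    gcongr
  have h2 : 0 ≤ ∫ x in Metric.ball (0 : ℂ) r, ‖x‖ ^ 2 := integral_nonneg fun _ => by positivity
  rw [hexp]
  constructor <;> linarith

/-! ### Positivity of the logarithmic energy of neutral charge distributions -/

/-- The mutual logarithmic energy of two charge densities. -/
noncomputable def logEnergy (σ τ : ℂ → ℝ) : ℝ :=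
  ∫ p : ℂ × ℂ, σ p.1 * logKernel p.1 p.2 * τ p.2

theorem ae_fst_ne_snd : ∀ᵐ p : ℂ × ℂ, p.1 ≠ p.2 := by
  have h : MeasurableSet {p : ℂ × ℂ | p.1 = p.2} := isClosed_diagonal.measurableSet
  have h0 : volume {p : ℂ × ℂ | p.1 = p.2} = 0 := by
    rw [Measure.volume_eq_prod, Measure.measure_prod_null h]
    refine Eventually.of_forall fun x => ?_
    have : Prod.mk x ⁻¹' {p : ℂ × ℂ | p.1 = p.2} = {x} := by
      ext y; simp [eq_comm]
    simp only [this]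
    simp
  rw [ae_iff]
  simpa using h0

/-- The Gaussian layer `t⁻¹ (exp (-t a) - exp (-t))` of `log (1 / a)`. -/
noncomputable def gaussLayer (a t : ℝ) : ℝ := t⁻¹ * (Real.exp (-(a * t)) - Real.exp (-(1 * t)))

/-- The difference of exponentials is at most t |a − 1| exp(−min(a, 1) t), which cancels the factor
t⁻¹ at 0 and decays at infinity. -/
theorem integrableOn_gaussLayer {a : ℝ} (ha : 0 < a) :
    IntegrableOn (gaussLayer a) (Set.Ioi 0) := by
  set m := min a 1 with hm
  have hm0 : 0 < m := lt_min ha one_pos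
  have h1 : IntegrableOn (fun t : ℝ => |a - 1| * Real.exp (-m * t)) (Set.Ioi 0) :=
    (integrableOn_exp_mul_Ioi (by linarith) 0).const_mul _
  refine h1.mono' (by unfold gaussLayer; fun_prop) ?_
  rw [ae_restrict_iff' measurableSet_Ioi]
  refine Eventually.of_forall fun t ht => ?_
  have ht : 0 < t := ht
  have key : ∀ u v : ℝ, u ≤ v → |Real.exp (-(u * t)) - Real.exp (-(v * t))| ≤
      t * ((v - u) * Real.exp (-u * t)) := by
    intro u v huv
    have h2 : Real.exp (-(v * t)) ≤ Real.exp (-(u * t)) := by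
      gcongr
    rw [abs_of_nonneg (by linarith)]
    have h3 : Real.exp (-(v * t)) = Real.exp (-(u * t)) * Real.exp (-((v - u) * t)) := by
      rw [← Real.exp_add]; ring_nf
    have h4 := Real.add_one_le_exp (-((v - u) * t))
    have h5 := Real.exp_pos (-(u * t))
    rw [h3, neg_mul]
    nlinarith
  unfold gaussLayer
  rw [norm_mul, Real.norm_eq_abs, Real.norm_eq_abs, abs_inv, abs_of_pos ht,
    inv_mul_le_iff₀ ht]
  rcases le_total a 1 with h | h
  · rw [hm, min_eq_left h, abs_sub_comm a 1, abs_of_nonneg (sub_nonneg.2 h)]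
    exact key a 1 h
  · rw [hm, min_eq_right h, abs_of_nonneg (sub_nonneg.2 h), abs_sub_comm]
    exact key 1 a h

theorem integral_gaussLayer {a : ℝ} (ha : 0 < a) :
    ∫ t in Set.Ioi 0, gaussLayer a t = Real.log (1 / a) := by
  have h := Frullani.integral_Ioi_eq (f := fun t => Real.exp (-t)) (a := a) (b := 1) (L := 1)
    (R := 0) ((by fun_prop : Continuous fun t : ℝ => Real.exp (-t)).locallyIntegrable.locallyIntegrableOn _)
    ha one_pos ?_ Real.tendsto_exp_neg_atTop_nhds_zero (integrableOn_gaussLayer ha)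
  · simpa [gaussLayer] using h
  · have : Tendsto (fun t : ℝ => Real.exp (-t)) (nhds 0) (nhds (Real.exp (-0))) :=
      (by fun_prop : Continuous fun t : ℝ => Real.exp (-t)).tendsto 0
    simp only [neg_zero, Real.exp_zero] at this
    exact this.mono_left nhdsWithin_le_nhds

/-- For fixed a the layers all have the same sign. This turns absolute convergence of the
logarithmic energy into the Fubini hypothesis of `logEnergy_self_nonneg`. -/
theorem integral_norm_gaussLayer {a : ℝ} (ha : 0 < a) :
    ∫ t in Set.Ioi 0, ‖gaussLayer a t‖ = |Real.log (1 / a)| := by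
  rw [← integral_gaussLayer ha]
  rcases le_total a 1 with h | h
  · have : ∀ t ∈ Set.Ioi (0 : ℝ), 0 ≤ gaussLayer a t := fun t ht => by
      have ht : 0 < t := ht
      refine mul_nonneg (by positivity) (sub_nonneg.2 ?_)
      gcongr
    rw [abs_of_nonneg (setIntegral_nonneg measurableSet_Ioi this)]
    exact setIntegral_congr_fun measurableSet_Ioi fun t ht => Real.norm_of_nonneg (this t ht)
  · have : ∀ t ∈ Set.Ioi (0 : ℝ), gaussLayer a t ≤ 0 := fun t ht => by
      have ht : 0 < t := ht
      refine mul_nonpos_of_nonneg_of_nonpos (by positivity) (sub_nonpos.2 ?_)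
      gcongr
    rw [abs_of_nonpos (setIntegral_nonpos measurableSet_Ioi this), ← integral_neg]
    exact setIntegral_congr_fun measurableSet_Ioi fun t ht => Real.norm_of_nonpos (this t ht)

/-- The parallelogram law completes the square around the midpoint of x and y: a Gaussian is, up to
a factor, a narrower Gaussian convolved with itself. -/
theorem integral_gaussian_mul_gaussian {t : ℝ} (ht : 0 < t) (x y : ℂ) :
    ∫ z : ℂ, Real.exp (-(2 * t * ‖x - z‖ ^ 2)) * Real.exp (-(2 * t * ‖y - z‖ ^ 2)) =
      Real.pi / (4 * t) * Real.exp (-(‖x - y‖ ^ 2 * t)) := by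
  have h : ∀ z : ℂ, Real.exp (-(2 * t * ‖x - z‖ ^ 2)) * Real.exp (-(2 * t * ‖y - z‖ ^ 2)) =
      Real.exp (-(‖x - y‖ ^ 2 * t)) * Real.exp (-(4 * t) * ‖(x + y) / 2 - z‖ ^ 2) := by
    intro z
    rw [← Real.exp_add, ← Real.exp_add]
    congr 1
    have := parallelogram_law_with_norm ℝ (x - z) (y - z)
    have h1 : x - z + (y - z) = 2 * ((x + y) / 2 - z) := by ring
    have h2 : x - z - (y - z) = x - y := by ring
    rw [h1, h2, norm_mul] at this
    simp only [Complex.norm_ofNat] at this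
    nlinarith
  simp_rw [h]
  rw [integral_const_mul, integral_sub_left_eq_self (fun z : ℂ => Real.exp (-(4 * t) * ‖z‖ ^ 2)),
    GaussianFourier.integral_rexp_neg_mul_sq_norm (by positivity)]
  simp [mul_comm]

theorem integrable_gaussian_mul_gaussian {t : ℝ} (ht : 0 < t) (x y : ℂ) :
    Integrable fun z : ℂ =>
      Real.exp (-(2 * t * ‖x - z‖ ^ 2)) * Real.exp (-(2 * t * ‖y - z‖ ^ 2)) := by
  refine Integrable.of_integral_ne_zero ?_
  rw [integral_gaussian_mul_gaussian ht]
  positivity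

/-- The self-convolution turns the form into a positive multiple of ∫ (∫ σ(x) exp(−2t|x − z|²) dx)²
dz. -/
theorem gaussian_form_nonneg {σ : ℂ → ℝ} (hσ : Integrable σ) {t : ℝ} (ht : 0 < t) :
    0 ≤ ∫ p : ℂ × ℂ, σ p.1 * σ p.2 * Real.exp (-(‖p.1 - p.2‖ ^ 2 * t)) := by
  have hss : Integrable fun p : ℂ × ℂ => σ p.1 * σ p.2 := hσ.mul_prod hσ
  set F : ℂ × ℂ → ℂ → ℝ := fun p z => σ p.1 * σ p.2 *
    (Real.exp (-(2 * t * ‖p.1 - z‖ ^ 2)) * Real.exp (-(2 * t * ‖p.2 - z‖ ^ 2))) with hF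
  have hFi : Integrable (Function.uncurry F) ((volume : Measure (ℂ × ℂ)).prod volume) := by
    rw [integrable_prod_iff]
    · refine ⟨Eventually.of_forall fun p =>
        (integrable_gaussian_mul_gaussian ht p.1 p.2).const_mul (σ p.1 * σ p.2), ?_⟩
      have : (fun p : ℂ × ℂ => ∫ z, ‖Function.uncurry F (p, z)‖) = fun p =>
          ‖σ p.1 * σ p.2‖ * (Real.pi / (4 * t) * Real.exp (-(‖p.1 - p.2‖ ^ 2 * t))) := by
        funext p
        rw [← integral_gaussian_mul_gaussian ht, ← integral_const_mul]
        refine integral_congr_ae (Eventually.of_forall fun z => ?_)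
        simp only [Function.uncurry_apply_pair, hF]
        rw [norm_mul (σ p.1 * σ p.2), Real.norm_of_nonneg (by positivity :
          0 ≤ Real.exp (-(2 * t * ‖p.1 - z‖ ^ 2)) * Real.exp (-(2 * t * ‖p.2 - z‖ ^ 2)))]
      rw [this]
      refine (hss.norm.mul_const (Real.pi / (4 * t))).mono' ?_ (Eventually.of_forall fun p => ?_)
      · exact hss.norm.aestronglyMeasurable.mul
          (by fun_prop : Continuous fun p : ℂ × ℂ =>
            Real.pi / (4 * t) * Real.exp (-(‖p.1 - p.2‖ ^ 2 * t))).aestronglyMeasurable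
      · rw [norm_mul, norm_norm]
        gcongr
        rw [Real.norm_of_nonneg (by positivity)]
        have : Real.exp (-(‖p.1 - p.2‖ ^ 2 * t)) ≤ 1 := Real.exp_le_one_iff.2 (by
          have : 0 ≤ ‖p.1 - p.2‖ ^ 2 * t := by positivity
          linarith)
        exact mul_le_of_le_one_right (by positivity) this
    · exact hss.aestronglyMeasurable.comp_fst.mul
        (by fun_prop : Continuous fun q : (ℂ × ℂ) × ℂ =>
          Real.exp (-(2 * t * ‖q.1.1 - q.2‖ ^ 2)) *
            Real.exp (-(2 * t * ‖q.1.2 - q.2‖ ^ 2))).aestronglyMeasurable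
  have h1 : ∫ p : ℂ × ℂ, ∫ z, F p z =
      Real.pi / (4 * t) * ∫ p : ℂ × ℂ, σ p.1 * σ p.2 * Real.exp (-(‖p.1 - p.2‖ ^ 2 * t)) := by
    rw [← integral_const_mul]
    refine integral_congr_ae (Eventually.of_forall fun p => ?_)
    simp only [hF]
    rw [integral_const_mul, integral_gaussian_mul_gaussian ht]
    ring
  have h2 : 0 ≤ ∫ z, ∫ p : ℂ × ℂ, F p z := by
    refine integral_nonneg fun z => ?_
    have : ∫ p : ℂ × ℂ, F p z = (∫ x, σ x * Real.exp (-(2 * t * ‖x - z‖ ^ 2))) *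
        ∫ x, σ x * Real.exp (-(2 * t * ‖x - z‖ ^ 2)) := by
      rw [Measure.volume_eq_prod, ← integral_prod_mul]
      refine integral_congr_ae (Eventually.of_forall fun p => ?_)
      simp only [hF]
      ring
    simp only [this, Pi.zero_apply]
    exact mul_self_nonneg _
  rw [← integral_integral_swap hFi, h1] at h2
  exact nonneg_of_mul_nonneg_right h2 (by positivity)

/-- By Frullani, 2 log(1/|x − y|) = ∫ t⁻¹ (exp(−t|x − y|²) − exp(−t)) dt over t > 0. Neutrality of σ
removes the constant exp(−t), and what remains is a superposition of nonnegative Gaussian forms. -/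
theorem logEnergy_self_nonneg {σ : ℂ → ℝ} (hσ : Integrable σ) (h0 : ∫ x, σ x = 0)
    (hL : Integrable fun p : ℂ × ℂ => σ p.1 * logKernel p.1 p.2 * σ p.2) :
    0 ≤ logEnergy σ σ := by
  have hss : Integrable fun p : ℂ × ℂ => σ p.1 * σ p.2 := hσ.mul_prod hσ
  set F : ℂ × ℂ → ℝ → ℝ := fun p t => σ p.1 * σ p.2 * gaussLayer (‖p.1 - p.2‖ ^ 2) t with hF
  have hlog : ∀ x y : ℂ, Real.log (1 / ‖x - y‖ ^ 2) = 2 * logKernel x y := by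
    intro x y
    rw [logKernel, one_div, one_div, ← inv_pow, Real.log_pow]
    norm_num
  have hpos : ∀ p : ℂ × ℂ, p.1 ≠ p.2 → 0 < ‖p.1 - p.2‖ ^ 2 := fun p hp => by
    have := norm_pos_iff.2 (sub_ne_zero.2 hp)
    positivity
  have hFi : Integrable (Function.uncurry F)
      ((volume : Measure (ℂ × ℂ)).prod (volume.restrict (Set.Ioi 0))) := by
    rw [integrable_prod_iff]
    · constructor
      · filter_upwards [ae_fst_ne_snd] with p hp
        exact (integrableOn_gaussLayer (hpos p hp)).const_mul (σ p.1 * σ p.2)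
      · refine (hL.norm.const_mul 2).congr ?_
        filter_upwards [ae_fst_ne_snd] with p hp
        have : ∫ t in Set.Ioi 0, ‖Function.uncurry F (p, t)‖ =
            ‖σ p.1 * σ p.2‖ * |Real.log (1 / ‖p.1 - p.2‖ ^ 2)| := by
          rw [← integral_norm_gaussLayer (hpos p hp), ← integral_const_mul]
          simp only [Function.uncurry_apply_pair, hF, norm_mul]
        rw [this, hlog, abs_mul]
        simp only [norm_mul, Real.norm_eq_abs]
        norm_num
        ring
    · exact hss.aestronglyMeasurable.comp_fst.mul
        (by unfold gaussLayer; fun_prop : Measurable fun q : (ℂ × ℂ) × ℝ =>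
          gaussLayer (‖q.1.1 - q.1.2‖ ^ 2) q.2).aestronglyMeasurable
  have h1 : ∫ p : ℂ × ℂ, ∫ t in Set.Ioi 0, F p t = 2 * logEnergy σ σ := by
    rw [logEnergy, ← integral_const_mul]
    refine integral_congr_ae ?_
    filter_upwards [ae_fst_ne_snd] with p hp
    simp only [hF]
    rw [integral_const_mul, integral_gaussLayer (hpos p hp), hlog]
    ring
  have h2 : 0 ≤ ∫ t in Set.Ioi 0, ∫ p : ℂ × ℂ, F p t := by
    refine setIntegral_nonneg measurableSet_Ioi fun t ht => ?_
    have ht : 0 < t := ht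
    have hg : Integrable fun p : ℂ × ℂ =>
        σ p.1 * σ p.2 * Real.exp (-(‖p.1 - p.2‖ ^ 2 * t)) := by
      refine hss.mul_bdd (c := 1) (by fun_prop) (Eventually.of_forall fun p => ?_)
      rw [Real.norm_of_nonneg (by positivity)]
      refine Real.exp_le_one_iff.2 ?_
      have : 0 ≤ ‖p.1 - p.2‖ ^ 2 * t := by positivity
      linarith
    have h3 : ∫ p : ℂ × ℂ, F p t =
        t⁻¹ * ((∫ p : ℂ × ℂ, σ p.1 * σ p.2 * Real.exp (-(‖p.1 - p.2‖ ^ 2 * t))) -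
          (∫ p : ℂ × ℂ, σ p.1 * σ p.2 * Real.exp (-(1 * t)))) := by
      rw [← integral_sub hg (hss.mul_const _), ← integral_const_mul]
      refine integral_congr_ae (Eventually.of_forall fun p => ?_)
      simp only [hF, gaussLayer]
      ring
    have h4 : ∫ p : ℂ × ℂ, σ p.1 * σ p.2 * Real.exp (-(1 * t)) = 0 := by
      rw [integral_mul_const, Measure.volume_eq_prod, integral_prod_mul, h0]
      simp
    rw [h3, h4, sub_zero]
    exact mul_nonneg (by positivity) (gaussian_form_nonneg hσ ht)
  rw [← integral_integral_swap hFi, h1] at h2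
  linarith

/-! ### The logarithmic potential inverts the Laplacian -/

/-- The Laplacian of a function on the plane. -/
noncomputable def planeLaplacian (χ : ℂ → ℝ) (x : ℂ) : ℝ :=
  fderiv ℝ (fun y => fderiv ℝ χ y 1) x 1 + fderiv ℝ (fun y => fderiv ℝ χ y Complex.I) x Complex.I

/-- The normalized density `π⁻¹ (1 + |w|²)⁻²`. -/
noncomputable def peakDensity (w : ℂ) : ℝ := Real.pi⁻¹ * ((1 + ‖w‖ ^ 2) ^ 2)⁻¹

theorem integral_peakDensity : ∫ w, peakDensity w = 1 := by
  have h := integral_fun_norm_addHaar (volume : Measure ℂ)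
    (fun y : ℝ => Real.pi⁻¹ * ((1 + y ^ 2) ^ 2)⁻¹)
  have hd : ∀ y : ℝ, HasDerivAt (fun y : ℝ => -(2 * Real.pi * (1 + y ^ 2))⁻¹)
      (y * (Real.pi⁻¹ * ((1 + y ^ 2) ^ 2)⁻¹)) y := by
    intro y
    have h1 : HasDerivAt (fun y : ℝ => 2 * Real.pi * (1 + y ^ 2)) (2 * Real.pi * (2 * y)) y := by
      have := ((hasDerivAt_pow 2 y).const_add 1).const_mul (2 * Real.pi)
      simpa using this
    have h2 := (h1.inv (by positivity)).neg
    convert! h2 using 1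
    field_simp
  have hI : ∫ y in Set.Ioi (0 : ℝ), y * (Real.pi⁻¹ * ((1 + y ^ 2) ^ 2)⁻¹) = (2 * Real.pi)⁻¹ := by
    have ht : Tendsto (fun y : ℝ => -(2 * Real.pi * (1 + y ^ 2))⁻¹) atTop (nhds (-0)) := by
      refine (tendsto_inv_atTop_zero.comp ?_).neg
      refine Tendsto.const_mul_atTop (by positivity) ?_
      exact tendsto_atTop_add_const_left _ _ (tendsto_pow_atTop (by norm_num))
    rw [integral_Ioi_of_hasDerivAt_of_nonneg' (fun y _ => hd y) (fun y hy => ?_) ht]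
    · simp
    · have hy : 0 < y := hy
      positivity
  simp only [Complex.finrank_real_complex, Nat.add_one_sub_one, pow_one, smul_eq_mul] at h
  rw [hI] at h
  unfold peakDensity
  rw [h, volume_real_ball _ zero_le_one]
  simp

theorem tendsto_integral_peakDensity {g : ℂ → ℝ} (hg : Integrable g) (hc : Continuous g) (x : ℂ) :
    Tendsto (fun c : ℝ => ∫ y, c ^ 2 * peakDensity (c • (x - y)) * g y) atTop (nhds (g x)) := by
  have h := tendsto_integral_comp_smul_smul_of_integrable' (μ := (volume : Measure ℂ))
    (φ := peakDensity) (fun w => by unfold peakDensity; positivity) integral_peakDensity ?_ hg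
    (hc.continuousAt (x := x))
  · simpa using h
  · rw [Complex.finrank_real_complex]
    have h1 : Tendsto (fun w : ℂ => Real.pi⁻¹ * (1 + ‖w‖ ^ 2)⁻¹) (Bornology.cobounded ℂ)
        (nhds (Real.pi⁻¹ * 0)) := by
      refine (tendsto_inv_atTop_zero.comp ?_).const_mul _
      exact tendsto_atTop_add_const_left _ _
        ((tendsto_pow_atTop (by norm_num)).comp tendsto_norm_cobounded_atTop)
    rw [mul_zero] at h1
    refine squeeze_zero (fun w => by unfold peakDensity; positivity) (fun w => ?_) h1
    unfold peakDensity
    have h2 : 0 < 1 + ‖w‖ ^ 2 := by positivity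
    calc ‖w‖ ^ 2 * (Real.pi⁻¹ * ((1 + ‖w‖ ^ 2) ^ 2)⁻¹)
        ≤ (1 + ‖w‖ ^ 2) * (Real.pi⁻¹ * ((1 + ‖w‖ ^ 2) ^ 2)⁻¹) := by
          gcongr; linarith
      _ = Real.pi⁻¹ * (1 + ‖w‖ ^ 2)⁻¹ := by field_simp

/-- The regularized logarithmic kernel. -/
noncomputable def regLog (η : ℝ) (x y : ℂ) : ℝ := -(1 / 2) * Real.log (‖x - y‖ ^ 2 + η)

theorem hasFDerivAt_normSq_sub (η : ℝ) (x y : ℂ) :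
    HasFDerivAt (fun y : ℂ => ‖x - y‖ ^ 2 + η) (-(2 • innerSL ℝ (x - y))) y := by
  have h := (((hasFDerivAt_id y).const_sub x).norm_sq).add_const η
  refine h.congr_fderiv ?_
  ext w
  simp
  ring

theorem hasFDerivAt_regLog {η : ℝ} (hη : 0 < η) (x y : ℂ) :
    HasFDerivAt (regLog η x) ((‖x - y‖ ^ 2 + η)⁻¹ • innerSL ℝ (x - y)) y := by
  have h := ((hasFDerivAt_normSq_sub η x y).log (by positivity)).const_mul (-(1 / 2))
  refine h.congr_fderiv ?_
  ext w
  simp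
  ring

theorem fderiv_regLog_apply {η : ℝ} (hη : 0 < η) (x y v : ℂ) :
    fderiv ℝ (regLog η x) y v = (‖x - y‖ ^ 2 + η)⁻¹ * inner ℝ (x - y) v := by
  rw [(hasFDerivAt_regLog hη x y).fderiv, smul_apply, innerSL_apply_apply, smul_eq_mul]

theorem hasFDerivAt_fderiv_regLog {η : ℝ} (hη : 0 < η) (x y v : ℂ) :
    HasFDerivAt (fun y => (‖x - y‖ ^ 2 + η)⁻¹ * inner ℝ (x - y) v)
      ((‖x - y‖ ^ 2 + η)⁻¹ • -(innerSL ℝ v) + (inner ℝ (x - y) v) •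
        (-((‖x - y‖ ^ 2 + η) ^ 2)⁻¹ • -(2 • innerSL ℝ (x - y)))) y := by
  have hi : HasFDerivAt (fun y : ℂ => inner ℝ (x - y) v) (-(innerSL ℝ v)) y := by
    have h := (((hasFDerivAt_id y).const_sub x).inner ℝ (hasFDerivAt_const v y))
    refine h.congr_fderiv ?_
    ext w
    simp [real_inner_comm]
  have h1 := (hasDerivAt_inv (x := ‖x - y‖ ^ 2 + η) (by positivity)).comp_hasFDerivAt y
    (hasFDerivAt_normSq_sub η x y)
  exact h1.mul hi

/-- With η = c⁻² the right side is −2π c² `peakDensity` (c (x − y)), that is −2π times an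
approximate identity as c → ∞. -/
theorem planeLaplacian_regLog {η : ℝ} (hη : 0 < η) (x y : ℂ) :
    planeLaplacian (regLog η x) y = -(2 * η / (‖x - y‖ ^ 2 + η) ^ 2) := by
  have h : ∀ v : ℂ, (fun y => fderiv ℝ (regLog η x) y v) =
      fun y => (‖x - y‖ ^ 2 + η)⁻¹ * inner ℝ (x - y) v := fun v =>
    funext fun y => fderiv_regLog_apply hη x y v
  have hn : ‖x - y‖ ^ 2 = (x - y).re ^ 2 + (x - y).im ^ 2 := by
    rw [Complex.sq_norm, Complex.normSq_apply]; ring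
  have hne : ‖x - y‖ ^ 2 + η ≠ 0 := by positivity
  unfold planeLaplacian
  rw [h, h, (hasFDerivAt_fderiv_regLog hη x y 1).fderiv,
    (hasFDerivAt_fderiv_regLog hη x y Complex.I).fderiv]
  simp only [add_apply, smul_apply, neg_apply, innerSL_apply_apply, Complex.inner, smul_eq_mul, nsmul_eq_mul]
  rw [hn] at hne ⊢
  simp
  field_simp
  ring

section IntegrationByParts

variable {f χ : ℂ → ℝ}

theorem integral_mul_fderiv_eq (hf : ContDiff ℝ 1 f) (hχ : ContDiff ℝ 1 χ)
    (hs : HasCompactSupport χ) (v : ℂ) :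
    ∫ y, f y * fderiv ℝ χ y v = -∫ y, fderiv ℝ f y v * χ y := by
  have c1 : Continuous fun y => fderiv ℝ f y v :=
    (hf.continuous_fderiv one_ne_zero).clm_apply continuous_const
  have c2 : Continuous fun y => fderiv ℝ χ y v :=
    (hχ.continuous_fderiv one_ne_zero).clm_apply continuous_const
  refine integral_mul_fderiv_eq_neg_fderiv_mul_of_integrable ?_ ?_ ?_ ?_ ?_
  · exact (c1.mul hχ.continuous).integrable_of_hasCompactSupport hs.mul_left
  · exact (hf.continuous.mul c2).integrable_of_hasCompactSupport (hs.fderiv_apply (𝕜 := ℝ) v).mul_left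
  · exact (hf.continuous.mul hχ.continuous).integrable_of_hasCompactSupport hs.mul_left
  · exact fun x _ => hf.differentiable one_ne_zero x
  · exact fun x _ => hχ.differentiable one_ne_zero x

theorem contDiff_fderiv_apply (hχ : ContDiff ℝ 2 χ) (v : ℂ) :
    ContDiff ℝ 1 fun y => fderiv ℝ χ y v :=
  (hχ.fderiv_right (m := 1) (by norm_num)).clm_apply contDiff_const

theorem continuous_planeLaplacian (hχ : ContDiff ℝ 2 χ) : Continuous (planeLaplacian χ) := by
  unfold planeLaplacian
  have h : ∀ v : ℂ, Continuous fun x => fderiv ℝ (fun y => fderiv ℝ χ y v) x v := fun v =>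
    ((contDiff_fderiv_apply hχ v).continuous_fderiv one_ne_zero).clm_apply continuous_const
  exact (h 1).add (h Complex.I)

theorem hasCompactSupport_planeLaplacian (hs : HasCompactSupport χ) :
    HasCompactSupport (planeLaplacian χ) :=
  ((hs.fderiv_apply (𝕜 := ℝ) 1).fderiv_apply (𝕜 := ℝ) 1).add
    ((hs.fderiv_apply (𝕜 := ℝ) Complex.I).fderiv_apply (𝕜 := ℝ) Complex.I)

theorem integrable_fderiv_fderiv (hf : ContDiff ℝ 1 f) (hχ : ContDiff ℝ 1 χ)
    (hs : HasCompactSupport χ) (v : ℂ) :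
    Integrable fun y => f y * fderiv ℝ χ y v :=
  (hf.continuous.mul ((hχ.continuous_fderiv one_ne_zero).clm_apply
    continuous_const)).integrable_of_hasCompactSupport (hs.fderiv_apply (𝕜 := ℝ) v).mul_left

theorem integral_mul_planeLaplacian (hf : ContDiff ℝ 1 f) (hχ : ContDiff ℝ 2 χ)
    (hs : HasCompactSupport χ) :
    ∫ y, f y * planeLaplacian χ y = -((∫ y, fderiv ℝ f y 1 * fderiv ℝ χ y 1) +
      ∫ y, fderiv ℝ f y Complex.I * fderiv ℝ χ y Complex.I) := by
  unfold planeLaplacian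
  simp_rw [mul_add]
  rw [integral_add (integrable_fderiv_fderiv hf (contDiff_fderiv_apply hχ 1)
      (hs.fderiv_apply (𝕜 := ℝ) 1) 1)
    (integrable_fderiv_fderiv hf (contDiff_fderiv_apply hχ _) (hs.fderiv_apply (𝕜 := ℝ) _) _),
    integral_mul_fderiv_eq hf (contDiff_fderiv_apply hχ _) (hs.fderiv_apply (𝕜 := ℝ) _),
    integral_mul_fderiv_eq hf (contDiff_fderiv_apply hχ _) (hs.fderiv_apply (𝕜 := ℝ) _)]
  ring

theorem integral_planeLaplacian (hχ : ContDiff ℝ 2 χ) (hs : HasCompactSupport χ) :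
    ∫ y, planeLaplacian χ y = 0 := by
  have := integral_mul_planeLaplacian (f := fun _ => 1) contDiff_const hχ hs
  simpa using this

theorem integral_mul_planeLaplacian_symm (hf : ContDiff ℝ 2 f) (hχ : ContDiff ℝ 2 χ)
    (hs : HasCompactSupport χ) :
    ∫ y, f y * planeLaplacian χ y = ∫ y, planeLaplacian f y * χ y := by
  have hχ1 : ContDiff ℝ 1 χ := hχ.of_le (by norm_num)
  have hi : ∀ v : ℂ, Integrable fun y => fderiv ℝ (fun y => fderiv ℝ f y v) y v * χ y := fun v =>
    ((((contDiff_fderiv_apply hf v).continuous_fderiv one_ne_zero).clm_apply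
      continuous_const).mul hχ.continuous).integrable_of_hasCompactSupport hs.mul_left
  rw [integral_mul_planeLaplacian (hf.of_le (by norm_num)) hχ hs,
    integral_mul_fderiv_eq (contDiff_fderiv_apply hf _) hχ1 hs,
    integral_mul_fderiv_eq (contDiff_fderiv_apply hf _) hχ1 hs]
  unfold planeLaplacian
  simp_rw [add_mul]
  rw [integral_add (hi _) (hi _)]
  ring

theorem contDiff_regLog {η : ℝ} (hη : 0 < η) (x : ℂ) : ContDiff ℝ 2 (regLog η x) := by
  unfold regLog
  refine contDiff_const.mul (ContDiff.log ?_ fun y => by positivity)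
  exact ((contDiff_const.sub contDiff_id).norm_sq ℝ).add contDiff_const

/-- A majorant uniform in η, for the limit η → 0. The condition η ≤ 1 gives log(r² + η) ≤ r². -/
theorem abs_regLog_le {η : ℝ} (hη : 0 < η) (h1 : η ≤ 1) {x y : ℂ} (hxy : x ≠ y) :
    |regLog η x y| ≤ nearKernel (x - y) + ‖x - y‖ ^ 2 := by
  have hp : 0 < ‖x - y‖ := norm_pos_iff.2 (sub_ne_zero.2 hxy)
  have h0 := nearKernel_nonneg (x - y)
  have h2 : Real.log (‖x - y‖ ^ 2) ≤ Real.log (‖x - y‖ ^ 2 + η) :=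
    Real.log_le_log (by positivity) (by linarith)
  have h3 : Real.log (‖x - y‖ ^ 2 + η) ≤ ‖x - y‖ ^ 2 := by
    have := Real.log_le_sub_one_of_pos (x := ‖x - y‖ ^ 2 + η) (by positivity)
    linarith
  have h4 : -Real.log ‖x - y‖ ≤ nearKernel (x - y) := by
    rw [← Real.log_inv]; exact le_max_right _ _
  rw [Real.log_pow] at h2
  push_cast at h2
  have h5 : 0 ≤ ‖x - y‖ ^ 2 := by positivity
  unfold regLog
  rw [abs_le]
  constructor <;> linarith

/-- The logarithmic potential of `-Δχ / (2π)` is `χ`. -/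
theorem integral_logKernel_mul_planeLaplacian (hχ : ContDiff ℝ 2 χ) (hs : HasCompactSupport χ)
    (x : ℂ) : ∫ y, logKernel x y * planeLaplacian χ y = -(2 * Real.pi) * χ x := by
  have hL := continuous_planeLaplacian hχ
  have hLs := hasCompactSupport_planeLaplacian hs
  -- The kernel is regularized with η = c⁻² and the Laplacian is moved onto it by Green's identity.
  -- The integral then has two limits as c → ∞, which must agree: one by dominated convergence, one
  -- by the approximate identity.
  have h1 : Tendsto (fun c : ℝ => ∫ y, regLog (c ^ 2)⁻¹ x y * planeLaplacian χ y) atTop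
      (nhds (∫ y, logKernel x y * planeLaplacian χ y)) := by
    refine tendsto_integral_filter_of_dominated_convergence
      (fun y => (nearKernel (x - y) + ‖x - y‖ ^ 2) * |planeLaplacian χ y|) ?_ ?_ ?_ ?_
    · refine Eventually.of_forall fun c => ?_
      unfold regLog
      have := hL.measurable
      fun_prop
    · filter_upwards [eventually_ge_atTop 1] with c hc
      filter_upwards [compl_mem_ae_iff.2 (measure_singleton (μ := volume) x)] with y hy
      rw [norm_mul, Real.norm_eq_abs, Real.norm_eq_abs]
      gcongr
      refine abs_regLog_le (by positivity) (inv_le_one_of_one_le₀ ?_) (Ne.symm hy)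
      exact one_le_pow₀ hc
    · simp_rw [add_mul]
      refine Integrable.add ?_ ?_
      · obtain ⟨B, hB⟩ := hL.bounded_above_of_compact_support hLs
        exact (integrable_nearKernel_sub x).mul_bdd (c := B) hL.abs.aestronglyMeasurable
          (Eventually.of_forall fun y => by rw [Real.norm_eq_abs, abs_abs]; exact hB y)
      · refine Continuous.integrable_of_hasCompactSupport (by fun_prop) ?_
        exact hLs.norm.mul_left
    · filter_upwards [compl_mem_ae_iff.2 (measure_singleton (μ := volume) x)] with y hy
      have hp : 0 < ‖x - y‖ := norm_pos_iff.2 (sub_ne_zero.2 (Ne.symm hy))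
      refine Tendsto.mul_const _ ?_
      have h2 : Tendsto (fun c : ℝ => ‖x - y‖ ^ 2 + (c ^ 2)⁻¹) atTop (nhds (‖x - y‖ ^ 2 + 0)) :=
        tendsto_const_nhds.add (tendsto_inv_atTop_zero.comp (tendsto_pow_atTop (by norm_num)))
      have h3 := (h2.log (by positivity)).const_mul (-(1 / 2))
      convert! h3 using 2
      rw [logKernel_eq_neg_log, add_zero, Real.log_pow]
      push_cast
      ring
  have h2 := (tendsto_integral_peakDensity (hχ.continuous.integrable_of_hasCompactSupport hs)
    hχ.continuous x).const_mul (-(2 * Real.pi))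
  refine tendsto_nhds_unique (h1.congr' ?_) h2
  filter_upwards [eventually_gt_atTop 0] with c hc
  have hη : 0 < (c ^ 2)⁻¹ := by positivity
  rw [integral_mul_planeLaplacian_symm (contDiff_regLog hη x) hχ hs, ← integral_const_mul]
  refine integral_congr_ae (Eventually.of_forall fun y => ?_)
  dsimp only
  rw [planeLaplacian_regLog hη, peakDensity, norm_smul, Real.norm_of_nonneg hc.le]
  field_simp
  ring

end IntegrationByParts

/-! ### Duality between the logarithmic energy and the Dirichlet norm -/

/-- Bounded measurable densities supported in a disk. -/
structure IsBoundedDensity (Λ T : ℝ) (β : ℂ → ℝ) : Prop where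
  measurable : Measurable β
  abs_le : ∀ y, |β y| ≤ Λ
  eq_zero : ∀ y, T < ‖y‖ → β y = 0

namespace IsBoundedDensity

variable {Λ T : ℝ} {β : ℂ → ℝ}

theorem nonneg (h : IsBoundedDensity Λ T β) : 0 ≤ Λ := (abs_nonneg _).trans (h.abs_le 0)

theorem integrable_logKernel_mul (h : IsBoundedDensity Λ T β) (x : ℂ) :
    Integrable fun y => logKernel x y * β y :=
  integrable_bdd_mul_logKernel h.measurable h.abs_le h.eq_zero x

theorem abs_le_indicator (h : IsBoundedDensity Λ T β) (y : ℂ) :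
    |β y| ≤ (Metric.closedBall (0 : ℂ) T).indicator (fun _ => Λ) y := by
  by_cases hy : T < ‖y‖
  · rw [h.eq_zero y hy, abs_zero]
    exact Set.indicator_nonneg (fun _ _ => h.nonneg) _
  · rw [Set.indicator_of_mem (by simpa using hy)]
    exact h.abs_le y

theorem integrable_mul (h : IsBoundedDensity Λ T β) {g : ℂ → ℝ} (hg : LocallyIntegrable g) :
    Integrable fun y => g y * β y := by
  have h1 : Integrable ((Metric.closedBall (0 : ℂ) T).indicator g) := by
    rw [integrable_indicator_iff measurableSet_closedBall]
    exact hg.integrableOn_isCompact (isCompact_closedBall 0 T)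
  refine (h1.mul_bdd (c := Λ) h.measurable.aestronglyMeasurable
    (Eventually.of_forall h.abs_le)).congr (Eventually.of_forall fun y => ?_)
  by_cases hy : T < ‖y‖
  · simp [h.eq_zero y hy]
  · simp only [Set.indicator_of_mem (show y ∈ Metric.closedBall (0 : ℂ) T by simpa using hy)]

theorem integrable (h : IsBoundedDensity Λ T β) : Integrable β := by
  simpa using h.integrable_mul (g := fun _ => 1) continuous_const.locallyIntegrable

theorem integrable_norm_mul (h : IsBoundedDensity Λ T β) : Integrable fun y => ‖y‖ * β y :=
  h.integrable_mul continuous_norm.locallyIntegrable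

theorem integral_abs_logKernel_mul_le (h : IsBoundedDensity Λ T β) (x : ℂ) :
    ∫ y, |logKernel x y * β y| ≤ Λ * nearMass + (‖x‖ + T) * ∫ y, |β y| := by
  have h1 : Integrable fun y => Λ * nearKernel (x - y) := (integrable_nearKernel_sub x).const_mul _
  have h2 : Integrable fun y => (‖x‖ + T) * |β y| := h.integrable.abs.const_mul _
  rw [← integral_nearKernel_sub x, ← integral_const_mul, ← integral_const_mul,
    ← integral_add h1 h2]
  refine integral_mono (h.integrable_logKernel_mul x).abs (h1.add h2) fun y => ?_
  dsimp only
  rw [abs_mul]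
  by_cases hy : T < ‖y‖
  · simp only [h.eq_zero y hy, abs_zero, mul_zero, add_zero]
    exact mul_nonneg h.nonneg (nearKernel_nonneg _)
  · have h3 := abs_logKernel_le x y
    have h4 := norm_sub_le x y
    have h5 := not_lt.1 hy
    have h6 := nearKernel_nonneg (x - y)
    calc |logKernel x y| * |β y| ≤ (nearKernel (x - y) + (‖x‖ + T)) * |β y| := by
          gcongr; linarith
      _ = nearKernel (x - y) * |β y| + (‖x‖ + T) * |β y| := by ring
      _ ≤ nearKernel (x - y) * Λ + (‖x‖ + T) * |β y| := by
          gcongr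
          exact h.abs_le y
      _ = _ := by ring

/-- A first moment of σ is enough: integrating |log|x − y|| against the bounded, compactly supported
β gives at most linear growth in |x|. -/
theorem integrable_energy (h : IsBoundedDensity Λ T β) {σ : ℂ → ℝ} (hσ : Integrable σ)
    (hσ1 : Integrable fun x => ‖x‖ * σ x) :
    Integrable fun p : ℂ × ℂ => σ p.1 * logKernel p.1 p.2 * β p.2 := by
  rw [Measure.volume_eq_prod, integrable_prod_iff]
  · refine ⟨Eventually.of_forall fun x => ?_, ?_⟩
    · simpa only [mul_assoc] using (h.integrable_logKernel_mul x).const_mul (σ x)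
    · have h1 : Integrable fun x => (Λ * nearMass + T * ∫ y, |β y|) * |σ x| +
          (∫ y, |β y|) * |‖x‖ * σ x| := (hσ.abs.const_mul _).add (hσ1.abs.const_mul _)
      refine h1.mono' ?_ (Eventually.of_forall fun x => ?_)
      · refine AEStronglyMeasurable.integral_prod_right' (f := fun p : ℂ × ℂ =>
          ‖σ p.1 * logKernel p.1 p.2 * β p.2‖) ?_
        have := h.measurable
        exact ((hσ.aestronglyMeasurable.comp_fst.mul
          (by fun_prop : Measurable fun p : ℂ × ℂ => logKernel p.1 p.2).aestronglyMeasurable).mul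
          (by fun_prop : Measurable fun p : ℂ × ℂ => β p.2).aestronglyMeasurable).norm
      · rw [Real.norm_of_nonneg (integral_nonneg fun _ => norm_nonneg _)]
        simp_rw [mul_assoc, norm_mul (σ x), Real.norm_eq_abs]
        rw [integral_const_mul, abs_mul, abs_norm]
        have h2 := h.integral_abs_logKernel_mul_le x
        calc |σ x| * ∫ y, |logKernel x y * β y|
            ≤ |σ x| * (Λ * nearMass + (‖x‖ + T) * ∫ y, |β y|) := by gcongr
          _ = _ := by ring
  · have := h.measurable
    exact (hσ.aestronglyMeasurable.comp_fst.mul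
      (by fun_prop : Measurable fun p : ℂ × ℂ => logKernel p.1 p.2).aestronglyMeasurable).mul
      (by fun_prop : Measurable fun p : ℂ × ℂ => β p.2).aestronglyMeasurable

theorem integrable_energy' (h : IsBoundedDensity Λ T β) {σ : ℂ → ℝ} (hσ : Integrable σ)
    (hσ1 : Integrable fun x => ‖x‖ * σ x) :
    Integrable fun p : ℂ × ℂ => β p.1 * logKernel p.1 p.2 * σ p.2 := by
  have := (h.integrable_energy hσ hσ1).swap
  refine this.congr (Eventually.of_forall fun p => ?_)
  simp only [Function.comp_apply, Prod.fst_swap, Prod.snd_swap]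
  rw [logKernel_comm]
  ring

theorem logEnergy_eq (h : IsBoundedDensity Λ T β) {σ : ℂ → ℝ} (hσ : Integrable σ)
    (hσ1 : Integrable fun x => ‖x‖ * σ x) :
    logEnergy σ β = ∫ x, σ x * ∫ y, logKernel x y * β y := by
  have := h.integrable_energy hσ hσ1
  rw [logEnergy]
  rw [Measure.volume_eq_prod] at this ⊢
  rw [integral_prod _ this]
  simp_rw [mul_assoc, integral_const_mul]

end IsBoundedDensity

theorem logEnergy_comm (σ τ : ℂ → ℝ) : logEnergy σ τ = logEnergy τ σ := by
  unfold logEnergy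
  rw [Measure.volume_eq_prod, ← integral_prod_swap]
  refine integral_congr_ae (Eventually.of_forall fun p => ?_)
  simp only [Prod.fst_swap, Prod.snd_swap]
  rw [logKernel_comm]
  ring

/-- Expansion of the energy of `σ - s β`. -/
theorem IsBoundedDensity.logEnergy_sub {Λ T : ℝ} {β : ℂ → ℝ} (h : IsBoundedDensity Λ T β)
    {σ : ℂ → ℝ} (hσ : Integrable σ) (hσ1 : Integrable fun x => ‖x‖ * σ x)
    (hL : Integrable fun p : ℂ × ℂ => σ p.1 * logKernel p.1 p.2 * σ p.2) (s : ℝ) :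
    (Integrable fun p : ℂ × ℂ => (σ p.1 - s * β p.1) * logKernel p.1 p.2 * (σ p.2 - s * β p.2)) ∧
    logEnergy (fun x => σ x - s * β x) (fun x => σ x - s * β x) =
      logEnergy σ σ - 2 * s * logEnergy σ β + s ^ 2 * logEnergy β β := by
  have h1 := (h.integrable_energy hσ hσ1).const_mul s
  have h2 := (h.integrable_energy' hσ hσ1).const_mul s
  have h3 := (h.integrable_energy h.integrable h.integrable_norm_mul).const_mul (s ^ 2)
  have he : (fun p : ℂ × ℂ => (σ p.1 - s * β p.1) * logKernel p.1 p.2 * (σ p.2 - s * β p.2)) =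
      fun p => σ p.1 * logKernel p.1 p.2 * σ p.2 - s * (σ p.1 * logKernel p.1 p.2 * β p.2) -
        s * (β p.1 * logKernel p.1 p.2 * σ p.2) +
        s ^ 2 * (β p.1 * logKernel p.1 p.2 * β p.2) := by
    funext p; ring
  refine ⟨he ▸ ((hL.sub h1).sub h2).add h3, ?_⟩
  have h5 := logEnergy_comm β σ
  unfold logEnergy at h5 ⊢
  have e1 := integral_sub hL h1
  have e2 := integral_sub (hL.sub h1) h2
  have e3 := integral_add ((hL.sub h1).sub h2) h3
  simp only [Pi.sub_apply] at e2 e3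
  rw [he, e3, e2, e1, integral_const_mul, integral_const_mul, integral_const_mul, h5]
  ring

/-- The factor 2 is not sharp, but in `sq_integral_mul_le` it is absorbed by (2π)⁻¹. -/
theorem sum_fderiv_sq_le (A : ℂ →L[ℝ] ℝ) : A 1 * A 1 + A Complex.I * A Complex.I ≤ 2 * ‖A‖ ^ 2 := by
  have h1 := A.le_opNorm 1
  have h2 := A.le_opNorm Complex.I
  simp only [norm_one, mul_one, Complex.norm_I, Real.norm_eq_abs] at h1 h2
  have h3 := sq_le_sq' (by linarith [neg_abs_le (A 1)]) ((le_abs_self _).trans h1)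
  have h4 := sq_le_sq' (by linarith [neg_abs_le (A Complex.I)]) ((le_abs_self _).trans h2)
  nlinarith

/-- The integral of a neutral charge density against a test function is controlled by the
logarithmic energy and the Dirichlet norm. -/
theorem sq_integral_mul_le {σ χ : ℂ → ℝ} (hσ : Integrable σ)
    (hσ1 : Integrable fun x => ‖x‖ * σ x) (h0 : ∫ x, σ x = 0)
    (hL : Integrable fun p : ℂ × ℂ => σ p.1 * logKernel p.1 p.2 * σ p.2)
    (hχ : ContDiff ℝ 2 χ) (hs : HasCompactSupport χ) :
    (∫ x, σ x * χ x) ^ 2 ≤ logEnergy σ σ * ∫ x, ‖fderiv ℝ χ x‖ ^ 2 := by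
  -- ν is the neutral charge whose logarithmic potential is χ. Hence ∫ σχ is the mutual energy of σ
  -- and ν, and the self-energy of ν is a Dirichlet integral of χ.
  set ν : ℂ → ℝ := fun x => -(2 * Real.pi)⁻¹ * planeLaplacian χ x with hν
  have hLc := continuous_planeLaplacian hχ
  have hLs := hasCompactSupport_planeLaplacian hs
  have hνc : Continuous ν := continuous_const.mul hLc
  have hνs : HasCompactSupport ν := hLs.mul_left
  obtain ⟨B, hB⟩ := hνc.bounded_above_of_compact_support hνs
  obtain ⟨T, hT⟩ := hνs.isCompact.isBounded.subset_closedBall 0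
  have hβ : IsBoundedDensity B T ν := ⟨hνc.measurable, hB, fun y hy =>
    image_eq_zero_of_notMem_tsupport fun hy' => by
      have := hT hy'
      rw [mem_closedBall_zero_iff] at this
      linarith⟩
  have hpot : ∀ x, ∫ y, logKernel x y * ν y = χ x := by
    intro x
    have h := integral_logKernel_mul_planeLaplacian hχ hs x
    have he : ∀ y, logKernel x y * ν y =
        -(2 * Real.pi)⁻¹ * (logKernel x y * planeLaplacian χ y) := fun y => by
      rw [hν]; ring
    simp_rw [he]
    rw [integral_const_mul, h]
    field_simp
  have h1 : logEnergy σ ν = ∫ x, σ x * χ x := by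
    rw [hβ.logEnergy_eq hσ hσ1]
    simp_rw [hpot]
  have hχ1 : ContDiff ℝ 1 χ := hχ.of_le (by norm_num)
  have h2 : logEnergy ν ν ≤ ∫ x, ‖fderiv ℝ χ x‖ ^ 2 := by
    rw [hβ.logEnergy_eq hβ.integrable hβ.integrable_norm_mul]
    simp_rw [hpot]
    have h3 := integral_mul_planeLaplacian hχ1 hχ hs
    have h4 : ∫ x, ν x * χ x = -(2 * Real.pi)⁻¹ * ∫ x, χ x * planeLaplacian χ x := by
      rw [← integral_const_mul]
      refine integral_congr_ae (Eventually.of_forall fun x => ?_)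
      simp only [hν]; ring
    have hi : ∀ v : ℂ, Integrable fun y => fderiv ℝ χ y v * fderiv ℝ χ y v := fun v =>
      integrable_fderiv_fderiv (contDiff_fderiv_apply hχ v) hχ1 hs v
    have h6 : Integrable fun x => ‖fderiv ℝ χ x‖ ^ 2 := by
      have hc := (hχ1.continuous_fderiv one_ne_zero)
      have hs' : HasCompactSupport fun x => ‖fderiv ℝ χ x‖ ^ 2 := by
        have := (hs.fderiv (𝕜 := ℝ)).norm
        exact this.comp_left (g := fun r : ℝ => r ^ 2) (by norm_num)
      exact (hc.norm.pow 2).integrable_of_hasCompactSupport hs'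
    have h5 : (∫ y, fderiv ℝ χ y 1 * fderiv ℝ χ y 1) +
        ∫ y, fderiv ℝ χ y Complex.I * fderiv ℝ χ y Complex.I ≤ 2 * ∫ x, ‖fderiv ℝ χ x‖ ^ 2 := by
      rw [← integral_add (hi _) (hi _), ← integral_const_mul]
      exact integral_mono ((hi _).add (hi _)) (h6.const_mul _) fun x => sum_fderiv_sq_le _
    have h7 : 0 ≤ ∫ x, ‖fderiv ℝ χ x‖ ^ 2 := integral_nonneg fun _ => by positivity
    rw [h4, h3, neg_mul_neg]
    calc (2 * Real.pi)⁻¹ * _ ≤ (2 * Real.pi)⁻¹ * (2 * ∫ x, ‖fderiv ℝ χ x‖ ^ 2) := by gcongr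
      _ = Real.pi⁻¹ * ∫ x, ‖fderiv ℝ χ x‖ ^ 2 := by field_simp
      _ ≤ 1 * ∫ x, ‖fderiv ℝ χ x‖ ^ 2 := by
        gcongr
        exact inv_le_one_of_one_le₀ (by linarith [Real.pi_gt_three])
      _ = _ := one_mul _
  have hν0 : ∫ x, ν x = 0 := by
    simp only [hν]
    rw [integral_const_mul, integral_planeLaplacian hχ hs, mul_zero]
  -- Cauchy–Schwarz through the discriminant. Positivity is available because σ − sν is neutral for
  -- every s.
  have hquad : ∀ s : ℝ, 0 ≤ logEnergy σ σ - 2 * s * logEnergy σ ν + s ^ 2 * logEnergy ν ν := by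
    intro s
    obtain ⟨hi, he⟩ := hβ.logEnergy_sub hσ hσ1 hL s
    rw [← he]
    refine logEnergy_self_nonneg (hσ.sub (hβ.integrable.const_mul s)) ?_ hi
    rw [integral_sub hσ (hβ.integrable.const_mul s), integral_const_mul, h0, hν0]
    simp
  have hE : 0 ≤ logEnergy σ σ := logEnergy_self_nonneg hσ h0 hL
  have hdisc := discrim_le_zero (a := logEnergy ν ν) (b := -2 * logEnergy σ ν)
    (c := logEnergy σ σ) fun s => by nlinarith [hquad s]
  rw [discrim] at hdisc
  have h8 : (logEnergy σ ν) ^ 2 ≤ logEnergy σ σ * logEnergy ν ν := by nlinarith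
  rw [← h1]
  exact h8.trans (by gcongr)

/-! ### Minimization over densities bounded by a constant in a disk -/

/-- A functional which is midpoint quasi-convex and closed along norm-convergent sequences attains
its minimum on a bounded family in a Hilbert space. -/
theorem exists_minimizer_of_midpoint {X H : Type*} [Nonempty X] [NormedAddCommGroup H]
    [InnerProductSpace ℝ H] [CompleteSpace H] (j : X → H) (F : X → ℝ) {B m₀ : ℝ}
    (hB : ∀ x, ‖j x‖ ≤ B) (hm₀ : ∀ x, m₀ ≤ F x)
    (hmid : ∀ x y, ∃ z, (2 : ℝ) • j z = j x + j y ∧ F z ≤ max (F x) (F y))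
    (hclosed : ∀ (u : ℕ → X) (h : H), Tendsto (fun n => j (u n)) atTop (nhds h) →
      ∃ x, ∃ φ : ℕ → ℕ, StrictMono φ ∧ Tendsto (fun n => F (u (φ n))) atTop (nhds (F x))) :
    ∃ x, ∀ y, F x ≤ F y := by
  set m := sInf (Set.range F) with hm
  have hbdd : BddBelow (Set.range F) := ⟨m₀, by rintro _ ⟨x, rfl⟩; exact hm₀ x⟩
  have hmle : ∀ x, m ≤ F x := fun x => csInf_le hbdd ⟨x, rfl⟩
  have hε : ∀ n : ℕ, (0 : ℝ) < 1 / (n + 1) := fun n => by positivity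
  -- Among almost-minimizers of F one of almost minimal norm is selected. The infima of ‖j x‖² over
  -- the shrinking sublevel sets increase and are bounded by B², hence converge.
  set K : ℕ → Set ℝ := fun n => (fun x => ‖j x‖ ^ 2) '' {x | F x ≤ m + 1 / (n + 1)} with hK
  have hKne : ∀ n, (K n).Nonempty := fun n => by
    obtain ⟨_, ⟨x, rfl⟩, hx⟩ := exists_lt_of_csInf_lt (Set.range_nonempty F)
      (show sInf (Set.range F) < m + 1 / (n + 1) by linarith [hε n])
    exact ⟨_, x, hx.le, rfl⟩
  have hKb : ∀ n, BddBelow (K n) := fun n => ⟨0, by rintro _ ⟨x, -, rfl⟩; positivity⟩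
  set d : ℕ → ℝ := fun n => sInf (K n) with hd
  have hdmono : Monotone d := by
    intro a b hab
    refine csInf_le_csInf (hKb a) (hKne b) (Set.image_mono fun x hx => ?_)
    have h1 : (1 : ℝ) / (b + 1) ≤ 1 / (a + 1) := by gcongr
    have hx : F x ≤ m + 1 / (b + 1) := hx
    exact hx.trans (by linarith)
  have hdB : ∀ n, d n ≤ B ^ 2 := fun n => by
    obtain ⟨_, x, hx, rfl⟩ := hKne n
    exact (csInf_le (hKb n) ⟨x, hx, rfl⟩).trans (by
      have := hB x
      dsimp only
      gcongr)
  have hdbdd : BddAbove (Set.range d) := ⟨B ^ 2, by rintro _ ⟨n, rfl⟩; exact hdB n⟩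
  have hdlim := tendsto_atTop_ciSup hdmono hdbdd
  set D := ⨆ n, d n with hD
  have hdD : ∀ n, d n ≤ D := fun n => le_ciSup hdbdd n
  have hex : ∀ n : ℕ, ∃ x, F x ≤ m + 1 / (n + 1) ∧ ‖j x‖ ^ 2 < d n + 1 / (n + 1) := fun n => by
    obtain ⟨_, ⟨x, hx, rfl⟩, hx'⟩ := exists_lt_of_csInf_lt (hKne n)
      (show sInf (K n) < d n + 1 / (n + 1) by linarith [hε n])
    exact ⟨x, hx, hx'⟩
  choose u hu1 hu2 using hex
  have hcauchy : CauchySeq fun n => j (u n) := by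
    -- By the midpoint hypothesis half the sum of two selected vectors comes from the larger
    -- sublevel set, so its squared norm is at least d n. The parallelogram law then bounds the
    -- squared distance by 4/(n+1) + 2(D − d n).
    refine cauchySeq_of_le_tendsto_0 (fun n : ℕ => √(4 * (1 / ((n : ℝ) + 1)) + 2 * (D - d n))) ?_ ?_
    · have key : ∀ n k : ℕ, n ≤ k → dist (j (u n)) (j (u k)) ≤
          √(4 * (1 / ((n : ℝ) + 1)) + 2 * (D - d n)) := by
        intro n k hnk
        have h1 : (1 : ℝ) / (k + 1) ≤ 1 / (n + 1) := by gcongr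
        obtain ⟨z, hz, hFz⟩ := hmid (u n) (u k)
        have h2 : F z ≤ m + 1 / (n + 1) :=
          hFz.trans (max_le (hu1 n) ((hu1 k).trans (by linarith)))
        have h3 : d n ≤ ‖j z‖ ^ 2 := csInf_le (hKb n) ⟨z, h2, rfl⟩
        have h4 : ‖j (u n) + j (u k)‖ = 2 * ‖j z‖ := by rw [← hz, norm_smul]; norm_num
        have h5 := parallelogram_law_with_norm ℝ (j (u n)) (j (u k))
        rw [h4] at h5
        rw [dist_eq_norm]
        refine Real.le_sqrt_of_sq_le ?_
        have h6 := hu2 n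
        have h7 := hu2 k
        have h8 := hdD k
        nlinarith
      intro n k N hn hk
      have hmono : ∀ n : ℕ, N ≤ n → √(4 * (1 / ((n : ℝ) + 1)) + 2 * (D - d n)) ≤
          √(4 * (1 / ((N : ℝ) + 1)) + 2 * (D - d N)) := fun n hn => by
        have := hdmono hn
        gcongr
      rcases le_total n k with h | h
      · exact (key n k h).trans (hmono n hn)
      · rw [dist_comm]
        exact (key k n h).trans (hmono k hk)
    · have h1 : Tendsto (fun n : ℕ => 4 * (1 / ((n : ℝ) + 1)) + 2 * (D - d n)) atTop
          (nhds (4 * 0 + 2 * (D - D))) :=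
        (tendsto_one_div_add_atTop_nhds_zero_nat.const_mul 4).add
          ((tendsto_const_nhds.sub hdlim).const_mul 2)
      simpa using h1.sqrt
  obtain ⟨h, hh⟩ := cauchySeq_tendsto_of_complete hcauchy
  obtain ⟨x, φ, hφ, hx⟩ := hclosed u h hh
  refine ⟨x, fun y => le_trans ?_ (hmle y)⟩
  have h1 : Tendsto (fun n : ℕ => m + 1 / ((φ n : ℝ) + 1)) atTop (nhds (m + 0)) :=
    tendsto_const_nhds.add (tendsto_one_div_add_atTop_nhds_zero_nat.comp hφ.tendsto_atTop)
  rw [add_zero] at h1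
  exact le_of_tendsto_of_tendsto' hx h1 fun n => hu1 (φ n)

/-- Probability densities bounded by `Λ` in the disk of radius `T`. -/
structure IsConstrainedDensity (Λ T : ℝ) (β : ℂ → ℝ) : Prop extends IsBoundedDensity Λ T β where
  nonneg' : ∀ y, 0 ≤ β y
  integral_eq_one : ∫ y, β y = 1

namespace IsBoundedDensity

variable {Λ Λ' T s : ℝ} {β γ : ℂ → ℝ}

theorem sub_mul (h : IsBoundedDensity Λ T β) (h' : IsBoundedDensity Λ' T γ) (s : ℝ) :
    IsBoundedDensity (Λ + |s| * Λ') T fun x => β x - s * γ x := by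
  refine ⟨h.measurable.sub (h'.measurable.const_mul s), fun y => ?_, fun y hy => ?_⟩
  · refine (abs_sub _ _).trans ?_
    rw [abs_mul]
    gcongr
    · exact h.abs_le y
    · exact h'.abs_le y
  · simp [h.eq_zero y hy, h'.eq_zero y hy]

theorem memLp_two (h : IsBoundedDensity Λ T β) : MemLp β 2 volume := by
  refine MemLp.of_le (g := (Metric.closedBall (0 : ℂ) T).indicator fun _ => Λ) ?_
    h.measurable.aestronglyMeasurable (Eventually.of_forall fun y => ?_)
  · exact memLp_indicator_const 2 measurableSet_closedBall Λ (Or.inr measure_closedBall_lt_top.ne)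
  · exact (h.abs_le_indicator y).trans (le_abs_self _)

theorem logEnergy_self_nonneg (h : IsBoundedDensity Λ T β) (h0 : ∫ x, β x = 0) :
    0 ≤ logEnergy β β :=
  _root_.logEnergy_self_nonneg h.integrable h0
    (h.integrable_energy h.integrable h.integrable_norm_mul)

end IsBoundedDensity

/-- The energy of a charge density in an external potential. -/
noncomputable def chargeEnergy (l : ℝ) (V ρ : ℂ → ℝ) : ℝ :=
  (∫ x, V x * ρ x) + l * logEnergy ρ ρ

/-- Convex combinations are written as β − s(β − γ), the form in which
`IsBoundedDensity.logEnergy_sub` expands the energy. -/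
theorem IsConstrainedDensity.sub_mul {Λ T s : ℝ} {β γ : ℂ → ℝ} (h : IsConstrainedDensity Λ T β)
    (h' : IsConstrainedDensity Λ T γ) (hs0 : 0 ≤ s) (hs1 : s ≤ 1) :
    IsConstrainedDensity Λ T fun x => β x - s * (β x - γ x) := by
  have hc : ∀ x, β x - s * (β x - γ x) = (1 - s) * β x + s * γ x := fun x => by ring
  have h0 : ∀ y, 0 ≤ β y - s * (β y - γ y) := fun y => by
    rw [hc]
    exact add_nonneg (mul_nonneg (by linarith) (h.nonneg' y)) (mul_nonneg hs0 (h'.nonneg' y))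
  refine ⟨⟨h.measurable.sub ((h.measurable.sub h'.measurable).const_mul s), fun y => ?_,
    fun y hy => ?_⟩, h0, ?_⟩
  · rw [abs_of_nonneg (h0 y), hc]
    have h1 := (le_abs_self _).trans (h.abs_le y)
    have h2 := (le_abs_self _).trans (h'.abs_le y)
    nlinarith
  · simp [h.eq_zero y hy, h'.eq_zero y hy]
  · simp_rw [hc]
    rw [integral_add (h.integrable.const_mul _) (h'.integrable.const_mul _), integral_const_mul,
      integral_const_mul, h.integral_eq_one, h'.integral_eq_one]
    ring

theorem chargeEnergy_sub {Λ T l : ℝ} {V β γ : ℂ → ℝ} (hV : LocallyIntegrable V)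
    (h : IsConstrainedDensity Λ T β) (h' : IsConstrainedDensity Λ T γ) (s : ℝ) :
    chargeEnergy l V (fun x => β x - s * (β x - γ x)) =
      chargeEnergy l V β - s * ((∫ x, V x * (β x - γ x)) +
        2 * l * logEnergy β (fun x => β x - γ x)) +
        l * s ^ 2 * logEnergy (fun x => β x - γ x) (fun x => β x - γ x) := by
  have hd : IsBoundedDensity (Λ + |1| * Λ) T fun x => β x - γ x := by
    simpa using h.toIsBoundedDensity.sub_mul h'.toIsBoundedDensity 1
  have h1 := (hd.logEnergy_sub h.integrable h.integrable_norm_mul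
    (h.integrable_energy h.integrable h.integrable_norm_mul) s).2
  unfold chargeEnergy
  rw [h1]
  have h2 : ∫ x, V x * (β x - s * (β x - γ x)) =
      (∫ x, V x * β x) - s * ∫ x, V x * (β x - γ x) := by
    rw [← integral_const_mul, ← integral_sub (h.integrable_mul hV)
      ((hd.integrable_mul hV).const_mul s)]
    refine integral_congr_ae (Eventually.of_forall fun x => ?_)
    dsimp only
    ring
  rw [h2]
  ring

/-- Serves both to bound the energy functional below and to control the self-interaction missing
from the mean energy of independent particles. -/
theorem IsConstrainedDensity.abs_logEnergy_le {Λ T : ℝ} {β : ℂ → ℝ}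
    (h : IsConstrainedDensity Λ T β) : |logEnergy β β| ≤ Λ * nearMass + 2 * T := by
  have habs : ∫ y, |β y| = 1 := by
    rw [← h.integral_eq_one]
    exact integral_congr_ae (Eventually.of_forall fun y => abs_of_nonneg (h.nonneg' y))
  rw [h.logEnergy_eq h.integrable h.integrable_norm_mul]
  refine (abs_integral_le_integral_abs).trans ?_
  have h1 : ∀ x, |β x * ∫ y, logKernel x y * β y| ≤ (Λ * nearMass + 2 * T) * β x := by
    intro x
    rw [abs_mul, abs_of_nonneg (h.nonneg' x), mul_comm]
    by_cases hx : T < ‖x‖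
    · simp [h.eq_zero x hx]
    · refine mul_le_mul_of_nonneg_right ?_ (h.nonneg' x)
      refine (abs_integral_le_integral_abs).trans ((h.integral_abs_logKernel_mul_le x).trans ?_)
      rw [habs]
      linarith [not_lt.1 hx]
  calc ∫ x, |β x * ∫ y, logKernel x y * β y| ≤ ∫ x, (Λ * nearMass + 2 * T) * β x :=
        integral_mono_of_nonneg (Eventually.of_forall fun _ => abs_nonneg _)
          (h.integrable.const_mul _) (Eventually.of_forall h1)
    _ = _ := by rw [integral_const_mul, h.integral_eq_one, mul_one]

/-- The common majorant Λ times the indicator of the disc has finite potential and interaction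
energies, so every term passes to the limit by dominated convergence. -/
theorem exists_constrained_limit {Λ T l : ℝ} {V : ℂ → ℝ} (hV : LocallyIntegrable V)
    {u : ℕ → ℂ → ℝ} (hu : ∀ n, IsConstrainedDensity Λ T (u n)) {g : ℂ → ℝ}
    (hg : Measurable g) (hlim : ∀ᵐ x, Tendsto (fun n => u n x) atTop (nhds (g x))) :
    ∃ β, IsConstrainedDensity Λ T β ∧
      Tendsto (fun n => chargeEnergy l V (u n)) atTop (nhds (chargeEnergy l V β)) := by
  have hΛ : 0 ≤ Λ := (hu 0).toIsBoundedDensity.nonneg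
  set χB : ℂ → ℝ := (Metric.closedBall (0 : ℂ) T).indicator fun _ => Λ with hχB
  have hχ : IsBoundedDensity Λ T χB := by
    refine ⟨measurable_const.indicator measurableSet_closedBall, fun y => ?_, fun y hy => ?_⟩
    · rw [hχB]
      by_cases hy : y ∈ Metric.closedBall (0 : ℂ) T
      · rw [Set.indicator_of_mem hy, abs_of_nonneg hΛ]
      · rw [Set.indicator_of_notMem hy, abs_zero]; exact hΛ
    · rw [hχB, Set.indicator_of_notMem (by simpa using hy)]
  have hu0 : ∀ n x, u n x ∈ Set.Icc 0 (χB x) := fun n x =>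
    ⟨(hu n).nonneg' x, (le_abs_self _).trans ((hu n).abs_le_indicator x)⟩
  -- The limit g obeys the constraints only almost everywhere; truncation makes them hold at every
  -- point.
  set β : ℂ → ℝ := fun x => max 0 (min (χB x) (g x)) with hβ
  have hβm : Measurable β := measurable_const.max (hχ.measurable.min hg)
  have hχ0 : ∀ x, 0 ≤ χB x := fun x => Set.indicator_nonneg (fun _ _ => hΛ) _
  have hβ0 : ∀ x, β x ∈ Set.Icc 0 (χB x) := fun x =>
    ⟨le_max_left _ _, max_le (hχ0 x) (min_le_left _ _)⟩
  have hβlim : ∀ᵐ x, Tendsto (fun n => u n x) atTop (nhds (β x)) := by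
    filter_upwards [hlim] with x hx
    have h1 : g x ∈ Set.Icc 0 (χB x) := isClosed_Icc.mem_of_tendsto hx
      (Eventually.of_forall fun n => hu0 n x)
    have h2 : β x = g x := by
      simp only [hβ]
      rw [min_eq_right h1.2, max_eq_right h1.1]
    rwa [h2]
  have hβb : IsBoundedDensity Λ T β := by
    refine ⟨hβm, fun y => ?_, fun y hy => ?_⟩
    · rw [abs_of_nonneg (hβ0 y).1]
      exact (hβ0 y).2.trans ((le_abs_self _).trans (hχ.abs_le y))
    · have := hβ0 y
      rw [hχ.eq_zero y hy] at this
      exact le_antisymm this.2 this.1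
  have hone : Tendsto (fun n => ∫ x, u n x) atTop (nhds (∫ x, β x)) := by
    refine tendsto_integral_of_dominated_convergence χB
      (fun n => (hu n).measurable.aestronglyMeasurable) hχ.integrable (fun n => ?_) hβlim
    exact Eventually.of_forall fun x => by
      rw [Real.norm_of_nonneg (hu0 n x).1]; exact (hu0 n x).2
  refine ⟨β, ⟨hβb, fun y => (hβ0 y).1, ?_⟩, ?_⟩
  · simp_rw [fun n => (hu n).integral_eq_one] at hone
    exact (tendsto_nhds_unique hone tendsto_const_nhds)
  · refine Tendsto.add ?_ (Tendsto.const_mul l ?_)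
    · refine tendsto_integral_of_dominated_convergence (fun x => |V x * χB x|)
        (fun n => ((hu n).integrable_mul hV).aestronglyMeasurable) (hχ.integrable_mul hV).abs
        (fun n => Eventually.of_forall fun x => ?_) ?_
      · rw [norm_mul, abs_mul, Real.norm_eq_abs, Real.norm_of_nonneg (hu0 n x).1,
          abs_of_nonneg (hχ0 x)]
        gcongr
        exact (hu0 n x).2
      · filter_upwards [hβlim] with x hx
        exact hx.const_mul _
    · refine tendsto_integral_of_dominated_convergence
        (fun p : ℂ × ℂ => |χB p.1 * logKernel p.1 p.2 * χB p.2|)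
        (fun n => ((hu n).integrable_energy (hu n).integrable
          (hu n).integrable_norm_mul).aestronglyMeasurable)
        (hχ.integrable_energy hχ.integrable hχ.integrable_norm_mul).abs
        (fun n => Eventually.of_forall fun p => ?_) ?_
      · rw [norm_mul, norm_mul, abs_mul, abs_mul, Real.norm_of_nonneg (hu0 n _).1,
          Real.norm_of_nonneg (hu0 n _).1, abs_of_nonneg (hχ0 _), abs_of_nonneg (hχ0 _),
          Real.norm_eq_abs]
        have h1 := (hu0 n p.1).2
        have h2 := (hu0 n p.2).2
        have h3 := (hu0 n p.2).1
        have h4 := hχ0 p.1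
        gcongr
      · have e1 : ∀ᵐ p : ℂ × ℂ, Tendsto (fun n => u n p.1) atTop (nhds (β p.1)) :=
          Measure.quasiMeasurePreserving_fst.ae hβlim
        have e2 : ∀ᵐ p : ℂ × ℂ, Tendsto (fun n => u n p.2) atTop (nhds (β p.2)) :=
          Measure.quasiMeasurePreserving_snd.ae hβlim
        filter_upwards [e1, e2] with p hp1 hp2
        exact (hp1.mul_const _).mul hp2

/-- The charge energy has a minimizer among the densities bounded by `Λ` in a disk. -/
theorem exists_constrained_minimizer {Λ T l : ℝ} (hl : 0 ≤ l) {V : ℂ → ℝ}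
    (hV : LocallyIntegrable V) (hne : ∃ β, IsConstrainedDensity Λ T β) :
    ∃ ρ, IsConstrainedDensity Λ T ρ ∧
      ∀ η, IsConstrainedDensity Λ T η → chargeEnergy l V ρ ≤ chargeEnergy l V η := by
  obtain ⟨β₀, hβ₀⟩ := hne
  have : Nonempty {β // IsConstrainedDensity Λ T β} := ⟨β₀, hβ₀⟩
  have hΛ : 0 ≤ Λ := hβ₀.toIsBoundedDensity.nonneg
  set χB : ℂ → ℝ := (Metric.closedBall (0 : ℂ) T).indicator fun _ => Λ with hχB
  have hχL : MemLp χB 2 volume :=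
    memLp_indicator_const 2 measurableSet_closedBall Λ (Or.inr measure_closedBall_lt_top.ne)
  have hVχ : Integrable fun x => |V x| * χB x := by
    have h1 : Integrable ((Metric.closedBall (0 : ℂ) T).indicator fun x => |V x| * Λ) := by
      rw [integrable_indicator_iff measurableSet_closedBall]
      exact ((hV.integrableOn_isCompact (isCompact_closedBall 0 T)).abs).mul_const _
    refine h1.congr (Eventually.of_forall fun x => ?_)
    rw [hχB]
    by_cases hx : x ∈ Metric.closedBall (0 : ℂ) T
    · simp only [Set.indicator_of_mem hx]
    · simp only [Set.indicator_of_notMem hx, mul_zero]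
  suffices h : ∃ x : {β // IsConstrainedDensity Λ T β}, ∀ y : {β // IsConstrainedDensity Λ T β},
      chargeEnergy l V x.1 ≤ chargeEnergy l V y.1 by
    obtain ⟨x, hx⟩ := h
    exact ⟨x.1, x.2, fun η hη => hx ⟨η, hη⟩⟩
  refine exists_minimizer_of_midpoint
    (j := fun β : {β // IsConstrainedDensity Λ T β} => β.2.memLp_two.toLp)
    (F := fun β => chargeEnergy l V β.1) (B := ‖hχL.toLp‖)
    (m₀ := -(∫ x, |V x| * χB x) - l * (Λ * nearMass + 2 * T)) ?_ ?_ ?_ ?_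
  · rintro ⟨β, hβ⟩
    refine Lp.norm_le_norm_of_ae_le ?_
    filter_upwards [hβ.memLp_two.coeFn_toLp, hχL.coeFn_toLp] with y h1 h2
    rw [h1, h2]
    exact (hβ.abs_le_indicator y).trans (le_abs_self _)
  · rintro ⟨β, hβ⟩
    have h1 := abs_le.1 hβ.abs_logEnergy_le
    have h2 : |∫ x, V x * β x| ≤ ∫ x, |V x| * χB x := by
      refine abs_integral_le_integral_abs.trans
        (integral_mono (hβ.integrable_mul hV).abs hVχ fun x => ?_)
      dsimp only
      rw [abs_mul]
      gcongr
      exact hβ.abs_le_indicator x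
    have h3 := abs_le.1 h2
    have h4 := mul_le_mul_of_nonneg_left h1.1 hl
    simp only [chargeEnergy]
    linarith
  · rintro ⟨β, hβ⟩ ⟨γ, hγ⟩
    have hs := hβ.sub_mul hγ (s := 1 / 2) (by norm_num) (by norm_num)
    refine ⟨⟨_, hs⟩, ?_, ?_⟩
    · rw [← MemLp.toLp_const_smul, ← MemLp.toLp_add, MemLp.toLp_eq_toLp_iff]
      refine Eventually.of_forall fun y => ?_
      simp only [Pi.smul_apply, Pi.add_apply, smul_eq_mul]
      ring
    -- Comparing the expansions at s = 1/2 and s = 1, the midpoint energy is the mean of the two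
    -- energies minus (l/4) times the nonnegative energy of the neutral density β − γ.
    · have e1 := chargeEnergy_sub (l := l) hV hβ hγ (1 / 2)
      have e2 := chargeEnergy_sub (l := l) hV hβ hγ 1
      have e3 : (fun x => β x - 1 * (β x - γ x)) = γ := by funext x; ring
      have hd : IsBoundedDensity (Λ + |1| * Λ) T fun x => β x - γ x := by
        simpa using hβ.toIsBoundedDensity.sub_mul hγ.toIsBoundedDensity 1
      have e4 := hd.logEnergy_self_nonneg (by
        rw [integral_sub hβ.integrable hγ.integrable, hβ.integral_eq_one, hγ.integral_eq_one,
          sub_self])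
      rw [e3] at e2
      dsimp only
      rw [e1]
      have h5 := mul_nonneg hl e4
      have h6 := le_max_left (chargeEnergy l V β) (chargeEnergy l V γ)
      have h7 := le_max_right (chargeEnergy l V β) (chargeEnergy l V γ)
      nlinarith
  · intro u h hh
    -- L² convergence gives convergence almost everywhere along a subsequence, which is all that the
    -- closedness hypothesis requires.
    have h1 := tendstoInMeasure_of_tendsto_Lp hh
    obtain ⟨φ, hφ, hae⟩ := h1.exists_seq_tendsto_ae
    have h2 : ∀ᵐ x, Tendsto (fun n => (u (φ n)).1 x) atTop (nhds (h x)) := by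
      have h3 : ∀ᵐ x, ∀ n, ((u n).2.memLp_two.toLp : ℂ → ℝ) x = (u n).1 x :=
        ae_all_iff.2 fun n => (u n).2.memLp_two.coeFn_toLp
      filter_upwards [hae, h3] with x hx hx3
      exact hx.congr fun n => hx3 (φ n)
    obtain ⟨β, hβ, hβl⟩ := exists_constrained_limit (l := l) hV (fun n => (u (φ n)).2)
      (Lp.stronglyMeasurable h).measurable h2
    exact ⟨⟨β, hβ⟩, φ, hφ, hβl⟩

/-- The first variation of the charge energy at a constrained minimizer. -/
theorem integral_potential_mul_sub_nonneg {Λ T l : ℝ} {V ρ : ℂ → ℝ}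
    (hV : LocallyIntegrable V) (hρ : IsConstrainedDensity Λ T ρ)
    (hmin : ∀ η, IsConstrainedDensity Λ T η → chargeEnergy l V ρ ≤ chargeEnergy l V η)
    {η : ℂ → ℝ} (hη : IsConstrainedDensity Λ T η) :
    ∫ x, (V x + 2 * l * ∫ y, logKernel x y * ρ y) * (ρ x - η x) ≤ 0 := by
  have hd : IsBoundedDensity (Λ + |1| * Λ) T fun x => ρ x - η x := by
    simpa using hρ.toIsBoundedDensity.sub_mul hη.toIsBoundedDensity 1
  set A := (∫ x, V x * (ρ x - η x)) + 2 * l * logEnergy ρ (fun x => ρ x - η x) with hA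
  set E := logEnergy (fun x => ρ x - η x) (fun x => ρ x - η x)
  -- A is the slope of the energy towards η; dividing the minimality inequality by s and letting s →
  -- 0 removes the quadratic term.
  have h1 : ∀ s : ℝ, 0 < s → s ≤ 1 → A ≤ l * s * E := by
    intro s hs0 hs1
    have h2 := hmin _ (hρ.sub_mul hη hs0.le hs1)
    rw [chargeEnergy_sub hV hρ hη s] at h2
    have h3 : s * A ≤ s * (l * s * E) := by nlinarith
    exact le_of_mul_le_mul_left h3 hs0
  have h2 : A ≤ 0 := by
    have h3 : Tendsto (fun n : ℕ => l * (1 / ((n : ℝ) + 1)) * E) atTop (nhds (l * 0 * E)) :=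
      (tendsto_one_div_add_atTop_nhds_zero_nat.const_mul l).mul_const E
    rw [mul_zero, zero_mul] at h3
    refine ge_of_tendsto' h3 fun n => h1 _ (by positivity) ?_
    rw [div_le_one (by positivity)]
    linarith [(Nat.cast_nonneg n : (0 : ℝ) ≤ n)]
  have hE : logEnergy ρ (fun x => ρ x - η x) = ∫ x, (ρ x - η x) * ∫ y, logKernel x y * ρ y := by
    rw [logEnergy_comm, hρ.logEnergy_eq hd.integrable hd.integrable_norm_mul]
  have hi : Integrable fun x => (ρ x - η x) * ∫ y, logKernel x y * ρ y := by
    have := (hρ.integrable_energy hd.integrable hd.integrable_norm_mul)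
    rw [Measure.volume_eq_prod] at this
    refine this.integral_prod_left.congr (Eventually.of_forall fun x => ?_)
    simp only [mul_assoc]
    rw [integral_const_mul]
  rw [hA, hE, ← integral_const_mul, ← integral_add (hd.integrable_mul hV) (hi.const_mul _)] at h2
  refine le_of_eq_of_le (integral_congr_ae (Eventually.of_forall fun x => ?_)) h2
  dsimp only
  ring

/-! ### The equilibrium density -/

theorem locallyIntegrable_logKernel (a : ℂ) : LocallyIntegrable fun x => logKernel x a := by
  have h1 : LocallyIntegrable fun x => nearKernel (a - x) + ‖a - x‖ :=
    (integrable_nearKernel_sub a).locallyIntegrable.add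
      (by fun_prop : Continuous fun x : ℂ => ‖a - x‖).locallyIntegrable
  refine h1.mono (by fun_prop) (Eventually.of_forall fun x => ?_)
  rw [logKernel_comm]
  exact (abs_logKernel_le a x).trans (le_abs_self _)

/-- The external potential of charges `q` at the points of `S` and a neutralizing background. -/
noncomputable def extPotential (q : ℝ) (S : Finset ℂ) (x : ℂ) : ℝ :=
  ∑ a ∈ S, q * logKernel x a + ‖x‖ ^ 2

/-- The logarithmic potential of a charge density. -/
noncomputable def logPotential (ρ : ℂ → ℝ) (x : ℂ) : ℝ := ∫ y, logKernel x y * ρ y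

/-- The total electrostatic potential. -/
noncomputable def totalPotential (l q : ℝ) (S : Finset ℂ) (ρ : ℂ → ℝ) (x : ℂ) : ℝ :=
  extPotential q S x + 2 * l * logPotential ρ x

theorem locallyIntegrable_extPotential (q : ℝ) (S : Finset ℂ) :
    LocallyIntegrable (extPotential q S) := by
  refine LocallyIntegrable.add ?_ (by fun_prop : Continuous fun x : ℂ => ‖x‖ ^ 2).locallyIntegrable
  exact locallyIntegrable_finsetSum S fun a _ => (locallyIntegrable_logKernel a).smul q

theorem measurable_extPotential (q : ℝ) (S : Finset ℂ) : Measurable (extPotential q S) := by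
  unfold extPotential
  fun_prop

/-- The crude bound log r ≤ r suffices: the charges contribute at worst linearly, with total charge
at most K, against the quadratic background. -/
theorem le_extPotential {q K R₀ : ℝ} {S : Finset ℂ} (hq : 0 ≤ q) (hK : q * S.card ≤ K)
    (hR : 0 ≤ R₀) (hS : ∀ a ∈ S, ‖a‖ ≤ R₀) (x : ℂ) :
    ‖x‖ ^ 2 - K * (‖x‖ + R₀) ≤ extPotential q S x := by
  have h1 : ∑ a ∈ S, -(q * (‖x‖ + R₀)) ≤ ∑ a ∈ S, q * logKernel x a := by
    refine Finset.sum_le_sum fun a ha => ?_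
    have h2 := neg_norm_le_logKernel x a
    have h3 := norm_sub_le x a
    have h4 := hS a ha
    have h5 := mul_le_mul_of_nonneg_left (show -(‖x‖ + R₀) ≤ logKernel x a by linarith) hq
    linarith
  rw [Finset.sum_const, nsmul_eq_mul] at h1
  have h2 := mul_le_mul_of_nonneg_right hK (add_nonneg (norm_nonneg x) hR)
  unfold extPotential
  linarith

namespace IsBoundedDensity

variable {Λ T : ℝ} {β : ℂ → ℝ}

/-- The cutoff r is free. Within r of x or x' the singularity contributes O(r²); beyond it the
kernel is Lipschitz with constant 1/r. -/
theorem abs_logPotential_sub_le (h : IsBoundedDensity Λ T β) {r : ℝ} (hr : 0 < r) (x x' : ℂ) :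
    |logPotential β x - logPotential β x'| ≤
      2 * Λ * (r ^ 2 * nearMass) + ‖x - x'‖ / r * ∫ y, |β y| := by
  -- For a ≥ r this is the Lipschitz bound of log on [r, ∞). For a ≤ r the part of the increment
  -- below r is the positive logarithm.
  have key : ∀ a b : ℝ, 0 < a → a ≤ b →
      Real.log b - Real.log a ≤ Real.posLog (r / a) + (b - a) / r := by
    intro a b ha hab
    have hb : 0 < b := ha.trans_le hab
    rcases le_total r a with h1 | h1
    · have h2 := Real.log_le_sub_one_of_pos (div_pos hb ha)
      rw [Real.log_div hb.ne' ha.ne'] at h2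
      have h3 : b / a - 1 = (b - a) / a := by field_simp
      have h4 : (b - a) / a ≤ (b - a) / r := by
        have := sub_nonneg.2 hab
        gcongr
      have h5 : 0 ≤ Real.posLog (r / a) := Real.posLog_nonneg
      linarith
    · have h2 := Real.log_le_sub_one_of_pos (div_pos hb hr)
      rw [Real.log_div hb.ne' hr.ne'] at h2
      have h3 : Real.log (r / a) ≤ Real.posLog (r / a) := le_max_right _ _
      rw [Real.log_div hr.ne' ha.ne'] at h3
      have h4 : b / r - 1 ≤ (b - a) / r := by
        rw [sub_div]
        have : a / r ≤ 1 := (div_le_one hr).2 h1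
        linarith
      linarith
  have hnear : ∀ w : ℂ, nearKernel (r⁻¹ • w) = Real.posLog (r / ‖w‖) := by
    intro w
    rw [nearKernel, norm_smul, norm_inv, Real.norm_of_nonneg hr.le, mul_inv, inv_inv]
    rfl
  have hpt : ∀ y, y ≠ x → y ≠ x' → |logKernel x y - logKernel x' y| ≤
      nearKernel (r⁻¹ • (x - y)) + nearKernel (r⁻¹ • (x' - y)) + ‖x - x'‖ / r := by
    intro y hy hy'
    have ha : 0 < ‖x - y‖ := norm_pos_iff.2 (sub_ne_zero.2 hy.symm)
    have hb : 0 < ‖x' - y‖ := norm_pos_iff.2 (sub_ne_zero.2 hy'.symm)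
    have h1 : ‖x - y‖ - ‖x' - y‖ ≤ ‖x - x'‖ := by
      have := norm_sub_norm_le (x - y) (x' - y); rwa [sub_sub_sub_cancel_right] at this
    have h2 : ‖x' - y‖ - ‖x - y‖ ≤ ‖x - x'‖ := by
      have := norm_sub_norm_le (x' - y) (x - y)
      rwa [sub_sub_sub_cancel_right, norm_sub_rev x' x] at this
    have p1 : 0 ≤ Real.posLog (r / ‖x - y‖) := Real.posLog_nonneg
    have p2 : 0 ≤ Real.posLog (r / ‖x' - y‖) := Real.posLog_nonneg
    rw [hnear, hnear, logKernel_eq_neg_log, logKernel_eq_neg_log]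
    rcases le_total ‖x - y‖ ‖x' - y‖ with h3 | h3
    · have h4 := key _ _ ha h3
      have h5 : (‖x' - y‖ - ‖x - y‖) / r ≤ ‖x - x'‖ / r := by gcongr
      have h6 := Real.log_le_log ha h3
      rw [abs_of_nonneg (by linarith)]
      linarith
    · have h4 := key _ _ hb h3
      have h5 : (‖x - y‖ - ‖x' - y‖) / r ≤ ‖x - x'‖ / r := by gcongr
      have h6 := Real.log_le_log hb h3
      rw [abs_of_nonpos (by linarith)]
      linarith
  have i1 := (integrable_nearKernel_scaled hr x).const_mul Λ
  have i2 := (integrable_nearKernel_scaled hr x').const_mul Λ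
  have i3 := h.integrable.abs.const_mul (‖x - x'‖ / r)
  have hn : ∀ x : ℂ, ∫ y, nearKernel (r⁻¹ • (x - y)) = r ^ 2 * nearMass := fun x => by
    rw [← integral_nearKernel_scaled hr,
      ← integral_sub_left_eq_self (fun w : ℂ => nearKernel (r⁻¹ • w)) volume x]
  unfold logPotential
  rw [← integral_sub (h.integrable_logKernel_mul x) (h.integrable_logKernel_mul x')]
  refine abs_integral_le_integral_abs.trans ?_
  calc ∫ y, |logKernel x y * β y - logKernel x' y * β y|
      ≤ ∫ y, (Λ * nearKernel (r⁻¹ • (x - y)) + Λ * nearKernel (r⁻¹ • (x' - y)) +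
          ‖x - x'‖ / r * |β y|) := by
        refine integral_mono_ae ((h.integrable_logKernel_mul x).sub
          (h.integrable_logKernel_mul x')).abs ((i1.add i2).add i3) ?_
        filter_upwards [compl_mem_ae_iff.2 (measure_singleton (μ := volume) x),
          compl_mem_ae_iff.2 (measure_singleton (μ := volume) x')] with y hy hy'
        rw [← _root_.sub_mul, abs_mul]
        have h1 := hpt y hy hy'
        have h2 := h.abs_le y
        have h3 := nearKernel_nonneg (r⁻¹ • (x - y))
        have h4 := nearKernel_nonneg (r⁻¹ • (x' - y))
        calc |logKernel x y - logKernel x' y| * |β y|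
            ≤ (nearKernel (r⁻¹ • (x - y)) + nearKernel (r⁻¹ • (x' - y)) + ‖x - x'‖ / r) * |β y| := by
              gcongr
          _ = nearKernel (r⁻¹ • (x - y)) * |β y| + nearKernel (r⁻¹ • (x' - y)) * |β y| +
              ‖x - x'‖ / r * |β y| := by ring
          _ ≤ nearKernel (r⁻¹ • (x - y)) * Λ + nearKernel (r⁻¹ • (x' - y)) * Λ +
              ‖x - x'‖ / r * |β y| := by gcongr
          _ = _ := by ring
    _ = _ := by
        have e1 := integral_add i1 i2
        have e2 := integral_add (i1.add i2) i3
        simp only [Pi.add_apply] at e2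
        rw [e2, e1, integral_const_mul,
          integral_const_mul, integral_const_mul, hn, hn]
        ring

theorem continuous_logPotential (h : IsBoundedDensity Λ T β) : Continuous (logPotential β) := by
  rw [Metric.continuous_iff]
  intro x ε hε
  set A := 2 * Λ * nearMass with hA
  have hA0 : 0 ≤ A := by have := h.nonneg; have := nearMass_pos; positivity
  set I := ∫ y, |β y| with hI
  have hI0 : 0 ≤ I := integral_nonneg fun _ => abs_nonneg _
  -- This makes the near part r² A smaller than ε/2; the distance is then chosen small relative to
  -- r.
  set r := min 1 (ε / (2 * (A + 1))) with hr
  have hr0 : 0 < r := lt_min one_pos (by positivity)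
  refine ⟨r * ε / (2 * (I + 1)), by positivity, fun y hy => ?_⟩
  rw [dist_eq_norm] at hy
  rw [Real.dist_eq]
  refine (h.abs_logPotential_sub_le hr0 y x).trans_lt ?_
  have h1 : 2 * Λ * (r ^ 2 * nearMass) = r * (r * A) := by rw [hA]; ring
  have h2 : r * (r * A) ≤ 1 * (r * A) := by
    gcongr
    exact min_le_left _ _
  have h3 : r * (2 * (A + 1)) ≤ ε := by
    rw [← le_div_iff₀ (by positivity)]; exact min_le_right _ _
  have h4 : ‖y - x‖ / r * I ≤ ε / 2 := by
    have h5 : ‖y - x‖ * (2 * (I + 1)) ≤ r * ε := by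
      rw [← le_div_iff₀ (by positivity)]; exact hy.le
    rw [div_mul_eq_mul_div, div_le_div_iff₀ hr0 two_pos]
    nlinarith [norm_nonneg (y - x)]
  rw [h1]
  nlinarith

end IsBoundedDensity

theorem IsConstrainedDensity.logPotential_le {Λ T : ℝ} {ρ : ℂ → ℝ}
    (h : IsConstrainedDensity Λ T ρ) (x : ℂ) : logPotential ρ x ≤ Λ * nearMass := by
  rw [← integral_nearKernel_sub x, ← integral_const_mul]
  refine integral_mono (h.integrable_logKernel_mul x) ((integrable_nearKernel_sub x).const_mul _)
    fun y => ?_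
  have h1 := logKernel_le_nearKernel x y
  have h2 := nearKernel_nonneg (x - y)
  have h3 := h.nonneg' y
  have h4 := (le_abs_self _).trans (h.abs_le y)
  calc logKernel x y * ρ y ≤ nearKernel (x - y) * ρ y := by gcongr
    _ ≤ nearKernel (x - y) * Λ := by gcongr
    _ = _ := mul_comm _ _

theorem IsConstrainedDensity.le_logPotential {Λ T : ℝ} {ρ : ℂ → ℝ}
    (h : IsConstrainedDensity Λ T ρ) (x : ℂ) : -(‖x‖ + T) ≤ logPotential ρ x := by
  have h1 : ∫ y, -(‖x‖ + T) * ρ y = -(‖x‖ + T) := by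
    rw [integral_const_mul, h.integral_eq_one, mul_one]
  rw [← h1]
  refine integral_mono (h.integrable.const_mul _) (h.integrable_logKernel_mul x) fun y => ?_
  by_cases hy : T < ‖y‖
  · simp [h.eq_zero y hy]
  · have h2 := neg_norm_le_logKernel x y
    have h3 := norm_sub_le x y
    exact mul_le_mul_of_nonneg_right (by linarith [not_lt.1 hy]) (h.nonneg' y)

/-! ### The bathtub principle. -/

/-- Existence of a quantile of a real function with respect to a finite measure. -/
theorem exists_quantile {α : Type*} [MeasurableSpace α] (μ : Measure α) [IsFiniteMeasure μ]
    {f : α → ℝ} (hf : Measurable f) {c : ENNReal} (hc0 : 0 < c) (hc : c < μ Set.univ) :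
    ∃ e : ℝ, μ {x | f x < e} ≤ c ∧ c ≤ μ {x | f x ≤ e} := by
  set A : Set ℝ := {e | c ≤ μ {x | f x ≤ e}} with hA
  have hmeas : ∀ e : ℝ, MeasurableSet {x | f x ≤ e} := fun e => measurableSet_le hf measurable_const
  have hAne : A.Nonempty := by
    have h1 : Tendsto (fun n : ℕ => μ {x | f x ≤ n}) atTop (nhds (μ (⋃ n : ℕ, {x | f x ≤ n}))) :=
      tendsto_measure_iUnion_atTop fun a b hab x (hx : f x ≤ a) =>
        hx.trans (by exact_mod_cast hab)
    have h2 : (⋃ n : ℕ, {x | f x ≤ n}) = Set.univ := by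
      ext x
      simpa using exists_nat_ge (f x)
    rw [h2] at h1
    obtain ⟨n, hn⟩ := (h1.eventually (lt_mem_nhds hc)).exists
    exact ⟨n, hn.le⟩
  have hAbdd : BddBelow A := by
    have h1 : Tendsto (fun n : ℕ => μ {x | f x ≤ -n}) atTop
        (nhds (μ (⋂ n : ℕ, {x | f x ≤ -n}))) :=
      tendsto_measure_iInter_atTop (fun n => (hmeas _).nullMeasurableSet)
        (fun a b hab x (hx : f x ≤ -b) => hx.trans (by
          have : (a : ℝ) ≤ b := by exact_mod_cast hab
          linarith)) ⟨0, measure_ne_top _ _⟩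
    have h2 : (⋂ n : ℕ, {x | f x ≤ -n}) = ∅ := by
      ext x
      obtain ⟨n, hn⟩ := exists_nat_gt (-f x)
      simp only [Set.mem_iInter, Set.mem_empty_iff_false, iff_false, not_forall]
      exact ⟨n, fun h : f x ≤ -n => by linarith⟩
    rw [h2, measure_empty] at h1
    obtain ⟨n, hn⟩ := (h1.eventually (gt_mem_nhds hc0)).exists
    refine ⟨-n, fun e (he : c ≤ _) => ?_⟩
    by_contra hlt
    have : μ {x | f x ≤ e} ≤ μ {x | f x ≤ -n} :=
      measure_mono fun x (hx : f x ≤ e) => hx.trans (not_le.1 hlt).le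
    exact absurd (he.trans this) (not_le.2 hn)
  refine ⟨sInf A, ?_, ?_⟩
  · have h1 : {x | f x < sInf A} = ⋃ n : ℕ, {x | f x ≤ sInf A - 1 / ((n : ℝ) + 1)} := by
      ext x
      simp only [Set.mem_ofPred_eq, Set.mem_iUnion]
      constructor
      · intro hx
        obtain ⟨n, hn⟩ := exists_nat_one_div_lt (sub_pos.2 hx)
        exact ⟨n, by linarith⟩
      · rintro ⟨n, hn⟩
        have : (0 : ℝ) < 1 / ((n : ℝ) + 1) := by positivity
        linarith
    have h2 : Tendsto (fun n : ℕ => μ {x | f x ≤ sInf A - 1 / ((n : ℝ) + 1)}) atTop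
        (nhds (μ (⋃ n : ℕ, {x | f x ≤ sInf A - 1 / ((n : ℝ) + 1)}))) :=
      tendsto_measure_iUnion_atTop fun a b hab x (hx : f x ≤ _) => hx.trans (by
        have : (1 : ℝ) / (b + 1) ≤ 1 / (a + 1) := by gcongr
        linarith)
    rw [h1]
    refine le_of_tendsto' h2 fun n => ?_
    by_contra hlt
    have h3 : (0 : ℝ) < 1 / ((n : ℝ) + 1) := by positivity
    have h4 := csInf_le hAbdd (show sInf A - 1 / ((n : ℝ) + 1) ∈ A from (not_le.1 hlt).le)
    linarith
  · have h1 : {x | f x ≤ sInf A} = ⋂ n : ℕ, {x | f x ≤ sInf A + 1 / ((n : ℝ) + 1)} := by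
      ext x
      simp only [Set.mem_ofPred_eq, Set.mem_iInter]
      constructor
      · intro hx n
        have : (0 : ℝ) < 1 / ((n : ℝ) + 1) := by positivity
        linarith
      · intro hx
        by_contra hlt
        obtain ⟨n, hn⟩ := exists_nat_one_div_lt (sub_pos.2 (not_le.1 hlt))
        linarith [hx n]
    have h2 : Tendsto (fun n : ℕ => μ {x | f x ≤ sInf A + 1 / ((n : ℝ) + 1)}) atTop
        (nhds (μ (⋂ n : ℕ, {x | f x ≤ sInf A + 1 / ((n : ℝ) + 1)}))) :=
      tendsto_measure_iInter_atTop (fun n => (hmeas _).nullMeasurableSet)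
        (fun a b hab x (hx : f x ≤ _) => hx.trans (by
          have : (1 : ℝ) / (b + 1) ≤ 1 / (a + 1) := by gcongr
          linarith)) ⟨0, measure_ne_top _ _⟩
    rw [h1]
    refine ge_of_tendsto' h2 fun n => ?_
    have h3 : (0 : ℝ) < 1 / ((n : ℝ) + 1) := by positivity
    obtain ⟨e, he, hlt⟩ := exists_lt_of_csInf_lt hAne (show sInf A < sInf A + 1 / ((n : ℝ) + 1) by
      linarith)
    exact le_trans he (measure_mono fun x (hx : f x ≤ e) => hx.trans hlt.le)

/-- The bathtub principle: a density bounded by `Λ` which minimizes a linear functional saturates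
the bound below some level and vanishes above it. -/
theorem exists_bathtub_level {Λ T : ℝ} (hT : 0 < T) (hΛT : 1 < Λ * (Real.pi * T ^ 2))
    {Φ ρ : ℂ → ℝ} (hΦm : Measurable Φ) (hΦ : LocallyIntegrable Φ)
    (hρ : IsConstrainedDensity Λ T ρ)
    (hmin : ∀ η, IsConstrainedDensity Λ T η → ∫ x, Φ x * (ρ x - η x) ≤ 0) :
    ∃ e : ℝ, volume.real ({x | Φ x < e} ∩ Metric.closedBall 0 T) ≤ 1 / Λ ∧
      ∀ᵐ x, (‖x‖ ≤ T → Φ x < e → ρ x = Λ) ∧ (e < Φ x → ρ x = 0) := by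
  have hΛ : 0 < Λ := by
    by_contra h
    have : Λ * (Real.pi * T ^ 2) ≤ 0 := mul_nonpos_of_nonpos_of_nonneg (not_lt.1 h) (by positivity)
    linarith
  set B := Metric.closedBall (0 : ℂ) T with hB
  have hBm : MeasurableSet B := measurableSet_closedBall
  have hBfin : volume B ≠ ⊤ := measure_closedBall_lt_top.ne
  have : IsFiniteMeasure (volume.restrict B) := ⟨by simpa using hBfin.lt_top⟩
  have hBvol : volume B = ENNReal.ofReal (Real.pi * T ^ 2) := by
    rw [hB, Complex.volume_closedBall, ENNReal.ofReal_mul Real.pi_pos.le,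
      ENNReal.ofReal_pow hT.le, mul_comm, ← NNReal.coe_real_pi, ENNReal.ofReal_coe_nnreal]
  have hc : ENNReal.ofReal (1 / Λ) < volume.restrict B Set.univ := by
    rw [Measure.restrict_apply_univ, hBvol]
    refine (ENNReal.ofReal_lt_ofReal_iff (by positivity)).2 ?_
    rw [div_lt_iff₀ hΛ]
    linarith
  obtain ⟨e, he1, he2⟩ := exists_quantile (volume.restrict B) hΦm
    (ENNReal.ofReal_pos.2 (by positivity : 0 < 1 / Λ)) hc
  have hm1 : MeasurableSet {x | Φ x < e} := measurableSet_lt hΦm measurable_const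
  have hm2 : MeasurableSet {x | Φ x ≤ e} := measurableSet_le hΦm measurable_const
  have hm3 : MeasurableSet {x | Φ x = e} := measurableSet_eq_fun hΦm measurable_const
  rw [Measure.restrict_apply hm1] at he1
  rw [Measure.restrict_apply hm2] at he2
  set E1 := {x | Φ x < e} ∩ B with hE1
  set E2 := {x | Φ x = e} ∩ B with hE2
  have hE1m : MeasurableSet E1 := hm1.inter hBm
  have hE2m : MeasurableSet E2 := hm3.inter hBm
  have hfin : ∀ E : Set ℂ, E ⊆ B → volume E ≠ ⊤ := fun E hE => measure_ne_top_of_subset hE hBfin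
  have hE12 : {x | Φ x ≤ e} ∩ B = E1 ∪ E2 := by
    ext x
    simp only [hE1, hE2, Set.mem_inter_iff, Set.mem_ofPred_eq, Set.mem_union, ← or_and_right,
      le_iff_lt_or_eq]
  have hdisj : Disjoint E1 E2 := by
    rw [Set.disjoint_left]
    rintro x ⟨h1, -⟩ ⟨h2, -⟩
    exact absurd (h2 : Φ x = e) (ne_of_lt h1)
  have hr1 : volume.real E1 ≤ 1 / Λ := ENNReal.toReal_le_of_le_ofReal (by positivity) he1
  have hr2 : 1 / Λ ≤ volume.real E1 + volume.real E2 := by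
    rw [← measureReal_union hdisj hE2m (hfin _ Set.inter_subset_right)
      (hfin _ Set.inter_subset_right), ← hE12]
    exact (ENNReal.ofReal_le_iff_le_toReal (hfin _ Set.inter_subset_right)).1 he2
  refine ⟨e, hr1, ?_⟩
  set m1 := volume.real E1 with hm1'
  set m2 := volume.real E2 with hm2'
  have hm2n : 0 ≤ m2 := measureReal_nonneg
  have hm1Λ : Λ * m1 ≤ 1 := by
    rw [le_div_iff₀ hΛ] at hr1; linarith
  have hm12Λ : 1 ≤ Λ * (m1 + m2) := by
    rw [div_le_iff₀ hΛ] at hr2; linarith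
  -- The comparison density η fills {Φ < e} completely and the level set {Φ = e} to the fraction θ
  -- that brings the mass to 1. If m2 = 0 then θ = 0 by convention, and Λ m1 is already 1.
  set θ := (1 - Λ * m1) / (Λ * m2) with hθ
  have hθ0 : 0 ≤ θ := div_nonneg (by linarith) (by positivity)
  have hθ1 : θ ≤ 1 := div_le_one_of_le₀ (by linarith) (by positivity)
  have hθm : Λ * m1 + θ * (Λ * m2) = 1 := by
    rcases hm2n.eq_or_lt with h0 | h0
    · rw [← h0] at hm12Λ ⊢
      linarith
    · rw [hθ, div_mul_cancel₀ _ (by positivity)]; ring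
  set η : ℂ → ℝ := fun x => E1.indicator (fun _ => Λ) x + E2.indicator (fun _ => θ * Λ) x with hη
  have hηE1 : ∀ x ∈ E1, η x = Λ := fun x hx => by
    simp only [hη]
    rw [Set.indicator_of_mem hx, Set.indicator_of_notMem (Set.disjoint_left.1 hdisj hx), add_zero]
  have hηE2 : ∀ x ∈ E2, η x = θ * Λ := fun x hx => by
    simp only [hη]
    rw [Set.indicator_of_mem hx, Set.indicator_of_notMem (Set.disjoint_right.1 hdisj hx), zero_add]
  have hηE : ∀ x, x ∉ E1 → x ∉ E2 → η x = 0 := fun x hx hx' => by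
    simp only [hη]
    rw [Set.indicator_of_notMem hx, Set.indicator_of_notMem hx', add_zero]
  have hη01 : ∀ x, 0 ≤ η x ∧ η x ≤ Λ := fun x => by
    by_cases h1 : x ∈ E1
    · rw [hηE1 x h1]; exact ⟨hΛ.le, le_rfl⟩
    · by_cases h2 : x ∈ E2
      · rw [hηE2 x h2]
        exact ⟨by positivity, by nlinarith⟩
      · rw [hηE x h1 h2]; exact ⟨le_rfl, hΛ.le⟩
  have hηout : ∀ x, T < ‖x‖ → η x = 0 := fun x hx =>
    hηE x (fun h => by have := h.2; simp [hB] at this; linarith)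
      (fun h => by have := h.2; simp [hB] at this; linarith)
  have hηc : IsConstrainedDensity Λ T η := by
    refine ⟨⟨(measurable_const.indicator hE1m).add (measurable_const.indicator hE2m), fun y => ?_,
      hηout⟩, fun y => (hη01 y).1, ?_⟩
    · rw [abs_of_nonneg (hη01 y).1]; exact (hη01 y).2
    · have i1 : Integrable (E1.indicator fun _ => Λ) := (integrable_indicator_iff hE1m).2
        (integrableOn_const (hfin _ Set.inter_subset_right))
      have i2 : Integrable (E2.indicator fun _ => θ * Λ) := (integrable_indicator_iff hE2m).2
        (integrableOn_const (hfin _ Set.inter_subset_right))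
      simp only [hη]
      rw [integral_add i1 i2, integral_indicator hE1m, integral_indicator hE2m, setIntegral_const,
        setIntegral_const, smul_eq_mul, smul_eq_mul, ← hm1', ← hm2']
      linarith
  have hd : IsBoundedDensity (Λ + |1| * Λ) T fun x => ρ x - η x := by
    simpa using hρ.toIsBoundedDensity.sub_mul hηc.toIsBoundedDensity 1
  have hint : Integrable fun x => (Φ x - e) * (ρ x - η x) :=
    hd.integrable_mul (hΦ.sub continuous_const.locallyIntegrable)
  -- Below the level η is as large as allowed, above it η vanishes. Since ρ and η have equal mass, e
  -- may be subtracted from Φ in the variational inequality, so this nonnegative product has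
  -- integral at most 0 and vanishes almost everywhere.
  have hnn : ∀ x, 0 ≤ (Φ x - e) * (ρ x - η x) := fun x => by
    by_cases hxT : T < ‖x‖
    · simp [hρ.eq_zero x hxT, hηout x hxT]
    have hxB : x ∈ B := by simpa [hB] using hxT
    rcases lt_trichotomy (Φ x) e with h | h | h
    · rw [hηE1 x ⟨h, hxB⟩]
      have := (le_abs_self _).trans (hρ.abs_le x)
      exact mul_nonneg_of_nonpos_of_nonpos (by linarith) (by linarith)
    · simp [h]
    · rw [hηE x (fun h' => absurd h'.1 (not_lt.2 h.le)) (fun h' => absurd h'.1 h.ne'), sub_zero]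
      exact mul_nonneg (by linarith) (hρ.nonneg' x)
  have hle : ∫ x, (Φ x - e) * (ρ x - η x) ≤ 0 := by
    have h1 := hmin η hηc
    have h2 : ∫ x, (Φ x - e) * (ρ x - η x) =
        (∫ x, Φ x * (ρ x - η x)) - ∫ x, e * (ρ x - η x) := by
      rw [← integral_sub (hd.integrable_mul hΦ) (hd.integrable.const_mul e)]
      refine integral_congr_ae (Eventually.of_forall fun x => ?_)
      dsimp only
      ring
    rw [h2, integral_const_mul, integral_sub hρ.integrable hηc.integrable, hρ.integral_eq_one,
      hηc.integral_eq_one]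
    linarith
  have hz := (integral_eq_zero_iff_of_nonneg hnn hint).1 (le_antisymm hle (integral_nonneg hnn))
  filter_upwards [hz] with x hx
  have hx : (Φ x - e) * (ρ x - η x) = 0 := hx
  constructor
  · intro hxT hxe
    have h1 := hηE1 x ⟨hxe, by simpa [hB] using hxT⟩
    rcases mul_eq_zero.1 hx with h | h <;> linarith
  · intro hxe
    have h1 := hηE x (fun h' => absurd h'.1 (not_lt.2 hxe.le)) (fun h' => absurd h'.1 hxe.ne')
    rcases mul_eq_zero.1 hx with h | h <;> linarith

/-- The set where Φ < e has area at most 1/Λ ≤ 1, while the unit disc has area π, so Φ ≥ e on a part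
of the unit disc of area at least 1. The integral of Φ over the unit disc is bounded, hence so is e.
The bound is only linear in T, which later lets T be chosen large. -/
theorem level_le {l q K R₀ Λ T e : ℝ} {S : Finset ℂ} {ρ : ℂ → ℝ} (hl : 0 ≤ l) (hq : 0 ≤ q)
    (hK : q * S.card ≤ K) (hR : 0 ≤ R₀) (hS : ∀ a ∈ S, ‖a‖ ≤ R₀) (hΛ : 1 ≤ Λ) (hT : 1 ≤ T)
    (hρ : IsConstrainedDensity Λ T ρ)
    (he : volume.real ({x | totalPotential l q S ρ x < e} ∩ Metric.closedBall 0 T) ≤ 1 / Λ) :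
    e ≤ K * nearMass +
      Real.pi * (1 + 2 * l * (Λ * nearMass) + (K * (1 + R₀) + 2 * l * (1 + T))) := by
  have hJ := nearMass_pos
  have hK0 : 0 ≤ K := (mul_nonneg hq (Nat.cast_nonneg _)).trans hK
  have hpi := Real.pi_gt_three
  set b := K * (1 + R₀) + 2 * l * (1 + T) with hb
  have hb0 : 0 ≤ b := by positivity
  by_cases hneg : e + b ≤ 0
  · have : 0 ≤ K * nearMass + Real.pi * (1 + 2 * l * (Λ * nearMass) + b) := by positivity
    linarith
  push Not at hneg
  set Φ := totalPotential l q S ρ with hΦ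
  have hΦm : Measurable Φ :=
    (measurable_extPotential q S).add (hρ.continuous_logPotential.measurable.const_mul _)
  set D := Metric.ball (0 : ℂ) 1 with hD
  have hDfin : volume D ≠ ⊤ := measure_ball_lt_top.ne
  set E := {x | Φ x < e} ∩ Metric.closedBall (0 : ℂ) T with hE
  have hEm : MeasurableSet E :=
    (measurableSet_lt hΦm measurable_const).inter measurableSet_closedBall
  have hG : 1 ≤ volume.real (D \ E) := by
    have h1 := measureReal_sdiff_add_inter (μ := volume) (s := D) hEm hDfin
    have h2 : volume.real (D ∩ E) ≤ volume.real E :=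
      measureReal_mono Set.inter_subset_right
        (measure_ne_top_of_subset Set.inter_subset_right measure_closedBall_lt_top.ne)
    have h3 : 1 / Λ ≤ 1 := (div_le_one (by linarith)).2 hΛ
    have h4 : volume.real D = Real.pi := by rw [hD, volume_real_ball _ zero_le_one]; ring
    linarith
  -- F majorizes Φ + b on the unit disc. The shift b makes Φ + b nonnegative there, so the set where
  -- Φ < e can be discarded.
  set F : ℂ → ℝ := fun x => ∑ a ∈ S, q * nearKernel (a - x) + (1 + 2 * l * (Λ * nearMass) + b)
    with hF
  have hFi : IntegrableOn F D := by
    refine Integrable.add ?_ (integrableOn_const hDfin)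
    exact (integrable_finsetSum S fun a _ => (integrable_nearKernel_sub a).const_mul q).integrableOn
  have h1 : ∀ x ∈ D, (D \ E).indicator (fun _ => e + b) x ≤ F x := by
    intro x hx
    have hx1 : ‖x‖ < 1 := by simpa [hD] using hx
    have hup : Φ x + b ≤ F x := by
      have h2 : ∑ a ∈ S, q * logKernel x a ≤ ∑ a ∈ S, q * nearKernel (a - x) := by
        refine Finset.sum_le_sum fun a _ => mul_le_mul_of_nonneg_left ?_ hq
        rw [logKernel_comm]
        exact logKernel_le_nearKernel a x
      have h3 := mul_le_mul_of_nonneg_left (hρ.logPotential_le x) (by positivity : 0 ≤ 2 * l)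
      have h4 : ‖x‖ ^ 2 ≤ 1 := by nlinarith [norm_nonneg x]
      simp only [hΦ, totalPotential, extPotential, hF]
      linarith
    by_cases hxE : x ∈ E
    · rw [Set.indicator_of_notMem (fun h => h.2 hxE)]
      refine le_trans ?_ hup
      have h2 := le_extPotential hq hK hR hS x
      have h3 := mul_le_mul_of_nonneg_left (hρ.le_logPotential x) (by positivity : 0 ≤ 2 * l)
      have h4 : K * (‖x‖ + R₀) ≤ K * (1 + R₀) := by gcongr
      have h5 : 2 * l * (‖x‖ + T) ≤ 2 * l * (1 + T) := by gcongr
      simp only [hΦ, totalPotential]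
      nlinarith [sq_nonneg ‖x‖]
    · rw [Set.indicator_of_mem (show x ∈ D \ E from ⟨hx, hxE⟩)]
      have hxe : e ≤ Φ x := by
        by_contra hlt
        exact hxE ⟨not_le.1 hlt, by simpa using hx1.le.trans hT⟩
      linarith
  have h2 : ∫ x in D, (D \ E).indicator (fun _ => e + b) x ≤ ∫ x in D, F x := by
    refine setIntegral_mono_on ?_ hFi measurableSet_ball h1
    exact ((integrable_indicator_iff (measurableSet_ball.diff hEm)).2 (integrableOn_const
      (measure_ne_top_of_subset Set.sdiff_subset hDfin))).integrableOn
  have h3 : ∫ x in D, (D \ E).indicator (fun _ => e + b) x = volume.real (D \ E) * (e + b) := by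
    rw [setIntegral_indicator (measurableSet_ball.diff hEm),
      Set.inter_eq_self_of_subset_right Set.sdiff_subset, setIntegral_const, smul_eq_mul]
  have h4 : ∫ x in D, F x ≤ K * nearMass + Real.pi * (1 + 2 * l * (Λ * nearMass) + b) := by
    have i1 : IntegrableOn (fun x => ∑ a ∈ S, q * nearKernel (a - x)) D :=
      (integrable_finsetSum S fun a _ => (integrable_nearKernel_sub a).const_mul q).integrableOn
    have i2 : IntegrableOn (fun _ : ℂ => 1 + 2 * l * (Λ * nearMass) + b) D :=
      integrableOn_const hDfin
    simp only [hF]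
    rw [integral_add i1 i2, setIntegral_const, hD, volume_real_ball _ zero_le_one, smul_eq_mul,
      integral_finsetSum _ fun a _ => ((integrable_nearKernel_sub a).const_mul q).integrableOn]
    have h5 : ∀ a ∈ S, ∫ x in Metric.ball (0 : ℂ) 1, q * nearKernel (a - x) ≤ q * nearMass := by
      intro a _
      rw [integral_const_mul, ← integral_nearKernel_sub a]
      exact mul_le_mul_of_nonneg_left (setIntegral_le_integral (integrable_nearKernel_sub a)
        (Eventually.of_forall fun _ => nearKernel_nonneg _)) hq
    have h6 := Finset.sum_le_sum h5
    rw [Finset.sum_const, nsmul_eq_mul] at h6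
    have h7 := mul_le_mul_of_nonneg_right hK hJ.le
    linarith
  have h5 : 1 * (e + b) ≤ volume.real (D \ E) * (e + b) :=
    mul_le_mul_of_nonneg_right hG hneg.le
  linarith

/-- A quantitative mean value inequality in place of Δ(potential) = −2πΛ. The disc average of the
kernel is at most its value at the centre and also at most log(1/r) + const; the smaller of the two
is the central value minus log⁺(r₁/|x₀ − y|). Integrating against ρ = Λ yields the deficit. -/
theorem setIntegral_ball_logPotential_le {Λ T r : ℝ} {ρ : ℂ → ℝ} (hρ : IsConstrainedDensity Λ T ρ)
    {x₀ : ℂ} (hr : 0 < r) (hsat : ∀ᵐ y, y ∈ Metric.ball x₀ r → ρ y = Λ) :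
    ∫ x in Metric.ball x₀ r, logPotential ρ x ≤ Real.pi * r ^ 2 *
      (logPotential ρ x₀ - Λ * ((r * Real.exp (-(nearMass / Real.pi))) ^ 2 * nearMass)) := by
  -- The radius at which the two upper bounds for the disc average coincide.
  set r₁ := r * Real.exp (-(nearMass / Real.pi)) with hr₁
  have hr₁0 : 0 < r₁ := by positivity
  have hr₁r : r₁ ≤ r := by
    rw [hr₁]
    refine mul_le_of_le_one_right hr.le (Real.exp_le_one_iff.2 ?_)
    have := div_pos nearMass_pos Real.pi_pos
    linarith
  set χ : ℂ → ℝ := (Metric.ball x₀ r).indicator fun _ => 1 with hχ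
  have hχb : IsBoundedDensity 1 (‖x₀‖ + r) χ := by
    refine ⟨measurable_const.indicator measurableSet_ball, fun y => ?_, fun y hy => ?_⟩
    · by_cases hy : y ∈ Metric.ball x₀ r <;> simp [hχ, hy]
    · rw [hχ, Set.indicator_of_notMem]
      intro hy'
      rw [mem_ball_iff_norm] at hy'
      have := norm_sub_norm_le y x₀
      linarith
  have hleft : ∫ x in Metric.ball x₀ r, logPotential ρ x = logEnergy χ ρ := by
    rw [hρ.logEnergy_eq hχb.integrable hχb.integrable_norm_mul, ← integral_indicator
      measurableSet_ball]
    refine integral_congr_ae (Eventually.of_forall fun x => ?_)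
    by_cases hx : x ∈ Metric.ball x₀ r
    · simp only [hχ, Set.indicator_of_mem hx, one_mul]; rfl
    · simp only [hχ, Set.indicator_of_notMem hx, zero_mul]
  have hP : ∀ y, ∫ x, logKernel y x * χ x = ∫ x in Metric.ball x₀ r, logKernel y x := by
    intro y
    rw [← integral_indicator measurableSet_ball]
    refine integral_congr_ae (Eventually.of_forall fun x => ?_)
    by_cases hx : x ∈ Metric.ball x₀ r
    · simp only [hχ, Set.indicator_of_mem hx, mul_one]
    · simp only [hχ, Set.indicator_of_notMem hx, mul_zero]
  have hPle : ∀ y, y ≠ x₀ → ∫ x, logKernel y x * χ x ≤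
      Real.pi * r ^ 2 * (logKernel x₀ y - nearKernel (r₁⁻¹ • (x₀ - y))) := by
    intro y hy
    rw [hP]
    have h0 : 0 < ‖x₀ - y‖ := norm_pos_iff.2 (sub_ne_zero.2 hy.symm)
    have h1 := setIntegral_logKernel_ball_le_center hy.symm hr
    simp_rw [logKernel_comm _ y] at h1
    have h2 := setIntegral_logKernel_ball_le y x₀ hr
    have h3 : nearKernel (r₁⁻¹ • (x₀ - y)) = max 0 (Real.log (r₁ / ‖x₀ - y‖)) := by
      rw [nearKernel, norm_smul, norm_inv, Real.norm_of_nonneg hr₁0.le, mul_inv, inv_inv]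
      rfl
    rw [h3]
    rcases le_total 0 (Real.log (r₁ / ‖x₀ - y‖)) with h | h
    · rw [max_eq_right h]
      refine h2.trans (mul_le_mul_of_nonneg_left ?_ (by positivity))
      rw [logKernel_eq_neg_log, Real.log_div hr₁0.ne' h0.ne', hr₁,
        Real.log_mul hr.ne' (Real.exp_pos _).ne', Real.log_exp, one_div, Real.log_inv]
      linarith
    · rw [max_eq_left h, sub_zero, logKernel_comm x₀ y]
      exact h1
  -- The truncated kernel lives in |x₀ − y| < r₁ ≤ r, where ρ takes the value Λ almost everywhere.
  have hnear : ∀ᵐ y, ρ y * nearKernel (r₁⁻¹ • (x₀ - y)) = Λ * nearKernel (r₁⁻¹ • (x₀ - y)) := by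
    filter_upwards [hsat] with y hy
    by_cases hyb : y ∈ Metric.ball x₀ r
    · rw [hy hyb]
    · have h1 : nearKernel (r₁⁻¹ • (x₀ - y)) = 0 := by
        rw [nearKernel, Real.posLog_eq_zero_iff, abs_of_nonneg (by positivity), norm_smul, norm_inv,
          Real.norm_of_nonneg hr₁0.le, mul_inv, inv_inv, ← div_eq_mul_inv]
        rw [mem_ball_iff_norm', not_lt] at hyb
        exact div_le_one_of_le₀ (hr₁r.trans hyb) (norm_nonneg _)
      rw [h1, mul_zero, mul_zero]
  have i1 : Integrable fun y => ρ y * logKernel x₀ y := by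
    simpa only [mul_comm] using hρ.integrable_logKernel_mul x₀
  have i2 : Integrable fun y => ρ y * nearKernel (r₁⁻¹ • (x₀ - y)) :=
    ((integrable_nearKernel_scaled hr₁0 x₀).const_mul Λ).congr (hnear.mono fun y hy => hy.symm)
  have i3 : Integrable fun y => ρ y * ∫ x, logKernel y x * χ x := by
    have := (hχb.integrable_energy hρ.integrable hρ.integrable_norm_mul)
    rw [Measure.volume_eq_prod] at this
    refine this.integral_prod_left.congr (Eventually.of_forall fun x => ?_)
    simp only [mul_assoc]
    rw [integral_const_mul]
  have hnI : ∫ y, nearKernel (r₁⁻¹ • (x₀ - y)) = r₁ ^ 2 * nearMass := by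
    rw [← integral_nearKernel_scaled hr₁0,
      ← integral_sub_left_eq_self (fun w : ℂ => nearKernel (r₁⁻¹ • w)) volume x₀]
  rw [hleft, logEnergy_comm, hχb.logEnergy_eq hρ.integrable hρ.integrable_norm_mul]
  calc ∫ y, ρ y * ∫ x, logKernel y x * χ x
      ≤ ∫ y, Real.pi * r ^ 2 * (ρ y * logKernel x₀ y - ρ y * nearKernel (r₁⁻¹ • (x₀ - y))) := by
        refine integral_mono_ae i3 ((i1.sub i2).const_mul _) ?_
        filter_upwards [compl_mem_ae_iff.2 (measure_singleton (μ := volume) x₀)] with y hy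
        have h1 := mul_le_mul_of_nonneg_left (hPle y hy) (hρ.nonneg' y)
        refine h1.trans_eq ?_
        ring
    _ = _ := by
        rw [integral_const_mul, integral_sub i1 i2, integral_congr_ae hnear, integral_const_mul,
          hnI, logPotential]
        simp_rw [mul_comm (ρ _)]

/-- The minimum principle: if the density saturates its upper bound below the level `e`, then the
total potential is at least `e`. -/
theorem level_le_totalPotential {l q Λ T e : ℝ} {S : Finset ℂ} {ρ : ℂ → ℝ} (hl : 0 ≤ l)
    (hq : 0 < q) (hρ : IsConstrainedDensity Λ T ρ)
    (hΛ : 1 < 2 * l * Λ * (Real.exp (-(nearMass / Real.pi)) ^ 2 * nearMass))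
    (hsat : ∀ᵐ x, ‖x‖ ≤ T → totalPotential l q S ρ x < e → ρ x = Λ)
    (hout : ∀ x, T ≤ ‖x‖ → e < totalPotential l q S ρ x) {x₁ : ℂ} (hx₁ : x₁ ∉ S) :
    e ≤ totalPotential l q S ρ x₁ := by
  by_contra hlt
  push Not at hlt
  set Φ := totalPotential l q S ρ with hΦ
  -- g is exp(−Φ) extended continuously by 0 to the charges, so a maximum of g on the disc is a
  -- minimum of Φ away from S.
  set g : ℂ → ℝ := fun x => (∏ a ∈ S, ‖x - a‖ ^ q) *
    Real.exp (-(‖x‖ ^ 2 + 2 * l * logPotential ρ x)) with hg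
  have hgc : Continuous g := by
    have := hρ.continuous_logPotential
    refine Continuous.mul (continuous_finsetProd S fun a _ => ?_) (by fun_prop)
    exact (by fun_prop : Continuous fun x : ℂ => ‖x - a‖).rpow_const fun _ => Or.inr hq.le
  have hgS : ∀ x ∈ S, g x = 0 := fun x hx => by
    simp only [hg]
    rw [Finset.prod_eq_zero hx (by simp [hq.ne']), zero_mul]
  have hgΦ : ∀ x, x ∉ S → g x = Real.exp (-Φ x) := fun x hx => by
    have h1 : ∀ a ∈ S, ‖x - a‖ ^ q = Real.exp (-(q * logKernel x a)) := fun a ha => by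
      have : 0 < ‖x - a‖ := norm_pos_iff.2 (sub_ne_zero.2 fun h => hx (h ▸ ha))
      rw [Real.rpow_def_of_pos this, logKernel_eq_neg_log]
      ring_nf
    simp only [hg]
    rw [Finset.prod_congr rfl h1, ← Real.exp_sum, ← Real.exp_add, Finset.sum_neg_distrib]
    simp only [hΦ, totalPotential, extPotential]
    ring_nf
  have hx₁T : ‖x₁‖ < T := by
    by_contra h
    exact absurd (hout x₁ (not_lt.1 h)) (not_lt.2 hlt.le)
  obtain ⟨x₀, hx₀B, hx₀⟩ := (isCompact_closedBall (0 : ℂ) T).exists_isMaxOn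
    ⟨x₁, by simpa using hx₁T.le⟩ hgc.continuousOn
  have hmax : ∀ x, ‖x‖ ≤ T → g x ≤ g x₀ := fun x hx => hx₀ (by simpa using hx)
  have hx₀S : x₀ ∉ S := fun h => by
    have h1 := hmax x₁ hx₁T.le
    rw [hgS _ h, hgΦ _ hx₁] at h1
    exact absurd (Real.exp_pos _) (not_lt.2 h1)
  have hx₀e : Φ x₀ < e := by
    have h1 := hmax x₁ hx₁T.le
    rw [hgΦ _ hx₀S, hgΦ _ hx₁, Real.exp_le_exp] at h1
    linarith
  have hx₀T : ‖x₀‖ < T := by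
    by_contra h
    exact absurd (hout x₀ (not_lt.1 h)) (not_lt.2 hx₀e.le)
  have hopen : IsOpen ({x | Real.exp (-e) < g x} ∩ Metric.ball 0 T) :=
    (isOpen_lt continuous_const hgc).inter Metric.isOpen_ball
  obtain ⟨r, hr, hball⟩ := Metric.isOpen_iff.1 hopen x₀ ⟨by
    change Real.exp (-e) < g x₀
    rw [hgΦ _ hx₀S, Real.exp_lt_exp]; linarith, by simpa using hx₀T⟩
  have hin : ∀ x ∈ Metric.ball x₀ r, x ∉ S ∧ Φ x < e ∧ ‖x‖ < T ∧ Φ x₀ ≤ Φ x := by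
    intro x hx
    obtain ⟨h1, h2⟩ := hball hx
    have h1 : Real.exp (-e) < g x := h1
    have h2 : ‖x‖ < T := by simpa using h2
    have h3 : x ∉ S := fun h => by
      rw [hgS _ h] at h1
      exact absurd (Real.exp_pos _) (not_lt.2 h1.le)
    have h4 := hmax x h2.le
    rw [hgΦ _ h3, hgΦ _ hx₀S, Real.exp_le_exp] at h4
    rw [hgΦ _ h3, Real.exp_lt_exp] at h1
    exact ⟨h3, by linarith, h2, by linarith⟩
  have hsat' : ∀ᵐ y, y ∈ Metric.ball x₀ r → ρ y = Λ := by
    filter_upwards [hsat] with y hy hyb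
    obtain ⟨-, h2, h3, -⟩ := hin y hyb
    exact hy h3.le h2
  have hc : ∀ f : ℂ → ℝ, Continuous f → IntegrableOn f (Metric.ball x₀ r) := fun f hf =>
    (hf.continuousOn.integrableOn_compact (isCompact_closedBall x₀ r)).mono_set
      Metric.ball_subset_closedBall
  have i1 : ∀ a ∈ S, IntegrableOn (fun x => q * logKernel x a) (Metric.ball x₀ r) := fun a _ => by
    have h := integrableOn_logKernel_ball a x₀ r
    simp_rw [logKernel_comm a] at h
    exact h.const_mul q
  have i2 := integrable_finsetSum S i1
  have i3 := hc (fun x => ‖x‖ ^ 2) (by fun_prop)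
  have i4 : IntegrableOn (fun x => 2 * l * logPotential ρ x) (Metric.ball x₀ r) :=
    (hc _ hρ.continuous_logPotential).const_mul _
  have hlow : Real.pi * r ^ 2 * Φ x₀ ≤ ∫ x in Metric.ball x₀ r, Φ x := by
    rw [← volume_real_ball x₀ hr.le, ← smul_eq_mul, ← setIntegral_const]
    exact setIntegral_mono_on (integrableOn_const measure_ball_lt_top.ne) ((i2.add i3).add i4)
      measurableSet_ball fun x hx => (hin x hx).2.2.2
  have hΦint : ∫ x in Metric.ball x₀ r, Φ x =
      ∑ a ∈ S, q * (∫ x in Metric.ball x₀ r, logKernel x a) +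
      (∫ x in Metric.ball x₀ r, ‖x‖ ^ 2) +
      2 * l * (∫ x in Metric.ball x₀ r, logPotential ρ x) := by
    have e1 := integral_add i2 i3
    have e2 := integral_add (i2.add i3) i4
    simp only [Pi.add_apply] at e2
    simp only [hΦ, totalPotential, extPotential]
    rw [e2, e1, integral_finsetSum S i1, integral_const_mul]
    simp_rw [integral_const_mul]
  have hs : ∑ a ∈ S, q * ∫ x in Metric.ball x₀ r, logKernel x a ≤
      Real.pi * r ^ 2 * ∑ a ∈ S, q * logKernel x₀ a := by
    rw [Finset.mul_sum]
    refine Finset.sum_le_sum fun a ha => ?_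
    have h1 := setIntegral_logKernel_ball_le_center (a := x₀) (z := a)
      (fun h => hx₀S (h ▸ ha)) hr
    have h2 := mul_le_mul_of_nonneg_left h1 hq.le
    linarith
  have hsq := (setIntegral_norm_sq_ball x₀ hr).2
  have hpot := mul_le_mul_of_nonneg_left (setIntegral_ball_logPotential_le hρ hr hsat')
    (by positivity : 0 ≤ 2 * l)
  rw [hΦint] at hlow
  -- Near its minimum x₀ the average of Φ is at least Φ x₀. The background raises the average by at
  -- most r², whereas the saturated density lowers it by a larger multiple of r², by the choice of
  -- Λ.
  have hfin : Real.pi * r ^ 2 * Φ x₀ ≤ Real.pi * r ^ 2 * (Φ x₀ + r ^ 2 *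
      (1 - 2 * l * Λ * (Real.exp (-(nearMass / Real.pi)) ^ 2 * nearMass))) := by
    refine (hlow.trans (add_le_add (add_le_add hs hsq) hpot)).trans_eq ?_
    simp only [hΦ, totalPotential, extPotential]
    ring
  have h1 := le_of_mul_le_mul_left hfin (by positivity)
  have h2 : r ^ 2 * (1 - 2 * l * Λ * (Real.exp (-(nearMass / Real.pi)) ^ 2 * nearMass)) < 0 :=
    mul_neg_of_pos_of_neg (by positivity) (by linarith)
  linarith

/-- `ρ` is an equilibrium density at level `e` for the charges `q` on `S`: the total potential is
at least `e`, with equality on the support of `ρ`, and it grows quadratically. -/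
structure IsEquilibrium (l q : ℝ) (S : Finset ℂ) (Λ T e : ℝ) (ρ : ℂ → ℝ) : Prop
    extends IsConstrainedDensity Λ T ρ where
  level_le : ∀ x, x ∉ S → e ≤ totalPotential l q S ρ x
  growth : ∀ x, x ∉ S → e + ‖x‖ ^ 2 / 2 - T ^ 2 / 2 ≤ totalPotential l q S ρ x
  support : ∀ᵐ x, (totalPotential l q S ρ x - e) * ρ x = 0

/-- The minimizer under artificial constraints is a true equilibrium: a large Λ excludes Φ < e off
the charges, and a large T keeps Φ above e outside the disc. Both depend only on l, K and R₀. -/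
theorem exists_equilibrium {l K R₀ : ℝ} (hl : 1 ≤ l) (hK0 : 0 ≤ K) (hR : 0 ≤ R₀) :
    ∃ Λ T : ℝ, 1 ≤ Λ ∧ 1 ≤ T ∧ ∀ (q : ℝ) (S : Finset ℂ), 0 < q → q * S.card ≤ K →
      (∀ a ∈ S, ‖a‖ ≤ R₀) → ∃ e ρ, IsEquilibrium l q S Λ T e ρ := by
  have hJ := nearMass_pos
  have hpi := Real.pi_gt_three
  obtain ⟨κ, hκ⟩ : ∃ κ, κ = Real.exp (-(nearMass / Real.pi)) ^ 2 * nearMass := ⟨_, rfl⟩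
  have hκ0 : 0 < κ := hκ ▸ by positivity
  -- With l ≥ 1 this gives 2 l Λ κ ≥ 2 > 1, the hypothesis of the minimum principle.
  obtain ⟨Λ, hΛ1, hΛκ⟩ : ∃ Λ : ℝ, 1 ≤ Λ ∧ 1 ≤ Λ * κ :=
    ⟨max 1 (1 / κ), le_max_left _ _, (div_le_iff₀ hκ0).1 (le_max_right _ _)⟩
  obtain ⟨A₁, hA₁⟩ : ∃ A₁, A₁ = K * nearMass +
    Real.pi * (1 + 2 * l * (Λ * nearMass) + (K * (1 + R₀) + 2 * l)) := ⟨_, rfl⟩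
  have hA₁0 : 0 ≤ A₁ := hA₁ ▸ by positivity
  -- A collects the coefficients of ‖x‖ for ‖x‖ ≥ T: K from the charges, 4l from the potential of ρ,
  -- 2πl from the T-dependence of the level. A' collects the constants. T is such that ‖x‖²/2
  -- dominates A‖x‖ + A' + 1 from there on.
  obtain ⟨A, hA⟩ : ∃ A, A = K + 4 * l + 2 * Real.pi * l := ⟨_, rfl⟩
  have hA0 : 0 ≤ A := hA ▸ by positivity
  obtain ⟨A', hA'⟩ : ∃ A', A' = K * R₀ + A₁ := ⟨_, rfl⟩
  have hA'0 : 0 ≤ A' := hA' ▸ by positivity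
  obtain ⟨T, hT⟩ : ∃ T, T = 2 * (A + A' + 1) := ⟨_, rfl⟩
  have hT1 : 1 ≤ T := by linarith
  refine ⟨Λ, T, hΛ1, hT1, fun q S hq hqK hS => ?_⟩
  have hl0 : 0 ≤ l := by linarith
  have hT2 : 1 ≤ T ^ 2 := one_le_pow₀ hT1
  have hπT : 1 < Real.pi * T ^ 2 := by nlinarith
  have hne : ∃ β, IsConstrainedDensity Λ T β := by
    have hB : volume.real (Metric.closedBall (0 : ℂ) T) = Real.pi * T ^ 2 := by
      rw [Measure.real, Complex.volume_closedBall]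
      simp [(by linarith : 0 ≤ T), mul_comm]
    refine ⟨(Metric.closedBall (0 : ℂ) T).indicator fun _ => (Real.pi * T ^ 2)⁻¹,
      ⟨measurable_const.indicator measurableSet_closedBall, fun y => ?_, fun y hy => ?_⟩,
      fun y => ?_, ?_⟩
    · by_cases hy : y ∈ Metric.closedBall (0 : ℂ) T
      · rw [Set.indicator_of_mem hy, abs_of_pos (by positivity)]
        exact (inv_le_one_of_one_le₀ hπT.le).trans hΛ1
      · rw [Set.indicator_of_notMem hy, abs_zero]; linarith
    · rw [Set.indicator_of_notMem (by simpa using hy)]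
    · exact Set.indicator_nonneg (fun _ _ => by positivity) _
    · rw [integral_indicator measurableSet_closedBall, setIntegral_const, hB, smul_eq_mul,
        mul_inv_cancel₀ (by positivity)]
  have hV := locallyIntegrable_extPotential q S
  obtain ⟨ρ, hρ, hmin⟩ := exists_constrained_minimizer hl0 hV hne
  set Φ := totalPotential l q S ρ with hΦ
  have hΦm : Measurable Φ :=
    (measurable_extPotential q S).add (hρ.continuous_logPotential.measurable.const_mul _)
  have hΦi : LocallyIntegrable Φ :=
    hV.add (continuous_const.mul hρ.continuous_logPotential : Continuous fun x =>
      2 * l * logPotential ρ x).locallyIntegrable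
  obtain ⟨e, he1, he2⟩ := exists_bathtub_level (by linarith) (by nlinarith) hΦm hΦi hρ
    fun η hη => integral_potential_mul_sub_nonneg hV hρ hmin hη
  have hle := level_le hl0 hq.le hqK hR hS hΛ1 hT1 hρ he1
  have hout : ∀ x, T ≤ ‖x‖ → e + ‖x‖ ^ 2 / 2 + 1 ≤ Φ x := by
    intro x hx
    have h1 := le_extPotential hq.le hqK hR hS x
    have h2 := mul_le_mul_of_nonneg_left (hρ.le_logPotential x) (by positivity : 0 ≤ 2 * l)
    have h3 : 2 * l * T ≤ 2 * l * ‖x‖ := by gcongr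
    have h4 : 2 * Real.pi * l * T ≤ 2 * Real.pi * l * ‖x‖ := by gcongr
    have h5 : e ≤ A₁ + 2 * Real.pi * l * T := by
      refine hle.trans_eq ?_
      rw [hA₁]; ring
    have h6 : ‖x‖ ^ 2 / 2 ≥ A * ‖x‖ + A' + 1 := by
      have h7 : 1 ≤ ‖x‖ := hT1.trans hx
      have h8 : (A' + 1) * 1 ≤ (A' + 1) * ‖x‖ := by gcongr
      have h9 : T * ‖x‖ ≤ ‖x‖ * ‖x‖ := by gcongr
      have h10 : T * ‖x‖ = 2 * (A * ‖x‖) + 2 * ((A' + 1) * ‖x‖) := by rw [hT]; ring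
      linarith
    simp only [hΦ, totalPotential]
    rw [hA, hA'] at h6
    linarith
  have hlev : ∀ x, x ∉ S → e ≤ Φ x := fun x hx =>
    level_le_totalPotential hl0 hq hρ (by
      have h1 : 2 * l * Λ * κ = 2 * l * (Λ * κ) := by ring
      rw [← hκ, h1]
      nlinarith) (he2.mono fun x hx => hx.1)
      (fun x hx => by have := hout x hx; have := sq_nonneg ‖x‖; linarith) hx
  refine ⟨e, ρ, hρ, hlev, fun x hx => ?_, ?_⟩
  · rcases le_total T ‖x‖ with h | h
    · have := hout x h
      have := sq_nonneg T
      linarith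
    · have h1 := hlev x hx
      have h2 : ‖x‖ ^ 2 ≤ T ^ 2 := by gcongr
      linarith
  · have hS0 : ∀ᵐ x : ℂ, x ∉ S :=
      compl_mem_ae_iff.2 ((Finset.finite_toSet S).measure_zero volume)
    filter_upwards [he2, hS0] with x hx hxS
    rcases (hlev x hxS).eq_or_lt with h | h
    · rw [← hΦ, ← h, sub_self, zero_mul]
    · rw [hx.2 h, mul_zero]

/-! ### Minimality and uniqueness of the equilibrium density -/

/-- Probability densities of finite energy in the field of charges `q` on `S`. -/
structure HasFiniteEnergy (q : ℝ) (S : Finset ℂ) (σ : ℂ → ℝ) : Prop where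
  nonneg : ∀ᵐ x, 0 ≤ σ x
  integrable : Integrable σ
  integral_eq_one : ∫ x, σ x = 1
  integrable_potential : Integrable fun x => extPotential q S x * σ x
  integrable_interaction : Integrable fun p : ℂ × ℂ => σ p.1 * logKernel p.1 p.2 * σ p.2

/-- The external potential grows quadratically, so its integrability against σ controls the first
moment on which the energy expansions rely. -/
theorem HasFiniteEnergy.integrable_norm_mul {q : ℝ} {S : Finset ℂ} {σ : ℂ → ℝ} (hq : 0 ≤ q)
    (h : HasFiniteEnergy q S σ) : Integrable fun x => ‖x‖ * σ x := by
  obtain ⟨R, hR⟩ := (Finset.finite_toSet S).isBounded.exists_norm_le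
  have hR' : ∀ a ∈ S, ‖a‖ ≤ |R| := fun a ha => (hR a ha).trans (le_abs_self R)
  set K := q * S.card with hK
  have hK0 : 0 ≤ K := mul_nonneg hq (Nat.cast_nonneg _)
  have hle : ∀ x : ℂ, ‖x‖ ≤ (1 + K ^ 2 + 2 * K * |R|) + 2 * extPotential q S x := fun x => by
    have h1 := le_extPotential hq le_rfl (abs_nonneg R) hR' x
    rw [← hK] at h1
    nlinarith [sq_nonneg (‖x‖ - K), sq_nonneg (‖x‖ - 1)]
  have hi : Integrable fun x => (1 + K ^ 2 + 2 * K * |R|) * σ x + 2 * (extPotential q S x * σ x) :=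
    (h.integrable.const_mul _).add (h.integrable_potential.const_mul 2)
  refine hi.mono' (continuous_norm.aestronglyMeasurable.mul h.integrable.aestronglyMeasurable) ?_
  filter_upwards [h.nonneg] with x hx
  rw [norm_mul, norm_norm, Real.norm_of_nonneg hx]
  calc ‖x‖ * σ x ≤ ((1 + K ^ 2 + 2 * K * |R|) + 2 * extPotential q S x) * σ x := by
        gcongr
        exact hle x
    _ = _ := by ring

theorem IsConstrainedDensity.hasFiniteEnergy {q Λ T : ℝ} {S : Finset ℂ} {ρ : ℂ → ℝ}
    (h : IsConstrainedDensity Λ T ρ) : HasFiniteEnergy q S ρ where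
  nonneg := Eventually.of_forall h.nonneg'
  integrable := h.integrable
  integral_eq_one := h.integral_eq_one
  integrable_potential := h.integrable_mul (locallyIntegrable_extPotential q S)
  integrable_interaction := h.integrable_energy h.integrable h.integrable_norm_mul

namespace IsEquilibrium

variable {l q Λ T e : ℝ} {S : Finset ℂ} {ρ σ : ℂ → ℝ}

theorem ae_nonneg (h : IsEquilibrium l q S Λ T e ρ) (hσ : HasFiniteEnergy q S σ) :
    ∀ᵐ x, 0 ≤ (totalPotential l q S ρ x - e) * σ x := by
  have hS0 : ∀ᵐ x : ℂ, x ∉ S :=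
    compl_mem_ae_iff.2 ((Finset.finite_toSet S).measure_zero volume)
  filter_upwards [hσ.nonneg, hS0] with x h1 h2
  exact mul_nonneg (sub_nonneg.2 (h.level_le x h2)) h1

theorem integrable_difference (hq : 0 ≤ q) (h : IsEquilibrium l q S Λ T e ρ)
    (hσ : HasFiniteEnergy q S σ) :
    Integrable (fun x => σ x - ρ x) ∧ Integrable (fun x => ‖x‖ * (σ x - ρ x)) ∧
    ∫ x, (σ x - ρ x) = 0 ∧
    Integrable fun p : ℂ × ℂ => (σ p.1 - ρ p.1) * logKernel p.1 p.2 * (σ p.2 - ρ p.2) := by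
  have h1 := hσ.integrable_norm_mul hq
  refine ⟨hσ.integrable.sub h.integrable, ?_, ?_, ?_⟩
  · simp_rw [mul_sub]
    exact h1.sub h.integrable_norm_mul
  · rw [integral_sub hσ.integrable h.integrable, hσ.integral_eq_one, h.integral_eq_one, sub_self]
  · have := (h.logEnergy_sub hσ.integrable h1 hσ.integrable_interaction 1).1
    simpa only [one_mul] using this

/-- The energy of a density of finite energy, expanded around the equilibrium density. -/
theorem chargeEnergy_eq (hq : 0 ≤ q) (h : IsEquilibrium l q S Λ T e ρ)
    (hσ : HasFiniteEnergy q S σ) :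
    (Integrable fun x => (totalPotential l q S ρ x - e) * σ x) ∧
    chargeEnergy l (extPotential q S) σ = chargeEnergy l (extPotential q S) ρ +
      (∫ x, (totalPotential l q S ρ x - e) * σ x) +
      l * logEnergy (fun x => σ x - ρ x) (fun x => σ x - ρ x) := by
  have key : ∀ τ : ℂ → ℝ, HasFiniteEnergy q S τ →
      (Integrable fun x => (totalPotential l q S ρ x - e) * τ x) ∧
      ∫ x, (totalPotential l q S ρ x - e) * τ x =
        (∫ x, extPotential q S x * τ x) + 2 * l * logEnergy τ ρ - e := by
    intro τ hτ
    have h1 := hτ.integrable_norm_mul hq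
    have i2 : Integrable fun x => τ x * logPotential ρ x := by
      have := h.integrable_energy hτ.integrable h1
      rw [Measure.volume_eq_prod] at this
      refine this.integral_prod_left.congr (Eventually.of_forall fun x => ?_)
      simp only [mul_assoc]
      rw [integral_const_mul, logPotential]
    have i3 := (hτ.integrable_potential.add (i2.const_mul (2 * l))).sub (hτ.integrable.const_mul e)
    have e0 : (fun x => (totalPotential l q S ρ x - e) * τ x) = fun x =>
        extPotential q S x * τ x + 2 * l * (τ x * logPotential ρ x) - e * τ x := by
      funext x
      simp only [totalPotential]
      ring
    refine ⟨e0 ▸ i3, ?_⟩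
    have e1 := integral_add hτ.integrable_potential (i2.const_mul (2 * l))
    have e2 := integral_sub (hτ.integrable_potential.add (i2.const_mul (2 * l)))
      (hτ.integrable.const_mul e)
    simp only [Pi.add_apply] at e2
    have e3 : logEnergy τ ρ = ∫ x, τ x * logPotential ρ x := h.logEnergy_eq hτ.integrable h1
    rw [e0, e2, e1, integral_const_mul, integral_const_mul, hτ.integral_eq_one, e3]
    ring
  obtain ⟨i1, k1⟩ := key σ hσ
  obtain ⟨-, k2⟩ := key ρ h.hasFiniteEnergy
  -- Because Φ = e on the support of ρ, the linear term of the expansion is exactly the integral of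
  -- Φ − e against σ.
  have k3 : ∫ x, (totalPotential l q S ρ x - e) * ρ x = 0 :=
    integral_eq_zero_of_ae h.support
  have k4 := (h.logEnergy_sub hσ.integrable (hσ.integrable_norm_mul hq)
    hσ.integrable_interaction 1).2
  simp only [one_mul, mul_one, one_pow] at k4
  refine ⟨i1, ?_⟩
  unfold chargeEnergy
  rw [k4, k1]
  rw [k3] at k2
  linarith

theorem logEnergy_difference_nonneg (hq : 0 ≤ q) (h : IsEquilibrium l q S Λ T e ρ)
    (hσ : HasFiniteEnergy q S σ) :
    0 ≤ logEnergy (fun x => σ x - ρ x) (fun x => σ x - ρ x) := by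
  obtain ⟨h1, -, h3, h4⟩ := h.integrable_difference hq hσ
  exact logEnergy_self_nonneg h1 h3 h4

/-- Both excess terms are nonnegative: one since Φ ≥ e almost everywhere, the other since σ − ρ is
neutral. Thus the bounds imposed in the construction are not felt. -/
theorem chargeEnergy_le (hl : 0 ≤ l) (hq : 0 ≤ q) (h : IsEquilibrium l q S Λ T e ρ)
    (hσ : HasFiniteEnergy q S σ) :
    chargeEnergy l (extPotential q S) ρ ≤ chargeEnergy l (extPotential q S) σ := by
  rw [(h.chargeEnergy_eq hq hσ).2]
  have h1 := integral_nonneg_of_ae (h.ae_nonneg hσ)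
  have h2 := mul_nonneg hl (h.logEnergy_difference_nonneg hq hσ)
  linarith

/-- Equality of energies forces σ − ρ to have zero logarithmic energy; by the duality inequality it
then annihilates every test function. -/
theorem ae_eq_of_chargeEnergy_le (hl : 0 < l) (hq : 0 ≤ q) (h : IsEquilibrium l q S Λ T e ρ)
    (hσ : HasFiniteEnergy q S σ)
    (hle : chargeEnergy l (extPotential q S) σ ≤ chargeEnergy l (extPotential q S) ρ) :
    σ =ᵐ[volume] ρ := by
  rw [(h.chargeEnergy_eq hq hσ).2] at hle
  have h1 := integral_nonneg_of_ae (h.ae_nonneg hσ)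
  have h2 := h.logEnergy_difference_nonneg hq hσ
  have h3 : logEnergy (fun x => σ x - ρ x) (fun x => σ x - ρ x) = 0 := by
    have : l * logEnergy (fun x => σ x - ρ x) (fun x => σ x - ρ x) ≤ 0 := by linarith
    exact le_antisymm (nonpos_of_mul_nonpos_right this hl) h2
  obtain ⟨k1, k2, k3, k4⟩ := h.integrable_difference hq hσ
  refine ae_eq_of_integral_contDiff_smul_eq hσ.integrable.locallyIntegrable
    h.integrable.locallyIntegrable fun g hg hs => ?_
  have h4 := sq_integral_mul_le k1 k2 k3 k4 (by exact_mod_cast contDiff_infty.1 hg 2) hs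
  rw [h3, zero_mul] at h4
  have h5 : ∫ x, (σ x - ρ x) * g x = 0 := by
    have := sq_nonneg (∫ x, (σ x - ρ x) * g x)
    exact pow_eq_zero_iff two_ne_zero |>.1 (le_antisymm h4 this)
  obtain ⟨B, hB⟩ := hg.continuous.bounded_above_of_compact_support hs
  have i1 : Integrable fun x => g x • σ x :=
    hσ.integrable.bdd_mul (c := B) hg.continuous.aestronglyMeasurable (Eventually.of_forall hB)
  have i2 : Integrable fun x => g x • ρ x :=
    h.integrable.bdd_mul (c := B) hg.continuous.aestronglyMeasurable (Eventually.of_forall hB)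
  rw [← sub_eq_zero, ← integral_sub i1 i2, ← h5]
  refine integral_congr_ae (Eventually.of_forall fun x => ?_)
  simp only [smul_eq_mul]
  ring

end IsEquilibrium

/-! ### Smeared point configurations -/

/-- The probability density of `N` point charges smeared over disks of radius `ε = N ^ (-1 / 2)`. -/
noncomputable def smear {N : ℕ} (ε : ℝ) (X : Fin N → ℂ) (x : ℂ) : ℝ :=
  Real.pi⁻¹ * ∑ i, (Metric.ball (X i) ε).indicator (fun _ => 1) x

theorem isBoundedDensity_indicator_ball (a : ℂ) (ε : ℝ) :
    IsBoundedDensity 1 (‖a‖ + ε) ((Metric.ball a ε).indicator fun _ => 1) where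
  measurable := measurable_const.indicator measurableSet_ball
  abs_le y := by by_cases hy : y ∈ Metric.ball a ε <;> simp [hy]
  eq_zero y hy := by
    refine Set.indicator_of_notMem (fun h => ?_) _
    rw [Metric.mem_ball, dist_eq_norm] at h
    have := norm_le_norm_add_norm_sub' y a
    linarith

theorem logPotential_indicator_ball (a : ℂ) (ε : ℝ) (x : ℂ) :
    logPotential ((Metric.ball a ε).indicator fun _ => 1) x =
      ∫ y in Metric.ball a ε, logKernel x y := by
  rw [← integral_indicator measurableSet_ball]
  refine integral_congr_ae (Eventually.of_forall fun y => ?_)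
  by_cases hy : y ∈ Metric.ball a ε <;> simp [hy]

/-- Newton's inequality: superharmonicity used once in each variable, also when the discs overlap.
-/
theorem setIntegral_setIntegral_logKernel_le {a b : ℂ} (hab : a ≠ b) {ε : ℝ} (hε : 0 < ε) :
    ∫ x in Metric.ball a ε, ∫ y in Metric.ball b ε, logKernel x y ≤
      (Real.pi * ε ^ 2) ^ 2 * logKernel a b := by
  have h1 : IntegrableOn (fun x => ∫ y in Metric.ball b ε, logKernel x y) (Metric.ball a ε) := by
    simp_rw [← logPotential_indicator_ball]
    exact ((isBoundedDensity_indicator_ball b ε).continuous_logPotential.continuousOn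
      |>.integrableOn_compact (isCompact_closedBall a ε)).mono_set Metric.ball_subset_closedBall
  have h2 : IntegrableOn (fun x => Real.pi * ε ^ 2 * logKernel x b) (Metric.ball a ε) := by
    refine Integrable.const_mul ?_ _
    simp_rw [logKernel_comm _ b]
    exact integrableOn_logKernel_ball b a ε
  have h3 : ∀ᵐ x : ℂ, x ≠ b := compl_mem_ae_iff.2 (measure_singleton (μ := volume) b)
  have h4 : ∫ x in Metric.ball a ε, ∫ y in Metric.ball b ε, logKernel x y ≤
      ∫ x in Metric.ball a ε, Real.pi * ε ^ 2 * logKernel x b := by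
    refine setIntegral_mono_ae h1 h2 ?_
    filter_upwards [h3] with x hx
    have := setIntegral_logKernel_ball_le_center hx.symm hε
    rw [logKernel_comm b x] at this
    refine le_trans (le_of_eq ?_) this
    exact integral_congr_ae (Eventually.of_forall fun y => logKernel_comm x y)
  refine h4.trans ?_
  rw [integral_const_mul, pow_two (Real.pi * ε ^ 2), mul_assoc (Real.pi * ε ^ 2)]
  exact mul_le_mul_of_nonneg_left (setIntegral_logKernel_ball_le_center hab hε) (by positivity)

/-- The self-energy of a smeared charge. At ε = N^(−1/2) the term log(1/ε) is the origin of the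
logarithm in the rate. -/
theorem setIntegral_setIntegral_logKernel_self_le (a : ℂ) {ε : ℝ} (hε : 0 < ε) :
    ∫ x in Metric.ball a ε, ∫ y in Metric.ball a ε, logKernel x y ≤
      (Real.pi * ε ^ 2) ^ 2 * (Real.log (1 / ε) + nearMass / Real.pi) := by
  have h1 : IntegrableOn (fun x => ∫ y in Metric.ball a ε, logKernel x y) (Metric.ball a ε) := by
    simp_rw [← logPotential_indicator_ball]
    exact ((isBoundedDensity_indicator_ball a ε).continuous_logPotential.continuousOn
      |>.integrableOn_compact (isCompact_closedBall a ε)).mono_set Metric.ball_subset_closedBall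
  have hf : volume (Metric.ball a ε) ≠ ⊤ := measure_ball_lt_top.ne
  have h4 := setIntegral_mono h1 (integrableOn_const hf)
    (fun x => setIntegral_logKernel_ball_le x a hε)
  refine h4.trans_eq ?_
  rw [setIntegral_const, volume_real_ball a hε.le, smul_eq_mul]
  ring

section Smear

variable {N : ℕ} {ε : ℝ} {X : Fin N → ℂ}

theorem integral_mul_smear {g : ℂ → ℝ} (hg : LocallyIntegrable g) (X : Fin N → ℂ) (ε : ℝ) :
    ∫ x, g x * smear ε X x = Real.pi⁻¹ * ∑ i, ∫ x in Metric.ball (X i) ε, g x := by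
  have h : ∀ i, Integrable fun x => g x * (Metric.ball (X i) ε).indicator (fun _ => 1) x :=
    fun i => (isBoundedDensity_indicator_ball (X i) ε).integrable_mul hg
  calc ∫ x, g x * smear ε X x = ∫ x, Real.pi⁻¹ *
        ∑ i, g x * (Metric.ball (X i) ε).indicator (fun _ => 1) x := by
        refine integral_congr_ae (Eventually.of_forall fun x => ?_)
        simp only [smear]
        rw [← Finset.mul_sum]
        ring
    _ = _ := by
        rw [integral_const_mul, integral_finsetSum _ fun i _ => h i]
        congr 1
        refine Finset.sum_congr rfl fun i _ => ?_
        rw [← integral_indicator measurableSet_ball]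
        refine integral_congr_ae (Eventually.of_forall fun x => ?_)
        by_cases hx : x ∈ Metric.ball (X i) ε <;> simp [hx]

/-- The bounds depend on N and X, but they only certify finite energy; no estimate uses their size.
-/
theorem isConstrainedDensity_smear (hε : 0 < ε) (hN : N * ε ^ 2 = 1) (X : Fin N → ℂ) :
    IsConstrainedDensity (Real.pi⁻¹ * N) (∑ i, ‖X i‖ + ε) (smear ε X) where
  measurable := Measurable.const_mul (Finset.measurable_fun_sum _ fun i _ =>
    measurable_const.indicator measurableSet_ball) _
  abs_le y := by
    rw [smear, abs_mul, abs_of_pos (by positivity)]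
    refine mul_le_mul_of_nonneg_left ((Finset.abs_sum_le_sum_abs _ _).trans ?_) (by positivity)
    refine (Finset.sum_le_sum fun i _ =>
      (isBoundedDensity_indicator_ball (X i) ε).abs_le y).trans_eq (by simp)
  eq_zero y hy := by
    rw [smear, Finset.sum_eq_zero, mul_zero]
    intro i _
    refine (isBoundedDensity_indicator_ball (X i) ε).eq_zero y (lt_of_le_of_lt ?_ hy)
    gcongr
    exact Finset.single_le_sum (f := fun i => ‖X i‖) (fun i _ => norm_nonneg _) (Finset.mem_univ i)
  nonneg' y := mul_nonneg (by positivity) (Finset.sum_nonneg fun i _ =>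
    Set.indicator_nonneg (fun _ _ => zero_le_one) _)
  integral_eq_one := by
    have h := integral_mul_smear (g := fun _ => 1) (locallyIntegrable_const 1) X ε
    simp only [one_mul] at h
    rw [h]
    simp only [setIntegral_const, volume_real_ball _ hε.le, smul_eq_mul, mul_one,
      Finset.sum_const, Finset.card_univ, Fintype.card_fin, nsmul_eq_mul]
    field_simp
    linarith

theorem logPotential_smear (X : Fin N → ℂ) (ε : ℝ) (x : ℂ) :
    logPotential (smear ε X) x = Real.pi⁻¹ * ∑ i, ∫ y in Metric.ball (X i) ε, logKernel x y := by
  unfold logPotential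
  refine integral_mul_smear ?_ X ε
  have : logKernel x = fun y => logKernel y x := funext (logKernel_comm x)
  rw [this]
  exact locallyIntegrable_logKernel x

/-- Smearing does not raise the off-diagonal terms, and each of the N diagonal terms, which count as
0 in the double sum, is replaced by a self-energy. Here ε⁴ = N⁻². -/
theorem logEnergy_smear_le (hε : 0 < ε) (hN : N * ε ^ 2 = 1) (hX : Function.Injective X) :
    logEnergy (smear ε X) (smear ε X) ≤ ε ^ 4 * (∑ i, ∑ j, logKernel (X i) (X j) +
      N * (Real.log (1 / ε) + nearMass / Real.pi)) := by
  have h := isConstrainedDensity_smear hε hN X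
  have h1 : logEnergy (smear ε X) (smear ε X) =
      ∫ x, logPotential (smear ε X) x * smear ε X x := by
    rw [h.logEnergy_eq h.integrable h.integrable_norm_mul]
    refine integral_congr_ae (Eventually.of_forall fun x => ?_)
    simp only [logPotential]
    ring
  rw [h1, integral_mul_smear h.continuous_logPotential.locallyIntegrable]
  simp_rw [logPotential_smear]
  have h2 : ∀ i j, IntegrableOn (fun x => ∫ y in Metric.ball (X j) ε, logKernel x y)
      (Metric.ball (X i) ε) := fun i j => by
    simp_rw [← logPotential_indicator_ball]
    exact ((isBoundedDensity_indicator_ball (X j) ε).continuous_logPotential.continuousOn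
      |>.integrableOn_compact (isCompact_closedBall (X i) ε)).mono_set Metric.ball_subset_closedBall
  set s := Real.log (1 / ε) + nearMass / Real.pi with hs
  have h3 : ∀ i j, ∫ x in Metric.ball (X i) ε, ∫ y in Metric.ball (X j) ε, logKernel x y ≤
      (Real.pi * ε ^ 2) ^ 2 * (logKernel (X i) (X j) + if i = j then s else 0) := by
    intro i j
    by_cases hij : i = j
    · subst hij
      have h0 : logKernel (X i) (X i) = 0 := by simp [logKernel]
      simp only [h0, if_true, zero_add]
      exact setIntegral_setIntegral_logKernel_self_le (X i) hε
    · simp only [hij, if_false, add_zero]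
      exact setIntegral_setIntegral_logKernel_le (hX.ne hij) hε
  calc Real.pi⁻¹ * ∑ i, ∫ x in Metric.ball (X i) ε,
        Real.pi⁻¹ * ∑ j, ∫ y in Metric.ball (X j) ε, logKernel x y
      = Real.pi⁻¹ ^ 2 * ∑ i, ∑ j, ∫ x in Metric.ball (X i) ε,
          ∫ y in Metric.ball (X j) ε, logKernel x y := by
        rw [pow_two, mul_assoc]
        congr 1
        rw [Finset.mul_sum]
        refine Finset.sum_congr rfl fun i _ => ?_
        rw [integral_const_mul, integral_finsetSum _ fun j _ => h2 i j]
    _ ≤ Real.pi⁻¹ ^ 2 * ∑ i, ∑ j,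
          (Real.pi * ε ^ 2) ^ 2 * (logKernel (X i) (X j) + if i = j then s else 0) := by
        gcongr with i _ j _
        exact h3 i j
    _ = _ := by
        simp_rw [← Finset.mul_sum, Finset.sum_add_distrib]
        simp
        field_simp

/-- Averaging lowers the potentials of the charges and raises the background |x|² by at most ε². -/
theorem integral_extPotential_smear_le {q : ℝ} {S : Finset ℂ} (hq : 0 ≤ q) (hε : 0 < ε)
    (hXS : ∀ i, X i ∉ S) :
    ∫ x, extPotential q S x * smear ε X x ≤
      ε ^ 2 * ∑ i, (extPotential q S (X i) + ε ^ 2) := by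
  rw [integral_mul_smear (locallyIntegrable_extPotential q S)]
  have h1 : ∀ i, ∫ x in Metric.ball (X i) ε, extPotential q S x ≤
      Real.pi * ε ^ 2 * (extPotential q S (X i) + ε ^ 2) := by
    intro i
    have i1 : ∀ a : ℂ, IntegrableOn (fun x => logKernel x a) (Metric.ball (X i) ε) := fun a => by
      simp_rw [logKernel_comm _ a]
      exact integrableOn_logKernel_ball a (X i) ε
    have i2 : IntegrableOn (fun x : ℂ => ‖x‖ ^ 2) (Metric.ball (X i) ε) :=
      ((by fun_prop : Continuous fun x : ℂ => ‖x‖ ^ 2).continuousOn.integrableOn_compact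
        (isCompact_closedBall (X i) ε)).mono_set Metric.ball_subset_closedBall
    simp only [extPotential]
    rw [integral_add (integrable_finsetSum S fun a _ => (i1 a).const_mul q) i2,
      integral_finsetSum S fun a _ => (i1 a).const_mul q]
    simp_rw [integral_const_mul]
    have h2 := (setIntegral_norm_sq_ball (X i) hε).2
    have h3 : ∑ a ∈ S, q * ∫ x in Metric.ball (X i) ε, logKernel x a ≤
        ∑ a ∈ S, q * (Real.pi * ε ^ 2 * logKernel (X i) a) := by
      refine Finset.sum_le_sum fun a ha => mul_le_mul_of_nonneg_left ?_ hq
      exact setIntegral_logKernel_ball_le_center (fun h => hXS i (by rwa [h])) hε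
    have h4 : ∑ a ∈ S, q * (Real.pi * ε ^ 2 * logKernel (X i) a) =
        Real.pi * ε ^ 2 * ∑ a ∈ S, q * logKernel (X i) a := by
      rw [Finset.mul_sum]
      exact Finset.sum_congr rfl fun a _ => by ring
    rw [h4] at h3
    linarith
  calc Real.pi⁻¹ * ∑ i, ∫ x in Metric.ball (X i) ε, extPotential q S x
      ≤ Real.pi⁻¹ * ∑ i, Real.pi * ε ^ 2 * (extPotential q S (X i) + ε ^ 2) := by
        gcongr with i _
        exact h1 i
    _ = _ := by
        rw [← Finset.mul_sum]
        field_simp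

/-- The energy of a configuration of `N` particles, in units of the temperature. The diagonal
terms of the double sum vanish. -/
noncomputable def gibbsEnergy (l q : ℝ) (S : Finset ℂ) {N : ℕ} (X : Fin N → ℂ) : ℝ :=
  N * ∑ i, extPotential q S (X i) + l * ∑ i, ∑ j, logKernel (X i) (X j)

theorem chargeEnergy_smear_le {l q : ℝ} {S : Finset ℂ} (hl : 0 ≤ l) (hq : 0 ≤ q) (hε : 0 < ε)
    (hN : N * ε ^ 2 = 1) (hX : Function.Injective X) (hXS : ∀ i, X i ∉ S) :
    (N : ℝ) ^ 2 * chargeEnergy l (extPotential q S) (smear ε X) ≤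
      gibbsEnergy l q S X + N + l * N * (Real.log (1 / ε) + nearMass / Real.pi) := by
  have h1 := mul_le_mul_of_nonneg_left (integral_extPotential_smear_le hq hε hXS)
    (sq_nonneg (N : ℝ))
  have h2 := mul_le_mul_of_nonneg_left (logEnergy_smear_le hε hN hX)
    (mul_nonneg hl (sq_nonneg (N : ℝ)))
  have h3 : (N : ℝ) ^ 2 * (ε ^ 2 * ∑ i, (extPotential q S (X i) + ε ^ 2)) =
      N * ∑ i, extPotential q S (X i) + N := by
    rw [Finset.sum_add_distrib]
    simp only [Finset.sum_const, Finset.card_univ, Fintype.card_fin, nsmul_eq_mul, hN]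
    linear_combination (N * (∑ i, extPotential q S (X i) + 1)) * hN
  have h4 : ∀ t : ℝ, l * (N : ℝ) ^ 2 * (ε ^ 4 * t) = l * t := fun t => by
    linear_combination l * t * (N * ε ^ 2 + 1) * hN
  rw [h3] at h1
  rw [h4] at h2
  unfold chargeEnergy gibbsEnergy
  linarith

/-- The right side is N times a sum of disc averages of Φ − e ≥ 0. Weakening the factor N to 1 is
affordable; what remains gives the weight a Gaussian tail in each variable, which makes it
integrable. -/
theorem IsEquilibrium.le_integral_smear {l q Λ T e : ℝ} {S : Finset ℂ} {ρ : ℂ → ℝ}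
    (h : IsEquilibrium l q S Λ T e ρ) (hε : 0 < ε) (hN : N * ε ^ 2 = 1) (hN1 : 1 ≤ N) :
    ∑ i, (‖X i‖ ^ 2 / 2 - T ^ 2 / 2) ≤
      (N : ℝ) ^ 2 * ∫ x, (totalPotential l q S ρ x - e) * smear ε X x := by
  have hc := h.continuous_logPotential
  have hli : LocallyIntegrable fun x => totalPotential l q S ρ x - e :=
    ((locallyIntegrable_extPotential q S).add
      (hc.locallyIntegrable.smul (2 * l))).sub (locallyIntegrable_const e)
  rw [integral_mul_smear hli]
  have hN1' : (1 : ℝ) ≤ N := by exact_mod_cast hN1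
  have hS0 : ∀ᵐ x : ℂ, x ∉ S :=
    compl_mem_ae_iff.2 ((Finset.finite_toSet S).measure_zero volume)
  have h1 : ∀ i, Real.pi * ε ^ 2 * (‖X i‖ ^ 2 / 2 - T ^ 2 / 2) ≤
      N * ∫ x in Metric.ball (X i) ε, (totalPotential l q S ρ x - e) := by
    intro i
    have i0 : IntegrableOn (fun x => totalPotential l q S ρ x - e) (Metric.ball (X i) ε) :=
      (hli.integrableOn_isCompact (isCompact_closedBall (X i) ε)).mono_set
        Metric.ball_subset_closedBall
    have h2 : 0 ≤ ∫ x in Metric.ball (X i) ε, (totalPotential l q S ρ x - e) := by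
      refine setIntegral_nonneg_of_ae ?_
      filter_upwards [hS0] with x hx
      exact sub_nonneg.2 (h.level_le x hx)
    have i2 : IntegrableOn (fun x : ℂ => ‖x‖ ^ 2) (Metric.ball (X i) ε) :=
      ((by fun_prop : Continuous fun x : ℂ => ‖x‖ ^ 2).continuousOn.integrableOn_compact
        (isCompact_closedBall (X i) ε)).mono_set Metric.ball_subset_closedBall
    have i3 : IntegrableOn (fun _ : ℂ => T ^ 2 / 2) (Metric.ball (X i) ε) :=
      integrableOn_const measure_ball_lt_top.ne
    have h3 : ∫ x in Metric.ball (X i) ε, (‖x‖ ^ 2 / 2 - T ^ 2 / 2) ≤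
        ∫ x in Metric.ball (X i) ε, (totalPotential l q S ρ x - e) := by
      refine setIntegral_mono_ae ((i2.div_const 2).sub i3) i0 ?_
      filter_upwards [hS0] with x hx
      have := h.growth x hx
      linarith
    rw [integral_sub (i2.div_const 2) i3, integral_div, setIntegral_const,
      volume_real_ball _ hε.le, smul_eq_mul] at h3
    have h4 := (setIntegral_norm_sq_ball (X i) hε).1
    have h5 := le_mul_of_one_le_left h2 hN1'
    linarith
  have h6 := Finset.sum_le_sum fun i (_ : i ∈ Finset.univ) => h1 i
  rw [← Finset.mul_sum, ← Finset.mul_sum] at h6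
  have h7 := mul_le_mul_of_nonneg_left h6 (by positivity : 0 ≤ (N : ℝ) * Real.pi⁻¹)
  calc _ = N * Real.pi⁻¹ * (Real.pi * ε ^ 2 * ∑ i, (‖X i‖ ^ 2 / 2 - T ^ 2 / 2)) := by
        field_simp
        linear_combination (-∑ i, (‖X i‖ ^ 2 - T ^ 2) / 2) * hN
    _ ≤ _ := h7
    _ = _ := by ring

/-- Lower bound for the energy of a configuration. -/
theorem IsEquilibrium.le_gibbsEnergy {l q Λ T e : ℝ} {S : Finset ℂ} {ρ : ℂ → ℝ}
    (h : IsEquilibrium l q S Λ T e ρ) (hl : 0 ≤ l) (hq : 0 ≤ q) (hε : 0 < ε)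
    (hN : N * ε ^ 2 = 1) (hN1 : 1 ≤ N) (hX : Function.Injective X) (hXS : ∀ i, X i ∉ S) :
    (N : ℝ) ^ 2 * chargeEnergy l (extPotential q S) ρ + ∑ i, (‖X i‖ ^ 2 / 2 - T ^ 2 / 2) +
      l * N ^ 2 * logEnergy (fun x => smear ε X x - ρ x) (fun x => smear ε X x - ρ x) ≤
      gibbsEnergy l q S X + N + l * N * (Real.log (1 / ε) + nearMass / Real.pi) := by
  refine le_trans ?_ (chargeEnergy_smear_le hl hq hε hN hX hXS)
  rw [(h.chargeEnergy_eq hq (isConstrainedDensity_smear hε hN X).hasFiniteEnergy).2]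
  have := h.le_integral_smear (X := X) hε hN hN1
  linarith

theorem abs_integral_mul_smear_sub_le {χ : ℂ → ℝ} (hχ : Continuous χ) {B : ℝ}
    (hB : ∀ x y, |χ x - χ y| ≤ B * ‖x - y‖) (hε : 0 < ε) (hN : N * ε ^ 2 = 1) (hB0 : 0 ≤ B) :
    |(∫ x, χ x * smear ε X x) - (N : ℝ)⁻¹ * ∑ i, χ (X i)| ≤ B * ε := by
  have hN0 : (N : ℝ) ≠ 0 := fun h0 => by simp [h0] at hN
  rw [integral_mul_smear hχ.locallyIntegrable]
  have h1 : ∀ i, |(∫ x in Metric.ball (X i) ε, χ x) - Real.pi * ε ^ 2 * χ (X i)| ≤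
      B * ε * (Real.pi * ε ^ 2) := by
    intro i
    have i1 : IntegrableOn χ (Metric.ball (X i) ε) :=
      (hχ.continuousOn.integrableOn_compact (isCompact_closedBall (X i) ε)).mono_set
        Metric.ball_subset_closedBall
    have i2 : IntegrableOn (fun _ : ℂ => χ (X i)) (Metric.ball (X i) ε) :=
      integrableOn_const measure_ball_lt_top.ne
    have h2 := norm_setIntegral_le_of_norm_le_const (μ := volume) (s := Metric.ball (X i) ε)
      (f := fun x => χ x - χ (X i)) (C := B * ε) measure_ball_lt_top (fun x hx => by
        rw [Real.norm_eq_abs]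
        refine (hB _ _).trans (mul_le_mul_of_nonneg_left ?_ hB0)
        rw [Metric.mem_ball, dist_eq_norm] at hx
        exact hx.le)
    rwa [integral_sub i1 i2, setIntegral_const, volume_real_ball _ hε.le, smul_eq_mul,
      Real.norm_eq_abs] at h2
  have h3 : Real.pi⁻¹ * (∑ i, ∫ x in Metric.ball (X i) ε, χ x) - (N : ℝ)⁻¹ * ∑ i, χ (X i) =
      Real.pi⁻¹ * ∑ i, ((∫ x in Metric.ball (X i) ε, χ x) - Real.pi * ε ^ 2 * χ (X i)) := by
    have h4 : (N : ℝ)⁻¹ = ε ^ 2 := by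
      field_simp
      linarith
    rw [Finset.sum_sub_distrib, ← Finset.mul_sum, h4]
    field_simp
  rw [h3, abs_mul, abs_of_pos (by positivity)]
  calc Real.pi⁻¹ * |∑ i, ((∫ x in Metric.ball (X i) ε, χ x) - Real.pi * ε ^ 2 * χ (X i))|
      ≤ Real.pi⁻¹ * ∑ i : Fin N, B * ε * (Real.pi * ε ^ 2) := by
        gcongr
        exact (Finset.abs_sum_le_sum_abs _ _).trans (Finset.sum_le_sum fun i _ => h1 i)
    _ = B * ε := by
        simp only [Finset.sum_const, Finset.card_univ, Fintype.card_fin, nsmul_eq_mul]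
        field_simp
        linear_combination B * hN

end Smear

/-! ### The Gibbs measure -/

section Product

/-- The probability measure of a constrained density. -/
noncomputable def densityMeasure (ρ : ℂ → ℝ) : Measure ℂ :=
  volume.withDensity fun x => ENNReal.ofReal (ρ x)

variable {Λ T : ℝ} {ρ : ℂ → ℝ} {N : ℕ}

theorem IsConstrainedDensity.isProbabilityMeasure (h : IsConstrainedDensity Λ T ρ) :
    IsProbabilityMeasure (densityMeasure ρ) where
  measure_univ := by
    rw [densityMeasure, withDensity_apply _ MeasurableSet.univ, Measure.restrict_univ,
      ← ofReal_integral_eq_lintegral_ofReal h.integrable (Eventually.of_forall h.nonneg'),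
      h.integral_eq_one, ENNReal.ofReal_one]

theorem IsConstrainedDensity.integrable_densityMeasure_iff (h : IsConstrainedDensity Λ T ρ)
    {g : ℂ → ℝ} : Integrable g (densityMeasure ρ) ↔ Integrable fun x => ρ x * g x := by
  rw [densityMeasure, integrable_withDensity_iff_integrable_smul' h.measurable.ennreal_ofReal
    (Eventually.of_forall fun x => ENNReal.ofReal_lt_top)]
  simp only [ENNReal.toReal_ofReal (h.nonneg' _), smul_eq_mul]

theorem IsConstrainedDensity.integral_densityMeasure (h : IsConstrainedDensity Λ T ρ)
    (g : ℂ → ℝ) : ∫ x, g x ∂densityMeasure ρ = ∫ x, ρ x * g x := by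
  rw [densityMeasure, integral_withDensity_eq_integral_toReal_smul h.measurable.ennreal_ofReal
    (Eventually.of_forall fun x => ENNReal.ofReal_lt_top)]
  simp only [ENNReal.toReal_ofReal (h.nonneg' _), smul_eq_mul]

theorem IsConstrainedDensity.densityMeasure_prod (h : IsConstrainedDensity Λ T ρ) :
    (densityMeasure ρ).prod (densityMeasure ρ) =
      volume.withDensity fun p : ℂ × ℂ => ENNReal.ofReal (ρ p.1 * ρ p.2) := by
  rw [densityMeasure, prod_withDensity h.measurable.ennreal_ofReal h.measurable.ennreal_ofReal,
    Measure.volume_eq_prod]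
  congr 1
  funext p
  rw [ENNReal.ofReal_mul (h.nonneg' _)]

theorem IsConstrainedDensity.densityMeasure_pi (h : IsConstrainedDensity Λ T ρ) (N : ℕ) :
    Measure.pi (fun _ : Fin N => densityMeasure ρ) =
      volume.withDensity fun X : Fin N → ℂ => ENNReal.ofReal (∏ i, ρ (X i)) := by
  have := h.isProbabilityMeasure
  refine Measure.pi_eq fun s hs => ?_
  have h1 : ∀ i, densityMeasure ρ (s i) = ENNReal.ofReal (∫ x, (s i).indicator ρ x) := by
    intro i
    rw [densityMeasure, withDensity_apply _ (hs i), integral_indicator (hs i),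
      ofReal_integral_eq_lintegral_ofReal h.integrable.integrableOn
        (Eventually.of_forall h.nonneg')]
  have h0 : ∀ i x, 0 ≤ (s i).indicator ρ x := fun i x =>
    Set.indicator_nonneg (fun x _ => h.nonneg' x) x
  have hind : ∀ i, Integrable ((s i).indicator ρ) := fun i => h.integrable.indicator (hs i)
  rw [withDensity_apply _ (MeasurableSet.univ_pi hs), ← lintegral_indicator (MeasurableSet.univ_pi hs)]
  simp_rw [h1]
  rw [← ENNReal.ofReal_prod_of_nonneg fun i _ => integral_nonneg (h0 i),
    ← integral_fintype_prod_volume_eq_prod (fun i => (s i).indicator ρ),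
    ofReal_integral_eq_lintegral_ofReal (μ := volume) (Integrable.fintype_prod hind)
      (Eventually.of_forall fun X => Finset.prod_nonneg fun i _ => h0 i _)]
  refine lintegral_congr fun X => ?_
  by_cases hX : X ∈ Set.pi Set.univ s
  · rw [Set.indicator_of_mem hX]
    congr 1
    exact Finset.prod_congr rfl fun i _ => (Set.indicator_of_mem (hX i trivial) _).symm
  · rw [Set.indicator_of_notMem hX]
    simp only [Set.mem_univ_pi, not_forall] at hX
    obtain ⟨i, hi⟩ := hX
    rw [Finset.prod_eq_zero (Finset.mem_univ i) (Set.indicator_of_notMem hi _), ENNReal.ofReal_zero]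

theorem IsConstrainedDensity.integrable_energy_densityMeasure (h : IsConstrainedDensity Λ T ρ)
    {i j : Fin N} (hij : i ≠ j) :
    Integrable (fun X : Fin N → ℂ => logKernel (X i) (X j))
      (Measure.pi fun _ => densityMeasure ρ) ∧
    ∫ X : Fin N → ℂ, logKernel (X i) (X j) ∂(Measure.pi fun _ => densityMeasure ρ) =
      logEnergy ρ ρ := by
  have := h.isProbabilityMeasure
  have hind := (ProbabilityTheory.iIndepFun_pi (μ := fun _ : Fin N => densityMeasure ρ)
    (X := fun _ => id) fun _ => aemeasurable_id).indepFun hij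
  simp only [id] at hind
  rw [ProbabilityTheory.indepFun_iff_map_prod_eq_prod_map_map (measurable_pi_apply i).aemeasurable
    (measurable_pi_apply j).aemeasurable] at hind
  have e1 : ∀ k : Fin N, (Measure.pi fun _ : Fin N => densityMeasure ρ).map (fun X => X k) =
      densityMeasure ρ := fun k =>
    (measurePreserving_eval (fun _ : Fin N => densityMeasure ρ) k).map_eq
  rw [e1, e1, h.densityMeasure_prod] at hind
  have hm : Measurable fun p : ℂ × ℂ => ENNReal.ofReal (ρ p.1 * ρ p.2) :=
    ((h.measurable.comp measurable_fst).mul (h.measurable.comp measurable_snd)).ennreal_ofReal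
  have hL : Measurable fun p : ℂ × ℂ => logKernel p.1 p.2 := by fun_prop
  have hφ : Measurable fun X : Fin N → ℂ => (X i, X j) := by fun_prop
  have ht : ∀ p : ℂ × ℂ, (ENNReal.ofReal (ρ p.1 * ρ p.2)).toReal • logKernel p.1 p.2 =
      ρ p.1 * logKernel p.1 p.2 * ρ p.2 := fun p => by
    rw [ENNReal.toReal_ofReal (mul_nonneg (h.nonneg' _) (h.nonneg' _)), smul_eq_mul]
    ring
  constructor
  · have i1 : Integrable (fun p : ℂ × ℂ => logKernel p.1 p.2)
        ((Measure.pi fun _ : Fin N => densityMeasure ρ).map fun X => (X i, X j)) := by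
      rw [hind, integrable_withDensity_iff_integrable_smul' hm
        (Eventually.of_forall fun x => ENNReal.ofReal_lt_top)]
      simp_rw [ht]
      exact h.integrable_energy h.integrable h.integrable_norm_mul
    exact i1.comp_measurable hφ
  · have := integral_map (μ := Measure.pi fun _ : Fin N => densityMeasure ρ) hφ.aemeasurable
      (f := fun p : ℂ × ℂ => logKernel p.1 p.2) hL.aestronglyMeasurable
    rw [← this, hind, integral_withDensity_eq_integral_toReal_smul hm
        (Eventually.of_forall fun x => ENNReal.ofReal_lt_top)]
    simp_rw [ht]
    rfl

/-- The mean energy of independent particles of density `ρ`. -/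
theorem IsConstrainedDensity.integral_gibbsEnergy (h : IsConstrainedDensity Λ T ρ) (l q : ℝ)
    (S : Finset ℂ) :
    Integrable (fun X : Fin N → ℂ => gibbsEnergy l q S X)
      (Measure.pi fun _ => densityMeasure ρ) ∧
    ∫ X : Fin N → ℂ, gibbsEnergy l q S X ∂(Measure.pi fun _ => densityMeasure ρ) =
      (N : ℝ) ^ 2 * chargeEnergy l (extPotential q S) ρ - l * N * logEnergy ρ ρ := by
  have := h.isProbabilityMeasure
  have hV : Integrable (extPotential q S) (densityMeasure ρ) := by
    rw [h.integrable_densityMeasure_iff]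
    simpa only [mul_comm] using h.integrable_mul (locallyIntegrable_extPotential q S)
  have i1 : ∀ i : Fin N, Integrable (fun X : Fin N → ℂ => extPotential q S (X i))
      (Measure.pi fun _ => densityMeasure ρ) := fun i => integrable_comp_eval hV
  have k1 : ∀ i : Fin N, ∫ X : Fin N → ℂ, extPotential q S (X i)
      ∂(Measure.pi fun _ => densityMeasure ρ) = ∫ x, extPotential q S x * ρ x := fun i => by
    rw [integral_comp_eval (μ := fun _ : Fin N => densityMeasure ρ) hV.aestronglyMeasurable,
      h.integral_densityMeasure]
    simp only [mul_comm]
  -- For i ≠ j the coordinates are independent; for i = j the kernel is 0. So N of the N²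
  -- interaction terms are missing.
  have i2 : ∀ i j : Fin N, Integrable (fun X : Fin N → ℂ => logKernel (X i) (X j))
      (Measure.pi fun _ => densityMeasure ρ) ∧
      ∫ X : Fin N → ℂ, logKernel (X i) (X j) ∂(Measure.pi fun _ => densityMeasure ρ) =
        logEnergy ρ ρ - if i = j then logEnergy ρ ρ else 0 := fun i j => by
    by_cases hij : i = j
    · subst hij
      simp [logKernel]
    · simpa [hij] using h.integrable_energy_densityMeasure hij
  have i3 := (integrable_finsetSum Finset.univ fun i _ => i1 i).const_mul (N : ℝ)
  have i4 := (integrable_finsetSum Finset.univ fun i _ =>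
    integrable_finsetSum Finset.univ fun j _ => (i2 i j).1).const_mul l
  refine ⟨i3.add i4, ?_⟩
  unfold gibbsEnergy
  rw [integral_add i3 i4, integral_const_mul, integral_const_mul,
    integral_finsetSum _ fun i _ => i1 i, integral_finsetSum _ fun i _ =>
    integrable_finsetSum Finset.univ fun j _ => (i2 i j).1]
  simp_rw [integral_finsetSum _ fun j _ => (i2 _ j).1, fun i j => (i2 i j).2, k1,
    Finset.sum_sub_distrib]
  simp [chargeEnergy]
  ring

/-- Jensen's inequality for the product measure ρ^⊗N, through the tangent line exp(−H) ≥ exp(−m)(1 +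
m − H) at the mean m. The pointwise bound by Λ^N plays the role of the entropy. -/
theorem IsConstrainedDensity.exp_le_integral_gibbs (h : IsConstrainedDensity Λ T ρ)
    {l q : ℝ} {S : Finset ℂ}
    (hi : Integrable fun X : Fin N → ℂ => Real.exp (-gibbsEnergy l q S X)) :
    Real.exp (-((N : ℝ) ^ 2 * chargeEnergy l (extPotential q S) ρ - l * N * logEnergy ρ ρ)) ≤
      Λ ^ N * ∫ X : Fin N → ℂ, Real.exp (-gibbsEnergy l q S X) := by
  have := h.isProbabilityMeasure
  obtain ⟨i1, k1⟩ := h.integral_gibbsEnergy (N := N) l q S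
  set m := (N : ℝ) ^ 2 * chargeEnergy l (extPotential q S) ρ - l * N * logEnergy ρ ρ
  have hm : Measurable fun X : Fin N → ℂ => ENNReal.ofReal (∏ i, ρ (X i)) :=
    (Finset.measurable_fun_prod _ fun i _ =>
      h.measurable.comp (measurable_pi_apply i)).ennreal_ofReal
  have h0 : ∀ X : Fin N → ℂ, 0 ≤ ∏ i, ρ (X i) := fun X =>
    Finset.prod_nonneg fun i _ => h.nonneg' _
  have hle : ∀ X : Fin N → ℂ, ∏ i, ρ (X i) ≤ Λ ^ N := fun X => by
    refine (Finset.prod_le_prod (fun i _ => h.nonneg' _) fun i _ =>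
      (le_abs_self _).trans (h.abs_le (X i))).trans_eq (by simp)
  have i2 : Integrable fun X : Fin N → ℂ => (∏ i, ρ (X i)) * Real.exp (-gibbsEnergy l q S X) := by
    refine hi.bdd_mul (c := Λ ^ N) (Finset.measurable_fun_prod _ fun i _ =>
      h.measurable.comp (measurable_pi_apply i)).aestronglyMeasurable
      (Eventually.of_forall fun X => ?_)
    rw [Real.norm_of_nonneg (h0 X)]
    exact hle X
  have i3 : Integrable (fun X : Fin N → ℂ => Real.exp (-gibbsEnergy l q S X))
      (Measure.pi fun _ => densityMeasure ρ) := by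
    rw [h.densityMeasure_pi, integrable_withDensity_iff_integrable_smul' hm
        (Eventually.of_forall fun x => ENNReal.ofReal_lt_top)]
    simpa only [ENNReal.toReal_ofReal (h0 _), smul_eq_mul] using i2
  have h1 : Real.exp (-m) ≤ ∫ X : Fin N → ℂ, Real.exp (-gibbsEnergy l q S X)
      ∂(Measure.pi fun _ => densityMeasure ρ) := by
    have i4 := (((integrable_const (1 + m)).sub i1).const_mul (Real.exp (-m)))
    have h2 := integral_mono i4 i3 fun X => by
      have h3 := Real.add_one_le_exp (m - gibbsEnergy l q S X)
      have h4 := mul_le_mul_of_nonneg_left h3 (Real.exp_pos (-m)).le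
      rw [← Real.exp_add] at h4
      simp only [Pi.sub_apply]
      convert! h4 using 2 <;> ring
    refine le_trans (le_of_eq ?_) h2
    simp only [Pi.sub_apply]
    rw [integral_const_mul, integral_sub (integrable_const _) i1, k1]
    simp
  refine h1.trans ?_
  rw [h.densityMeasure_pi, integral_withDensity_eq_integral_toReal_smul hm
    (Eventually.of_forall fun x => ENNReal.ofReal_lt_top), ← integral_const_mul]
  simp only [ENNReal.toReal_ofReal (h0 _), smul_eq_mul]
  refine integral_mono i2 (hi.const_mul _) fun X => ?_
  exact mul_le_mul_of_nonneg_right (hle X) (Real.exp_pos _).le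

end Product

theorem ae_injective (N : ℕ) : ∀ᵐ X : Fin N → ℂ, Function.Injective X := by
  have h : ∀ i j : Fin N, i ≠ j → ∀ᵐ X : Fin N → ℂ, X i ≠ X j := by
    intro i j hij
    -- Configurations with coinciding i-th and j-th points form a proper subspace, hence a null set.
    let p : Submodule ℝ (Fin N → ℂ) :=
      LinearMap.ker ((LinearMap.proj i : (Fin N → ℂ) →ₗ[ℝ] ℂ) - LinearMap.proj j)
    have hp : p ≠ ⊤ := by
      intro hp
      have : (Pi.single i 1 : Fin N → ℂ) ∈ p := hp ▸ Submodule.mem_top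
      simp [p, hij.symm] at this
    have h0 := Measure.addHaar_submodule volume p hp
    rw [ae_iff]
    convert! h0 using 2
    ext X
    simp [p, sub_eq_zero]
  have h2 : ∀ᵐ X : Fin N → ℂ, ∀ i j : Fin N, i ≠ j → X i ≠ X j := by
    simp only [ae_all_iff]
    intro i j hij
    exact h i j hij
  filter_upwards [h2] with X hX i j hij
  by_contra hne
  exact hX i j hne hij

theorem ae_forall_notMem (N : ℕ) (S : Finset ℂ) : ∀ᵐ X : Fin N → ℂ, ∀ i, X i ∉ S := by
  rw [ae_all_iff]
  intro i
  have h : ∀ a ∈ S, ∀ᵐ X : Fin N → ℂ, X i ≠ a := fun a _ =>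
    Measure.ae_eval_ne (μ := fun _ : Fin N => (volume : Measure ℂ)) i a
  have h2 : ∀ᵐ X : Fin N → ℂ, ∀ a ∈ S, X i ≠ a := (Finset.eventually_all S).2 h
  filter_upwards [h2] with X hX hi
  exact hX _ hi rfl

theorem measurable_gibbsEnergy (l q : ℝ) (S : Finset ℂ) (N : ℕ) :
    Measurable fun X : Fin N → ℂ => gibbsEnergy l q S X := by
  unfold gibbsEnergy
  refine Measurable.add (Measurable.const_mul (Finset.measurable_fun_sum _ fun i _ =>
    (measurable_extPotential q S).comp (measurable_pi_apply i)) _) ?_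
  fun_prop

/-! ### The energy estimate for test functions of class `C¹` -/

/-- Mollification at a scale below 1 given by uniform continuity of χ and its derivative. The radius
r does not depend on η, so dominated convergence applies to the gradients. -/
theorem exists_contDiff_approx {χ : ℂ → ℝ} (hχ : ContDiff ℝ 1 χ) (hs : HasCompactSupport χ) :
    ∃ r : ℝ, (∀ x, χ x ≠ 0 → ‖x‖ ≤ r) ∧ ∀ η : ℝ, 0 < η → ∃ g : ℂ → ℝ, ContDiff ℝ 2 g ∧
      HasCompactSupport g ∧ (∀ x, fderiv ℝ g x ≠ 0 → ‖x‖ ≤ r) ∧ (∀ x, |g x - χ x| ≤ η) ∧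
      ∀ x, ‖fderiv ℝ g x - fderiv ℝ χ x‖ ≤ η := by
  obtain ⟨r, hr⟩ := hs.isCompact.isBounded.exists_norm_le
  refine ⟨r + 1, fun x hx => (hr x (subset_tsupport χ hx)).trans (by linarith), fun η hη => ?_⟩
  have hdc : Continuous (fderiv ℝ χ) := hχ.continuous_fderiv one_ne_zero
  have hds : HasCompactSupport (fderiv ℝ χ) := hs.fderiv ℝ
  obtain ⟨δ₁, hδ₁, h1⟩ := Metric.uniformContinuous_iff.1
    (hs.uniformContinuous_of_continuous hχ.continuous) η hη
  obtain ⟨δ₂, hδ₂, h2⟩ := Metric.uniformContinuous_iff.1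
    (hds.uniformContinuous_of_continuous hdc) η hη
  set δ := min (min δ₁ δ₂) 1 with hδ
  have hδ0 : 0 < δ := by positivity
  let φ : ContDiffBump (0 : ℂ) := ⟨δ / 2, δ, by positivity, by linarith⟩
  have hout : φ.rOut = δ := rfl
  set g : ℂ → ℝ := convolution (φ.normed volume) χ (ContinuousLinearMap.lsmul ℝ ℝ) volume with hg
  have hsupp : ∀ x, g x ≠ 0 → ‖x‖ ≤ r + 1 := by
    intro x hx
    have hx' := support_convolution_subset (ContinuousLinearMap.lsmul ℝ ℝ)
      (f := φ.normed volume) (g := χ) (μ := volume) hx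
    obtain ⟨y, hy, z, hz, rfl⟩ := Set.mem_add.1 hx'
    rw [φ.support_normed_eq, mem_ball_zero_iff, hout] at hy
    have h3 := hr z (subset_tsupport χ hz)
    have h4 : δ ≤ 1 := min_le_right _ _
    exact (norm_add_le y z).trans (by linarith)
  have hgs : HasCompactSupport g :=
    HasCompactSupport.intro (isCompact_closedBall (0 : ℂ) (r + 1)) fun x hx => by
      by_contra hne
      exact hx (mem_closedBall_zero_iff.2 (hsupp x hne))
  have hgd : ∀ x, HasFDerivAt g (convolution (φ.normed volume) (fderiv ℝ χ)
      (ContinuousLinearMap.lsmul ℝ ℝ) volume x) x := by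
    intro x
    have := hs.hasFDerivAt_convolution_right (ContinuousLinearMap.lsmul ℝ ℝ)
      (f := φ.normed volume) (μ := volume) φ.continuous_normed.locallyIntegrable hχ x
    convert! this using 3
  refine ⟨g, ?_, hgs, fun x hx => ?_, fun x => ?_, fun x => ?_⟩
  · exact φ.hasCompactSupport_normed.contDiff_convolution_left _ φ.contDiff_normed
      hχ.continuous.locallyIntegrable
  · have h3 : x ∈ tsupport g := by
      by_contra hne
      exact hx (image_eq_zero_of_notMem_tsupport
        (fun h => hne (tsupport_fderiv_subset ℝ h)))
    have h4 : tsupport g ⊆ Metric.closedBall 0 (r + 1) :=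
      closure_minimal (fun x hx => mem_closedBall_zero_iff.2 (hsupp x hx)) Metric.isClosed_closedBall
    exact mem_closedBall_zero_iff.1 (h4 h3)
  · rw [← Real.dist_eq]
    refine φ.dist_normed_convolution_le hχ.continuous.aestronglyMeasurable fun y hy => (h1 ?_).le
    exact lt_of_lt_of_le hy ((min_le_left _ _).trans (min_le_left _ _))
  · rw [(hgd x).fderiv, ← dist_eq_norm]
    refine φ.dist_normed_convolution_le hdc.aestronglyMeasurable fun y hy => (h2 ?_).le
    exact lt_of_lt_of_le hy ((min_le_left _ _).trans (min_le_right _ _))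

theorem sq_integral_mul_le_of_contDiff_one {σ χ : ℂ → ℝ} (hσ : Integrable σ)
    (hσ1 : Integrable fun x => ‖x‖ * σ x) (h0 : ∫ x, σ x = 0)
    (hL : Integrable fun p : ℂ × ℂ => σ p.1 * logKernel p.1 p.2 * σ p.2)
    (hχ : ContDiff ℝ 1 χ) (hs : HasCompactSupport χ) :
    (∫ x, σ x * χ x) ^ 2 ≤ logEnergy σ σ * ∫ x, ‖fderiv ℝ χ x‖ ^ 2 := by
  obtain ⟨r, -, hr⟩ := exists_contDiff_approx hχ hs
  choose g hg1 hg2 hg3 hg4 hg5 using fun n : ℕ => hr (1 / ((n : ℝ) + 1)) (by positivity)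
  have hdc : Continuous (fderiv ℝ χ) := hχ.continuous_fderiv one_ne_zero
  have hds : HasCompactSupport (fderiv ℝ χ) := hs.fderiv ℝ
  obtain ⟨B, hB⟩ := hχ.continuous.bounded_above_of_compact_support hs
  obtain ⟨B', hB'⟩ := hdc.bounded_above_of_compact_support hds
  have hη : Tendsto (fun n : ℕ => 1 / ((n : ℝ) + 1)) atTop (nhds 0) :=
    tendsto_one_div_add_atTop_nhds_zero_nat
  have hη1 : ∀ n : ℕ, 1 / ((n : ℝ) + 1) ≤ 1 := fun n => by
    rw [div_le_one (by positivity)]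
    have : (0 : ℝ) ≤ n := Nat.cast_nonneg n
    linarith
  have t1 : Tendsto (fun n => ∫ x, σ x * g n x) atTop (nhds (∫ x, σ x * χ x)) := by
    refine tendsto_integral_of_dominated_convergence (fun x => (B + 1) * ‖σ x‖)
      (fun n => hσ.aestronglyMeasurable.mul (hg1 n).continuous.aestronglyMeasurable)
      (hσ.norm.const_mul _) (fun n => Eventually.of_forall fun x => ?_)
      (Eventually.of_forall fun x => ?_)
    · rw [norm_mul, mul_comm]
      refine mul_le_mul_of_nonneg_right ?_ (norm_nonneg _)
      have h1 := hg4 n x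
      rw [← Real.norm_eq_abs] at h1
      have h2 := norm_le_norm_add_norm_sub' (g n x) (χ x)
      linarith [hB x, hη1 n]
    · refine Tendsto.const_mul _ ?_
      rw [tendsto_iff_dist_tendsto_zero]
      exact squeeze_zero (fun _ => dist_nonneg) (fun n => by rw [Real.dist_eq]; exact hg4 n x) hη
  have t2 : Tendsto (fun n => ∫ x, ‖fderiv ℝ (g n) x‖ ^ 2) atTop
      (nhds (∫ x, ‖fderiv ℝ χ x‖ ^ 2)) := by
    have hi : Integrable ((Metric.closedBall (0 : ℂ) r).indicator fun _ => (B' + 1) ^ 2) :=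
      (integrable_indicator_iff Metric.isClosed_closedBall.measurableSet).2
        (integrableOn_const measure_closedBall_lt_top.ne)
    refine tendsto_integral_of_dominated_convergence _
      (fun n => ((hg1 n).continuous_fderiv two_ne_zero).norm.pow 2 |>.aestronglyMeasurable)
      hi (fun n => Eventually.of_forall fun x => ?_)
      (Eventually.of_forall fun x => ?_)
    · by_cases hx : fderiv ℝ (g n) x = 0
      · rw [hx]
        simp only [norm_zero, ne_eq, OfNat.ofNat_ne_zero, not_false_eq_true, zero_pow]
        exact Set.indicator_nonneg (fun _ _ => by positivity) _
      · rw [Set.indicator_of_mem (mem_closedBall_zero_iff.2 (hg3 n x hx)), norm_pow, norm_norm]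
        have h2 := norm_le_norm_add_norm_sub' (fderiv ℝ (g n) x) (fderiv ℝ χ x)
        have h3 := hg5 n x
        have h4 : ‖fderiv ℝ (g n) x‖ ≤ B' + 1 := by linarith [hB' x, hη1 n]
        gcongr
    · refine Tendsto.pow (Tendsto.norm ?_) 2
      rw [tendsto_iff_dist_tendsto_zero]
      exact squeeze_zero (fun _ => dist_nonneg) (fun n => by rw [dist_eq_norm]; exact hg5 n x) hη
  exact le_of_tendsto_of_tendsto' (t1.pow 2) (t2.const_mul _) fun n =>
    sq_integral_mul_le hσ hσ1 h0 hL (hg1 n) (hg2 n)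

/-! ### Fluctuations under the Gibbs measure -/

/-- The constant of the fluctuation bound. -/
noncomputable def gibbsConstant (l Λ T : ℝ) : ℝ :=
  l + l * (nearMass / Real.pi) + 2 + T ^ 2 / 2 + Real.log Λ + l * (Λ * nearMass + 2 * T) +
    Real.log (2 * Real.pi)

theorem integral_exp_neg_half_sq (N : ℕ) :
    (Integrable fun X : Fin N → ℂ => ∏ i, Real.exp (-(1 / 2) * ‖X i‖ ^ 2)) ∧
    ∫ X : Fin N → ℂ, ∏ i, Real.exp (-(1 / 2) * ‖X i‖ ^ 2) = (2 * Real.pi) ^ N := by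
  have h1 : ∫ x : ℂ, Real.exp (-(1 / 2) * ‖x‖ ^ 2) = 2 * Real.pi := by
    rw [GaussianFourier.integral_rexp_neg_mul_sq_norm (by norm_num)]
    simp [mul_comm]
  have h2 : Integrable fun x : ℂ => Real.exp (-(1 / 2) * ‖x‖ ^ 2) :=
    Integrable.of_integral_ne_zero (by rw [h1]; positivity)
  refine ⟨Integrable.fintype_prod fun _ => h2, ?_⟩
  rw [integral_fintype_prod_volume_eq_pow (fun x : ℂ => Real.exp (-(1 / 2) * ‖x‖ ^ 2)), h1,
    Fintype.card_fin]

/-- Since (y − L) exp(L − y) ≤ 1, an exponential bound on a weight p becomes a bound on y p.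
Integrated over configurations it controls the mean of y without any entropy argument. -/
theorem mul_exp_neg_le {p b L y : ℝ} (hp : 0 ≤ p) (hb : 0 ≤ b)
    (h : p ≤ Real.exp (L - y) * b) : y * p ≤ L * p + b := by
  by_cases hy : y ≤ L
  · have := mul_le_mul_of_nonneg_right hy hp
    linarith
  push Not at hy
  have h1 := mul_le_mul_of_nonneg_left h (sub_nonneg.2 hy.le)
  have h2 : (y - L) * Real.exp (L - y) ≤ 1 := by
    have h3 := Real.add_one_le_exp (y - L)
    have h4 := mul_le_mul_of_nonneg_right (show y - L ≤ Real.exp (y - L) by linarith)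
      (Real.exp_pos (L - y)).le
    rwa [← Real.exp_add, show y - L + (L - y) = 0 by ring, Real.exp_zero] at h4
  have h5 := mul_le_mul_of_nonneg_right h2 hb
  linarith

/-- Young's inequality is optimal at t = √a; t = √a + η is taken instead since √a may vanish. -/
theorem le_sqrt_of_forall_pos {x a : ℝ} (ha : 0 ≤ a)
    (h : ∀ t : ℝ, 0 < t → x ≤ t / 2 + a / (2 * t)) : x ≤ √a := by
  refine le_of_forall_pos_le_add fun η hη => ?_
  have hs := Real.sqrt_nonneg a
  have h1 := h (√a + η) (by linarith)
  have h2 : a / (2 * (√a + η)) ≤ (√a + η) / 2 := by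
    rw [div_le_div_iff₀ (by linarith) (by norm_num)]
    have := Real.sq_sqrt ha
    nlinarith
  linarith

/-- Collects all errors: the cost of smearing, the loss in the partition function, the mass of the
reference Gaussian, and 1 from `mul_exp_neg_le`. -/
theorem gibbsConstant_bound {l Λ T : ℝ} {N : ℕ} (hl : 1 ≤ l) (hΛ : 1 ≤ Λ) (hT : 0 ≤ T) (hN : 1 ≤ N) :
    N * (l * (1 / 2 * Real.log N + nearMass / Real.pi) + 1 + T ^ 2 / 2) +
      N * (Real.log Λ + l * (Λ * nearMass + 2 * T)) + N * Real.log (2 * Real.pi) + 1 ≤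
      N * (gibbsConstant l Λ T * (1 + Real.log N)) := by
  have hN' : (1 : ℝ) ≤ N := by exact_mod_cast hN
  have hlog : 0 ≤ Real.log N := Real.log_nonneg hN'
  have hJ := nearMass_pos
  have h1 : 0 ≤ Real.log Λ := Real.log_nonneg hΛ
  have h2 : 0 ≤ Real.log (2 * Real.pi) := Real.log_nonneg (by linarith [Real.pi_gt_three])
  have h3 : 0 ≤ nearMass / Real.pi := by positivity
  have h4 : 0 ≤ l * (Λ * nearMass + 2 * T) := by positivity
  have h5 : 0 ≤ l * (nearMass / Real.pi) := by positivity
  have h6 : l * (1 / 2 * Real.log N + nearMass / Real.pi) + 1 + T ^ 2 / 2 +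
      (Real.log Λ + l * (Λ * nearMass + 2 * T)) + Real.log (2 * Real.pi) + 1 ≤
      gibbsConstant l Λ T * (1 + Real.log N) := by
    unfold gibbsConstant
    have h7 : 0 ≤ (l / 2 + l * (nearMass / Real.pi) + 2 + T ^ 2 / 2 + Real.log Λ +
      l * (Λ * nearMass + 2 * T) + Real.log (2 * Real.pi)) * Real.log N := by positivity
    nlinarith
  have h8 := mul_le_mul_of_nonneg_left h6 (by linarith : (0 : ℝ) ≤ N)
  nlinarith

namespace IsEquilibrium

variable {l q Λ T e : ℝ} {S : Finset ℂ} {ρ : ℂ → ℝ} {N : ℕ}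

/-- Pointwise bound of the Gibbs weight. -/
theorem exp_neg_gibbsEnergy_le (h : IsEquilibrium l q S Λ T e ρ) (hl : 0 ≤ l) (hq : 0 ≤ q)
    (hN : 1 ≤ N) {X : Fin N → ℂ} (hX : Function.Injective X) (hXS : ∀ i, X i ∉ S) :
    Real.exp (-gibbsEnergy l q S X) ≤
      Real.exp (-((N : ℝ) ^ 2 * chargeEnergy l (extPotential q S) ρ) +
        N * (l * (1 / 2 * Real.log N + nearMass / Real.pi) + 1 + T ^ 2 / 2) -
        l * N ^ 2 * logEnergy (fun x => smear (1 / √(N : ℝ)) X x - ρ x)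
          (fun x => smear (1 / √(N : ℝ)) X x - ρ x)) *
        ∏ i, Real.exp (-(1 / 2) * ‖X i‖ ^ 2) := by
  have hN' : (0 : ℝ) < N := by exact_mod_cast hN
  have hε : (N : ℝ) * (1 / √(N : ℝ)) ^ 2 = 1 := by
    rw [div_pow, Real.sq_sqrt hN'.le]
    field_simp
  have h1 := h.le_gibbsEnergy hl hq (by positivity) hε hN hX hXS
  rw [one_div_one_div, Real.log_sqrt hN'.le, Finset.sum_sub_distrib] at h1
  simp only [Finset.sum_const, Finset.card_univ, Fintype.card_fin, nsmul_eq_mul] at h1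
  rw [← Real.exp_sum, ← Real.exp_add, ← Finset.mul_sum]
  refine Real.exp_le_exp.2 ?_
  rw [← Finset.sum_div] at h1
  linarith

theorem integrable_exp_neg_gibbsEnergy (h : IsEquilibrium l q S Λ T e ρ) (hl : 0 ≤ l)
    (hq : 0 ≤ q) (hN : 1 ≤ N) :
    Integrable fun X : Fin N → ℂ => Real.exp (-gibbsEnergy l q S X) := by
  refine ((integral_exp_neg_half_sq N).1.const_mul
    (Real.exp (-((N : ℝ) ^ 2 * chargeEnergy l (extPotential q S) ρ) +
        N * (l * (1 / 2 * Real.log N + nearMass / Real.pi) + 1 + T ^ 2 / 2)))).mono'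
    (measurable_gibbsEnergy l q S N).neg.exp.aestronglyMeasurable ?_
  filter_upwards [ae_injective N, ae_forall_notMem N S] with X hX hXS
  rw [Real.norm_of_nonneg (Real.exp_pos _).le]
  refine (h.exp_neg_gibbsEnergy_le hl hq hN hX hXS).trans ?_
  have hN' : (0 : ℝ) < N := by exact_mod_cast hN
  have hε : (N : ℝ) * (1 / √(N : ℝ)) ^ 2 = 1 := by
    rw [div_pow, Real.sq_sqrt hN'.le]
    field_simp
  have h2 := h.logEnergy_difference_nonneg hq
    (isConstrainedDensity_smear (by positivity) hε X).hasFiniteEnergy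
  have h3 := mul_nonneg (mul_nonneg hl (sq_nonneg (N : ℝ))) h2
  refine mul_le_mul_of_nonneg_right (Real.exp_le_exp.2 ?_)
    (Finset.prod_nonneg fun i _ => (Real.exp_pos _).le)
  linarith

/-- The Jensen bound with Λ^N moved to the left as exp(N log Λ) and the self-interaction estimated;
the loss is only e^(O(N)). -/
theorem exp_le_integral_exp_neg_gibbsEnergy (h : IsEquilibrium l q S Λ T e ρ) (hl : 0 ≤ l)
    (hq : 0 ≤ q) (hΛ : 1 ≤ Λ) (hN : 1 ≤ N) :
    Real.exp (-((N : ℝ) ^ 2 * chargeEnergy l (extPotential q S) ρ) -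
        N * (Real.log Λ + l * (Λ * nearMass + 2 * T))) ≤
      ∫ X : Fin N → ℂ, Real.exp (-gibbsEnergy l q S X) := by
  have h1 := h.exp_le_integral_gibbs (h.integrable_exp_neg_gibbsEnergy hl hq hN)
  have h2 := mul_le_mul_of_nonneg_left (abs_le.1 h.abs_logEnergy_le).1
    (mul_nonneg hl (Nat.cast_nonneg N))
  have hΛ0 : 0 < Λ := by linarith
  have hp : Λ ^ N = Real.exp (N * Real.log Λ) := by
    rw [Real.exp_nat_mul, Real.exp_log hΛ0]
  rw [hp, ← div_le_iff₀' (Real.exp_pos _), ← Real.exp_sub] at h1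
  refine le_trans (Real.exp_le_exp.2 ?_) h1
  linarith

/-- For each configuration, passing to the smeared density costs Bε, and duality bounds the rest by
the square root of y times the Dirichlet integral, y being the energy of smeared X − ρ. The mean of
l N² y is at most L + 1 = O(N log N). -/
theorem abs_integral_fluctuation_le (h : IsEquilibrium l q S Λ T e ρ) (hl : 1 ≤ l)
    (hq : 0 ≤ q) (hΛ : 1 ≤ Λ) (hT : 0 ≤ T) (hN : 1 ≤ N) {χ : ℂ → ℝ} (hχ : ContDiff ℝ 1 χ)
    (hs : HasCompactSupport χ) {B : ℝ} (hB : ∀ x y, |χ x - χ y| ≤ B * ‖x - y‖) (hB0 : 0 ≤ B) :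
    |∫ X : Fin N → ℂ, ((N : ℝ)⁻¹ * ∑ i, χ (X i) - ∫ x, χ x * ρ x) *
        Real.exp (-gibbsEnergy l q S X)| ≤
      (√(gibbsConstant l Λ T * (1 + Real.log N) / N * ∫ x, ‖fderiv ℝ χ x‖ ^ 2) +
        B * (1 / √(N : ℝ))) * ∫ X : Fin N → ℂ, Real.exp (-gibbsEnergy l q S X) := by
  have hl0 : 0 ≤ l := by linarith
  have hN1 : (1 : ℝ) ≤ N := by exact_mod_cast hN
  have hN' : (0 : ℝ) < N := by linarith
  have hε0 : 0 < 1 / √(N : ℝ) := by positivity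
  have hε : (N : ℝ) * (1 / √(N : ℝ)) ^ 2 = 1 := by
    rw [div_pow, Real.sq_sqrt hN'.le]
    field_simp
  obtain ⟨ε, hεd⟩ : ∃ ε, ε = 1 / √(N : ℝ) := ⟨_, rfl⟩
  rw [← hεd] at hε hε0
  have hint := h.integrable_exp_neg_gibbsEnergy hl0 hq hN
  have hZ := h.exp_le_integral_exp_neg_gibbsEnergy hl0 hq hΛ hN
  have hCb := gibbsConstant_bound hl hΛ hT hN
  obtain ⟨hgi, hge⟩ := integral_exp_neg_half_sq N
  obtain ⟨Z, hZd⟩ : ∃ Z, Z = ∫ X : Fin N → ℂ, Real.exp (-gibbsEnergy l q S X) := ⟨_, rfl⟩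
  obtain ⟨D, hD⟩ : ∃ D, D = ∫ x, ‖fderiv ℝ χ x‖ ^ 2 := ⟨_, rfl⟩
  have hD0 : 0 ≤ D := hD ▸ integral_nonneg fun x => by positivity
  obtain ⟨F, hF⟩ : ∃ F, F = (N : ℝ) ^ 2 * chargeEnergy l (extPotential q S) ρ := ⟨_, rfl⟩
  obtain ⟨K₁, hK₁⟩ : ∃ K₁, K₁ =
    N * (l * (1 / 2 * Real.log N + nearMass / Real.pi) + 1 + T ^ 2 / 2) := ⟨_, rfl⟩
  obtain ⟨K₂, hK₂⟩ : ∃ K₂, K₂ = N * (Real.log Λ + l * (Λ * nearMass + 2 * T)) := ⟨_, rfl⟩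
  obtain ⟨A, hA⟩ : ∃ A, A = gibbsConstant l Λ T * (1 + Real.log N) := ⟨_, rfl⟩
  obtain ⟨L, hL⟩ : ∃ L, L = K₁ + K₂ + N * Real.log (2 * Real.pi) := ⟨_, rfl⟩
  rw [← hK₁, ← hK₂, ← hA, ← hL] at hCb
  rw [← hF, ← hK₂, ← hZd] at hZ
  have hZ0 : 0 < Z := (Real.exp_pos _).trans_le hZ
  rw [← hZd, ← hD, ← hA, ← hεd]
  have hpi2 : Real.exp (N * Real.log (2 * Real.pi)) = (2 * Real.pi) ^ N := by
    rw [Real.exp_nat_mul, Real.exp_log (by positivity)]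
  -- the reference weight has total mass at most the partition function
  obtain ⟨b, hb⟩ : ∃ b : (Fin N → ℂ) → ℝ, b = fun X => Real.exp (-F - K₂) *
    Real.exp (-(N * Real.log (2 * Real.pi))) * ∏ i, Real.exp (-(1 / 2) * ‖X i‖ ^ 2) := ⟨_, rfl⟩
  have hbi : Integrable b := hb ▸ hgi.const_mul _
  have hb0 : ∀ X, 0 ≤ b X := fun X => by
    rw [hb]
    exact mul_nonneg (by positivity) (Finset.prod_nonneg fun i _ => (Real.exp_pos _).le)
  have hbZ : ∫ X, b X ≤ Z := by
    rw [hb, integral_const_mul, hge, ← hpi2, mul_assoc, ← Real.exp_add]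
    simpa using hZ
  have hGi : Integrable fun X : Fin N → ℂ => ((N : ℝ)⁻¹ * ∑ i, χ (X i) - ∫ x, χ x * ρ x) *
      Real.exp (-gibbsEnergy l q S X) := by
    obtain ⟨M, hM⟩ := hχ.continuous.bounded_above_of_compact_support hs
    have hc : Continuous fun X : Fin N → ℂ => (N : ℝ)⁻¹ * ∑ i, χ (X i) - ∫ x, χ x * ρ x := by
      have := hχ.continuous
      fun_prop
    refine hint.bdd_mul (c := M + |∫ x, χ x * ρ x|) hc.aestronglyMeasurable
      (Eventually.of_forall fun X => ?_)
    refine (norm_sub_le _ _).trans (add_le_add ?_ le_rfl)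
    rw [norm_mul, norm_inv, RCLike.norm_natCast, inv_mul_le_iff₀ hN']
    refine (norm_sum_le _ _).trans ((Finset.sum_le_sum fun i _ => hM (X i)).trans_eq ?_)
    simp
  suffices hmain : (∫ X : Fin N → ℂ, |((N : ℝ)⁻¹ * ∑ i, χ (X i) - ∫ x, χ x * ρ x) *
        Real.exp (-gibbsEnergy l q S X)|) / Z - B * ε ≤ √(A / N * D) by
    refine abs_integral_le_integral_abs.trans ?_
    rwa [sub_le_iff_le_add, div_le_iff₀ hZ0] at hmain
  have hA0 : 0 ≤ A / N * D := by
    have : 0 ≤ A := hA ▸ by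
      have := Real.log_nonneg hN1
      have h1 : 0 ≤ Real.log Λ := Real.log_nonneg hΛ
      have h2 : 0 ≤ Real.log (2 * Real.pi) := Real.log_nonneg (by linarith [Real.pi_gt_three])
      have hJ := nearMass_pos
      unfold gibbsConstant
      positivity
    positivity
  -- The square root is linearized with a parameter t, so that only the mean of y has to be
  -- estimated.
  refine le_sqrt_of_forall_pos hA0 fun t ht => ?_
  rw [sub_le_iff_le_add, div_le_iff₀ hZ0]
  have hpt : ∀ᵐ X : Fin N → ℂ, |((N : ℝ)⁻¹ * ∑ i, χ (X i) - ∫ x, χ x * ρ x) *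
        Real.exp (-gibbsEnergy l q S X)| ≤
      (B * ε + t / 2 + D / (2 * t * N ^ 2) * L) * Real.exp (-gibbsEnergy l q S X) +
        D / (2 * t * N ^ 2) * b X := by
    filter_upwards [ae_injective N, ae_forall_notMem N S] with X hX hXS
    have h1 := h.exp_neg_gibbsEnergy_le hl0 hq hN hX hXS
    have hsm := isConstrainedDensity_smear hε0 hε X
    have hfe := hsm.hasFiniteEnergy (q := q) (S := S)
    obtain ⟨k1, k2, k3, k4⟩ := h.integrable_difference hq hfe
    have h2 := sq_integral_mul_le_of_contDiff_one k1 k2 k3 k4 hχ hs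
    have h3 := h.logEnergy_difference_nonneg hq hfe
    have h4 := abs_integral_mul_smear_sub_le (X := X) hχ.continuous hB hε0 hε hB0
    have e1 : ∫ x, (smear ε X x - ρ x) * χ x =
        (∫ x, χ x * smear ε X x) - ∫ x, χ x * ρ x := by
      rw [← integral_sub (hsm.integrable_mul hχ.continuous.locallyIntegrable)
        (h.integrable_mul hχ.continuous.locallyIntegrable)]
      exact integral_congr_ae (Eventually.of_forall fun x => by simp only; ring)
    rw [← hεd, ← hF, ← hK₁] at h1
    rw [e1, ← hD] at h2
    obtain ⟨y, hy⟩ : ∃ y, y = logEnergy (fun x => smear ε X x - ρ x)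
      (fun x => smear ε X x - ρ x) := ⟨_, rfl⟩
    rw [← hy] at h1 h2 h3
    obtain ⟨p, hp⟩ : ∃ p, p = Real.exp (-gibbsEnergy l q S X) := ⟨_, rfl⟩
    have hp0 : 0 < p := hp ▸ Real.exp_pos _
    rw [← hp] at h1 ⊢
    -- L is what is left of the upper bound on the weight after the normalization of b has been
    -- taken out.
    have h5 : p ≤ Real.exp (L - l * N ^ 2 * y) * b X := by
      refine h1.trans_eq ?_
      rw [hb]
      simp only
      rw [← mul_assoc, ← mul_assoc, ← Real.exp_add, ← Real.exp_add, hL]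
      congr 2
      ring
    have h6 := mul_exp_neg_le hp0.le (hb0 X) h5
    obtain ⟨s, hs'⟩ : ∃ s, s = ∫ x, χ x * smear ε X x := ⟨_, rfl⟩
    obtain ⟨r, hr'⟩ : ∃ r, r = ∫ x, χ x * ρ x := ⟨_, rfl⟩
    obtain ⟨w, hw⟩ : ∃ w, w = (N : ℝ)⁻¹ * ∑ i, χ (X i) := ⟨_, rfl⟩
    rw [← hs', ← hr'] at h2
    rw [← hs', ← hw] at h4
    rw [← hw, ← hr', abs_mul, abs_of_pos hp0]
    -- w is the empirical mean of χ, s its smeared version, r the equilibrium value. Here |s − r| ≤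
    -- t/2 + (s − r)²/(2t) with (s − r)² ≤ y D, and l ≥ 1 allows the factor l to be inserted.
    have h7 : |w - r| ≤ B * ε + t / 2 + D / (2 * t * N ^ 2) * (l * N ^ 2 * y) := by
      have h8 : |w - r| ≤ |s - w| + |s - r| := by
        rw [abs_sub_comm s w]
        exact abs_sub_le w s r
      have h9 : |s - r| ≤ t / 2 + (s - r) ^ 2 / (2 * t) := by
        have h10 : 0 ≤ (|s - r| - t) ^ 2 / (2 * t) := by positivity
        have h11 : (|s - r| - t) ^ 2 / (2 * t) = (s - r) ^ 2 / (2 * t) - |s - r| + t / 2 := by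
          rw [← sq_abs (s - r)]
          field_simp
          ring
        linarith
      have h12 : (s - r) ^ 2 / (2 * t) ≤ D / (2 * t * N ^ 2) * (l * N ^ 2 * y) := by
        have e : D / (2 * t * N ^ 2) * (l * N ^ 2 * y) = l * (y * D) / (2 * t) := by
          field_simp
        rw [e]
        gcongr
        exact h2.trans (le_mul_of_one_le_left (mul_nonneg h3 hD0) hl)
      linarith
    have h13 := mul_le_mul_of_nonneg_right h7 hp0.le
    have h14 := mul_le_mul_of_nonneg_left h6 (by positivity : 0 ≤ D / (2 * t * N ^ 2))
    linarith
  have hmono := integral_mono_ae hGi.abs ((hint.const_mul _).add (hbi.const_mul _)) hpt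
  have e2 := integral_add (hint.const_mul (B * ε + t / 2 + D / (2 * t * N ^ 2) * L))
    (hbi.const_mul (D / (2 * t * N ^ 2)))
  simp only [Pi.add_apply] at hmono
  rw [e2, integral_const_mul, integral_const_mul, ← hZd] at hmono
  refine hmono.trans ?_
  have h15 : D / (2 * t * N ^ 2) * ∫ X, b X ≤ D / (2 * t * N ^ 2) * Z := by
    gcongr
  have h16 : D / (2 * t * N ^ 2) * (L + 1) ≤ A / N * D / (2 * t) := by
    have e : A / N * D / (2 * t) = D / (2 * t * N ^ 2) * (N * A) := by
      field_simp
    rw [e]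
    gcongr
  have h17 := mul_le_mul_of_nonneg_right h16 hZ0.le
  linarith

end IsEquilibrium

/-! ### The one-particle density as a Gibbs expectation -/

/-- The polynomial with simple zeros at the points `√N a` for `a ∈ S`. -/
noncomputable def rootPolynomial (N : ℕ) (S : Finset ℂ) : ℂ[X] :=
  ∏ a ∈ S, (Polynomial.X - Polynomial.C (√(N : ℝ) * a))

theorem sum_sum_logKernel_eq {N : ℕ} (X : Fin N → ℂ) :
    ∑ i, ∑ j, logKernel (X i) (X j) = 2 * ∑ i, ∑ j ∈ Finset.Ioi i, logKernel (X i) (X j) := by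
  have h := Finset.sum_sum_Ioi_add_eq_sum_sum_off_diag fun i j => logKernel (X i) (X j)
  have h1 : ∀ i, ∑ j, logKernel (X j) (X i) = ∑ j ∈ {i}ᶜ, logKernel (X j) (X i) := fun i => by
    rw [← Finset.sum_compl_add_sum {i}]
    simp [logKernel]
  rw [Finset.sum_comm]
  simp_rw [h1]
  rw [← h, Finset.mul_sum]
  refine Finset.sum_congr rfl fun i _ => ?_
  rw [Finset.mul_sum]
  refine Finset.sum_congr rfl fun j _ => ?_
  rw [logKernel_comm (X j)]
  ring

/-- The plasma analogy. Squaring gives each zero of f the charge 2, which is N · (2/N), and each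
pair the factor 2ℓ, which is ℓ for both orders in the double sum. κ gathers the powers of √N created
by the scaling. -/
theorem norm_sq_laughlinAmplitude {ℓ N : ℕ} (hN : 1 ≤ N) (S : Finset ℂ) :
    ∃ κ : ℝ, ∀ X : Fin N → ℂ, Function.Injective X → (∀ i, X i ∉ S) →
      ‖laughlinAmplitude ℓ N (rootPolynomial N S) (√(N : ℝ) • X)‖ ^ 2 =
        Real.exp κ * Real.exp (-gibbsEnergy ℓ (2 / N) S X) := by
  have hN' : (0 : ℝ) < N := by exact_mod_cast hN
  have hs : 0 < √(N : ℝ) := Real.sqrt_pos.2 hN'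
  set c := Real.log √(N : ℝ) with hc
  refine ⟨2 * (∑ _i : Fin N, ∑ _a ∈ S, c + ∑ i : Fin N, ∑ _j ∈ Finset.Ioi i, ℓ * c),
    fun X hX hXS => ?_⟩
  have hne : ∀ w : ℂ, w ≠ 0 → Real.log ‖(√(N : ℝ) : ℂ) * w‖ = c + Real.log ‖w‖ := fun w hw => by
    rw [norm_mul, Complex.norm_real, Real.norm_of_nonneg hs.le,
      Real.log_mul hs.ne' (norm_ne_zero_iff.2 hw)]
  have hsc : (√(N : ℝ) : ℂ) ≠ 0 := by exact_mod_cast hs.ne'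
  have e1 : ∀ i, (rootPolynomial N S).eval ((√(N : ℝ) • X) i) =
      ∏ a ∈ S, (√(N : ℝ) : ℂ) * (X i - a) := fun i => by
    simp only [rootPolynomial, Polynomial.eval_prod, Polynomial.eval_sub, Polynomial.eval_X,
      Polynomial.eval_C, Pi.smul_apply, Complex.real_smul, mul_sub]
  have e2 : ∀ i j, (√(N : ℝ) • X) i - (√(N : ℝ) • X) j = (√(N : ℝ) : ℂ) * (X i - X j) :=
    fun i j => by simp only [Pi.smul_apply, Complex.real_smul, mul_sub]
  have n1 : ∀ i, ∀ a ∈ S, ‖(√(N : ℝ) : ℂ) * (X i - a)‖ ≠ 0 := fun i a ha =>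
    norm_ne_zero_iff.2 (mul_ne_zero hsc (sub_ne_zero.2 fun h => hXS i (by rwa [h])))
  have n2 : ∀ i, ∀ j ∈ Finset.Ioi i, ‖(√(N : ℝ) : ℂ) * (X i - X j)‖ ≠ 0 := fun i j hj =>
    norm_ne_zero_iff.2 (mul_ne_zero hsc (sub_ne_zero.2 (hX.ne (Finset.mem_Ioi.1 hj).ne)))
  have hnorm : ‖laughlinAmplitude ℓ N (rootPolynomial N S) (√(N : ℝ) • X)‖ =
      (∏ i, ∏ a ∈ S, ‖(√(N : ℝ) : ℂ) * (X i - a)‖) *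
      (∏ i, ∏ j ∈ Finset.Ioi i, ‖(√(N : ℝ) : ℂ) * (X i - X j)‖ ^ ℓ) *
      Real.exp (-(N * ∑ i, ‖X i‖ ^ 2) / 2) := by
    unfold laughlinAmplitude
    simp_rw [e1, e2]
    rw [norm_mul, norm_mul, Complex.norm_real, Real.norm_of_nonneg (Real.exp_pos _).le]
    simp_rw [norm_prod, norm_pow]
    congr 4
    rw [Finset.mul_sum]
    refine Finset.sum_congr rfl fun i _ => ?_
    rw [Pi.smul_apply, norm_smul, mul_pow, Real.norm_of_nonneg hs.le, Real.sq_sqrt hN'.le]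
  have hp1 : (∏ i, ∏ a ∈ S, ‖(√(N : ℝ) : ℂ) * (X i - a)‖) ≠ 0 :=
    Finset.prod_ne_zero_iff.2 fun i _ => Finset.prod_ne_zero_iff.2 (n1 i)
  have hp2 : (∏ i, ∏ j ∈ Finset.Ioi i, ‖(√(N : ℝ) : ℂ) * (X i - X j)‖ ^ ℓ) ≠ 0 :=
    Finset.prod_ne_zero_iff.2 fun i _ => Finset.prod_ne_zero_iff.2 fun j hj =>
      pow_ne_zero _ (n2 i j hj)
  have hlog : Real.log ‖laughlinAmplitude ℓ N (rootPolynomial N S) (√(N : ℝ) • X)‖ =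
      ∑ i, ∑ a ∈ S, (c - logKernel (X i) a) +
      ∑ i, ∑ j ∈ Finset.Ioi i, ℓ * (c - logKernel (X i) (X j)) - (N * ∑ i, ‖X i‖ ^ 2) / 2 := by
    rw [hnorm, Real.log_mul (mul_ne_zero hp1 hp2) (Real.exp_pos _).ne', Real.log_mul hp1 hp2,
      Real.log_exp, Real.log_prod fun i _ => Finset.prod_ne_zero_iff.2 (n1 i),
      Real.log_prod fun i _ => Finset.prod_ne_zero_iff.2 fun j hj => pow_ne_zero _ (n2 i j hj)]
    have s1 : ∀ i, Real.log (∏ a ∈ S, ‖(√(N : ℝ) : ℂ) * (X i - a)‖) =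
        ∑ a ∈ S, (c - logKernel (X i) a) := fun i => by
      rw [Real.log_prod (n1 i)]
      refine Finset.sum_congr rfl fun a ha => ?_
      rw [hne _ (sub_ne_zero.2 fun h => hXS i (by rwa [h])), logKernel_eq_neg_log]
      ring
    have s2 : ∀ i, Real.log (∏ j ∈ Finset.Ioi i, ‖(√(N : ℝ) : ℂ) * (X i - X j)‖ ^ ℓ) =
        ∑ j ∈ Finset.Ioi i, ℓ * (c - logKernel (X i) (X j)) := fun i => by
      rw [Real.log_prod fun j hj => pow_ne_zero _ (n2 i j hj)]
      refine Finset.sum_congr rfl fun j hj => ?_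
      rw [Real.log_pow, hne _ (sub_ne_zero.2 (hX.ne (Finset.mem_Ioi.1 hj).ne)),
        logKernel_eq_neg_log]
      ring
    simp_rw [s1, s2]
    ring
  have hpos : 0 < ‖laughlinAmplitude ℓ N (rootPolynomial N S) (√(N : ℝ) • X)‖ := by
    rw [hnorm]
    exact (mul_ne_zero (mul_ne_zero hp1 hp2) (Real.exp_pos _).ne').symm.lt_of_le
      (hnorm ▸ norm_nonneg _)
  rw [← Real.exp_log (pow_pos hpos 2), ← Real.exp_add, Real.log_pow, hlog]
  congr 1
  unfold gibbsEnergy extPotential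
  rw [sum_sum_logKernel_eq]
  simp_rw [mul_sub, Finset.sum_sub_distrib, Finset.sum_add_distrib, ← Finset.mul_sum]
  push_cast
  field_simp
  ring

section Reduction

variable {ℓ n : ℕ} {S : Finset ℂ}

theorem integrable_norm_sq_laughlinAmplitude {N : ℕ} (hN : 1 ≤ N)
    (hi : Integrable fun X : Fin N → ℂ => Real.exp (-gibbsEnergy ℓ (2 / N) S X)) :
    Integrable fun z => ‖laughlinAmplitude ℓ N (rootPolynomial N S) z‖ ^ 2 := by
  have hs : √(N : ℝ) ≠ 0 := (Real.sqrt_pos.2 (by exact_mod_cast hN)).ne'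
  obtain ⟨κ, hκ⟩ := norm_sq_laughlinAmplitude (ℓ := ℓ) hN S
  rw [← integrable_comp_smul_iff volume _ hs]
  refine (hi.const_mul (Real.exp κ)).congr ?_
  filter_upwards [ae_injective N, ae_forall_notMem N S] with X hX hXS
  exact (hκ X hX hXS).symm

/-- Expectations in the Laughlin state are Gibbs expectations. -/
theorem integral_laughlinAmplitude_mul {N : ℕ} (hN : 1 ≤ N) :
    ∃ c : ℝ, 0 < c ∧ ∀ g : (Fin N → ℂ) → ℝ,
      ∫ z, ‖laughlinAmplitude ℓ N (rootPolynomial N S) z‖ ^ 2 * g ((√(N : ℝ))⁻¹ • z) =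
        c * ∫ X : Fin N → ℂ, Real.exp (-gibbsEnergy ℓ (2 / N) S X) * g X := by
  have hs : 0 < √(N : ℝ) := Real.sqrt_pos.2 (by exact_mod_cast hN)
  obtain ⟨κ, hκ⟩ := norm_sq_laughlinAmplitude (ℓ := ℓ) hN S
  refine ⟨√(N : ℝ) ^ Module.finrank ℝ (Fin N → ℂ) * Real.exp κ, by positivity, fun g => ?_⟩
  have h1 := Measure.integral_comp_smul (volume : Measure (Fin N → ℂ))
    (fun z => ‖laughlinAmplitude ℓ N (rootPolynomial N S) z‖ ^ 2 * g ((√(N : ℝ))⁻¹ • z)) √(N : ℝ)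
  rw [abs_of_pos (by positivity), smul_eq_mul, eq_inv_mul_iff_mul_eq₀ (by positivity)] at h1
  rw [← h1, mul_assoc, ← integral_const_mul (Real.exp κ)]
  congr 1
  refine integral_congr_ae ?_
  filter_upwards [ae_injective N, ae_forall_notMem N S] with X hX hXS
  rw [hκ X hX hXS, inv_smul_smul₀ hs.ne', mul_assoc]

theorem gibbsEnergy_comp_perm {l q : ℝ} {N : ℕ} (X : Fin N → ℂ) (σ : Equiv.Perm (Fin N)) :
    gibbsEnergy l q S (X ∘ σ) = gibbsEnergy l q S X := by
  unfold gibbsEnergy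
  simp only [Function.comp_apply]
  rw [Equiv.sum_comp σ fun i => extPotential q S (X i)]
  have h : ∀ i, ∑ j, logKernel (X (σ i)) (X (σ j)) = ∑ j, logKernel (X (σ i)) (X j) := fun i =>
    Equiv.sum_comp σ fun j => logKernel (X (σ i)) (X j)
  simp_rw [h]
  rw [Equiv.sum_comp σ fun i => ∑ j, logKernel (X i) (X j)]

/-- The weight is symmetric in the particles, so the first coordinate represents all of them. -/
theorem integral_gibbs_mul_eval {l q : ℝ} (φ : ℂ → ℝ) (i : Fin (n + 1)) :
    ∫ X : Fin (n + 1) → ℂ, Real.exp (-gibbsEnergy l q S X) * φ (X i) =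
      ∫ X : Fin (n + 1) → ℂ, Real.exp (-gibbsEnergy l q S X) * φ (X 0) := by
  have h := (volume_measurePreserving_piCongrLeft (fun _ : Fin (n + 1) => ℂ)
    (Equiv.swap 0 i)).integral_comp' fun X => Real.exp (-gibbsEnergy l q S X) * φ (X 0)
  rw [← h]
  refine integral_congr_ae (Eventually.of_forall fun X => ?_)
  have e : (MeasurableEquiv.piCongrLeft (fun _ : Fin (n + 1) => ℂ) (Equiv.swap 0 i)) X =
      X ∘ (Equiv.swap 0 i) := by
    funext j
    have := Equiv.piCongrLeft_apply_apply (fun _ : Fin (n + 1) => ℂ) (Equiv.swap 0 i) X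
      (Equiv.swap 0 i j)
    rw [Equiv.swap_apply_self] at this
    exact this
  simp only
  rw [e, gibbsEnergy_comp_perm]
  simp

theorem scaledOneParticleDensity_eq (f : ℂ[X]) (x : ℂ) :
    scaledOneParticleDensity ℓ (n + 1) f x =
      ((n + 1 : ℕ) : ℝ) / (∫ w, ‖laughlinAmplitude ℓ (n + 1) f w‖ ^ 2) *
        ∫ w : Fin n → ℂ, ‖laughlinAmplitude ℓ (n + 1) f
          (Fin.cons (√((n + 1 : ℕ) : ℝ) * x : ℂ) w : Fin (n + 1) → ℂ)‖ ^ 2 := by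
  unfold scaledOneParticleDensity oneParticleDensity laughlinState
  simp_rw [norm_mul, mul_pow, Complex.norm_real, norm_inv, Real.norm_eq_abs, inv_pow, sq_abs]
  rw [integral_const_mul, Real.sq_sqrt (integral_nonneg fun _ => by positivity)]
  ring

theorem piFinSuccAbove_symm_eq_cons (p : ℂ × (Fin n → ℂ)) :
    (MeasurableEquiv.piFinSuccAbove (fun _ : Fin (n + 1) => ℂ) 0).symm p =
      (Fin.cons p.1 p.2 : Fin (n + 1) → ℂ) := by
  simp [MeasurableEquiv.piFinSuccAbove]
  rfl

theorem integrable_comp_cons {G : (Fin (n + 1) → ℂ) → ℝ} (hG : Integrable G) :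
    Integrable (fun p : ℂ × (Fin n → ℂ) => G (Fin.cons p.1 p.2 : Fin (n + 1) → ℂ))
      (volume.prod volume) := by
  have hm := (volume_preserving_piFinSuccAbove (fun _ : Fin (n + 1) => ℂ) 0).symm
  have hi := (hm.integrable_comp_emb (MeasurableEquiv.measurableEmbedding _)).2 hG
  rw [← Measure.volume_eq_prod]
  simpa only [Function.comp_def, piFinSuccAbove_symm_eq_cons] using hi

theorem integral_cons {G : (Fin (n + 1) → ℂ) → ℝ} (hG : Integrable G) :
    (Integrable fun x : ℂ => ∫ w : Fin n → ℂ, G (Fin.cons x w : Fin (n + 1) → ℂ)) ∧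
    ∫ x : ℂ, ∫ w : Fin n → ℂ, G (Fin.cons x w : Fin (n + 1) → ℂ) = ∫ z, G z := by
  have hm := (volume_preserving_piFinSuccAbove (fun _ : Fin (n + 1) => ℂ) 0).symm
  have hi := integrable_comp_cons hG
  refine ⟨hi.integral_prod_left, ?_⟩
  rw [← hm.integral_comp' G]
  simp_rw [piFinSuccAbove_symm_eq_cons]
  exact (integral_prod _ hi).symm

/-- Scaling dx contributes N⁻¹, which cancels the N in the definition of the density, so the scaled
density has mass 1. By symmetry, testing it is taking the Gibbs mean of the empirical average. -/
theorem integral_scaledOneParticleDensity_mul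
    (hi : Integrable fun X : Fin (n + 1) → ℂ =>
      Real.exp (-gibbsEnergy ℓ (2 / (n + 1 : ℕ)) S X))
    {φ : ℂ → ℝ} (hφ : Continuous φ) {M : ℝ} (hM : ∀ x, |φ x| ≤ M) :
    (Integrable fun x => scaledOneParticleDensity ℓ (n + 1) (rootPolynomial (n + 1) S) x * φ x) ∧
    (∫ x, scaledOneParticleDensity ℓ (n + 1) (rootPolynomial (n + 1) S) x * φ x) *
      ∫ X : Fin (n + 1) → ℂ, Real.exp (-gibbsEnergy ℓ (2 / (n + 1 : ℕ)) S X) =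
      ∫ X : Fin (n + 1) → ℂ, (((n + 1 : ℕ) : ℝ)⁻¹ * ∑ i, φ (X i)) *
        Real.exp (-gibbsEnergy ℓ (2 / (n + 1 : ℕ)) S X) := by
  obtain ⟨N, hNd⟩ : ∃ N : ℝ, N = ((n + 1 : ℕ) : ℝ) := ⟨_, rfl⟩
  have hN : 0 < N := by rw [hNd]; positivity
  have hs : 0 < √N := Real.sqrt_pos.2 hN
  obtain ⟨W, hW⟩ : ∃ W : (Fin (n + 1) → ℂ) → ℝ,
    W = fun z => ‖laughlinAmplitude ℓ (n + 1) (rootPolynomial (n + 1) S) z‖ ^ 2 := ⟨_, rfl⟩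
  have hWi : Integrable W := hW ▸ integrable_norm_sq_laughlinAmplitude (by omega) hi
  have hWφ : Integrable fun z : Fin (n + 1) → ℂ => W z * φ ((√N)⁻¹ • z 0) :=
    hWi.mul_bdd (c := M) (hφ.comp (by fun_prop)).aestronglyMeasurable
      (Eventually.of_forall fun z => hM _)
  obtain ⟨c, hc, hcg⟩ := integral_laughlinAmplitude_mul (ℓ := ℓ) (S := S) (N := n + 1) (by omega)
  obtain ⟨k1, k2⟩ := integral_cons hWφ
  simp only [Fin.cons_zero] at k1 k2
  have hμ : ∀ x, scaledOneParticleDensity ℓ (n + 1) (rootPolynomial (n + 1) S) x * φ x =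
      N / (∫ w, W w) * ∫ w : Fin n → ℂ, W (Fin.cons (√N • x) w : Fin (n + 1) → ℂ) *
        φ ((√N)⁻¹ • (√N • x)) := fun x => by
    rw [scaledOneParticleDensity_eq, integral_mul_const, inv_smul_smul₀ hs.ne', hW, ← hNd,
      Complex.real_smul, mul_assoc]
  have hsc : ∫ x : ℂ, ∫ w : Fin n → ℂ, W (Fin.cons (√N • x) w : Fin (n + 1) → ℂ) *
      φ ((√N)⁻¹ • (√N • x)) = N⁻¹ * ∫ z, W z * φ ((√N)⁻¹ • z 0) := by
    have := Measure.integral_comp_smul (volume : Measure ℂ) (fun x => ∫ w : Fin n → ℂ,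
      W (Fin.cons x w : Fin (n + 1) → ℂ) * φ ((√N)⁻¹ • x)) √N
    rw [this, k2, Complex.finrank_real_complex, Real.sq_sqrt hN.le, abs_of_pos (by positivity),
      smul_eq_mul]
  simp_rw [hμ]
  refine ⟨((integrable_comp_smul_iff volume _ hs.ne').2 k1).const_mul _, ?_⟩
  rw [integral_const_mul, hsc]
  have hc1 := hcg fun _ => 1
  have hc2 := hcg fun X => φ (X 0)
  simp only [mul_one, Pi.smul_apply] at hc1 hc2
  rw [hNd] at *
  rw [hW] at *
  simp only
  rw [hc1, hc2]
  have hsum : ∫ X : Fin (n + 1) → ℂ, (((n + 1 : ℕ) : ℝ)⁻¹ * ∑ i, φ (X i)) *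
        Real.exp (-gibbsEnergy ℓ (2 / (n + 1 : ℕ)) S X) =
      ∫ X : Fin (n + 1) → ℂ, Real.exp (-gibbsEnergy ℓ (2 / (n + 1 : ℕ)) S X) * φ (X 0) := by
    have e : ∀ X : Fin (n + 1) → ℂ, (((n + 1 : ℕ) : ℝ)⁻¹ * ∑ i, φ (X i)) *
        Real.exp (-gibbsEnergy ℓ (2 / (n + 1 : ℕ)) S X) = ((n + 1 : ℕ) : ℝ)⁻¹ *
        ∑ i, Real.exp (-gibbsEnergy ℓ (2 / (n + 1 : ℕ)) S X) * φ (X i) := fun X => by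
      rw [← Finset.mul_sum]
      ring
    simp_rw [e]
    have e2 : ∀ i, Integrable fun X : Fin (n + 1) → ℂ =>
        Real.exp (-gibbsEnergy ℓ (2 / (n + 1 : ℕ)) S X) * φ (X i) := fun i =>
      hi.mul_bdd (c := M) (hφ.comp (continuous_apply i)).aestronglyMeasurable
        (Eventually.of_forall fun z => hM _)
    rw [integral_const_mul, integral_finsetSum _ fun i _ => e2 i]
    simp_rw [integral_gibbs_mul_eval]
    rw [Finset.sum_const, Finset.card_univ, Fintype.card_fin, nsmul_eq_mul, ← mul_assoc,
      inv_mul_cancel₀ hN.ne', one_mul]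
  rw [hsum]
  have hZ : 0 < ∫ X : Fin (n + 1) → ℂ, Real.exp (-gibbsEnergy ℓ (2 / (n + 1 : ℕ)) S X) :=
    integral_exp_pos hi
  field_simp

end Reduction

/-! ### Gaussian decay of the one-particle density -/

theorem integral_norm_pow_mul_gaussian (k : ℕ) :
    ∫ w : ℂ, ‖w‖ ^ (2 * k) * Real.exp (-‖w‖ ^ 2) = Real.pi * k.factorial := by
  have h := Complex.integral_rpow_mul_exp_neg_rpow (p := 2) (q := (2 * k : ℕ)) (by norm_num)
    (by have : (0 : ℝ) ≤ ((2 * k : ℕ) : ℝ) := Nat.cast_nonneg _; linarith)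
  simp only [Real.rpow_natCast, Real.rpow_two] at h
  rw [h]
  have : ((2 * k : ℕ) + 2 : ℝ) / 2 = k + 1 := by push_cast; ring
  rw [this, Real.Gamma_nat_eq_factorial]
  ring

theorem integrable_norm_pow_mul_gaussian (k : ℕ) :
    Integrable fun w : ℂ => ‖w‖ ^ k * Real.exp (-‖w‖ ^ 2) := by
  have h : ∀ k : ℕ, Integrable fun w : ℂ => ‖w‖ ^ (2 * k) * Real.exp (-‖w‖ ^ 2) := fun k =>
    Integrable.of_integral_ne_zero (by rw [integral_norm_pow_mul_gaussian]; positivity)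
  refine ((h 0).add (h k)).mono' (by fun_prop) (Eventually.of_forall fun w => ?_)
  rw [Real.norm_of_nonneg (by positivity), Pi.add_apply, ← add_mul]
  refine mul_le_mul_of_nonneg_right ?_ (Real.exp_pos _).le
  rw [mul_zero, pow_zero, mul_comm 2 k, pow_mul]
  nlinarith [sq_nonneg (‖w‖ ^ k - 1), sq_nonneg (‖w‖ ^ k)]

theorem integral_monomial_gaussian (j k : ℕ) :
    (Integrable fun w : ℂ => w ^ j * (starRingEnd ℂ w) ^ k * (Real.exp (-‖w‖ ^ 2) : ℝ)) ∧
    ∫ w : ℂ, w ^ j * (starRingEnd ℂ w) ^ k * (Real.exp (-‖w‖ ^ 2) : ℝ) =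
      if j = k then (Real.pi * k.factorial : ℂ) else 0 := by
  constructor
  · refine (integrable_norm_pow_mul_gaussian (j + k)).mono' (by fun_prop)
      (Eventually.of_forall fun w => ?_)
    rw [norm_mul, norm_mul, norm_pow, norm_pow, RCLike.norm_conj, ← pow_add, Complex.norm_real,
      Real.norm_of_nonneg (Real.exp_pos _).le]
  · by_cases hjk : j = k
    · subst hjk
      rw [if_pos rfl]
      have h := integral_norm_pow_mul_gaussian j
      have h2 : ∀ w : ℂ, w ^ j * (starRingEnd ℂ w) ^ j * (Real.exp (-‖w‖ ^ 2) : ℝ) =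
          ((‖w‖ ^ (2 * j) * Real.exp (-‖w‖ ^ 2) : ℝ) : ℂ) := fun w => by
        rw [← mul_pow, Complex.mul_conj, Complex.normSq_eq_norm_sq, pow_mul]
        push_cast
        ring
      simp_rw [h2]
      rw [integral_complex_ofReal, h]
      push_cast
      ring
    · rw [if_neg hjk]
      have hne : (j : ℝ) - k ≠ 0 := sub_ne_zero.2 (by exact_mod_cast hjk)
      -- Rotation by the angle π/(j − k) multiplies w^j w̄^k by e^(iπ) = −1, so the integral equals
      -- its own negative.
      set a := Circle.exp (Real.pi / (j - k)) with ha
      have hmp := (rotation a).measurePreserving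
      have h := hmp.integral_comp (rotation a).toHomeomorph.measurableEmbedding
        fun w : ℂ => w ^ j * (starRingEnd ℂ w) ^ k * (Real.exp (-‖w‖ ^ 2) : ℝ)
      have hconst : (a : ℂ) ^ j * (starRingEnd ℂ (a : ℂ)) ^ k = -1 := by
        have hne' : (j : ℂ) - k ≠ 0 := by exact_mod_cast hne
        rw [ha, Circle.coe_exp, ← Complex.exp_conj, ← Complex.exp_nat_mul, ← Complex.exp_nat_mul,
          ← Complex.exp_add, ← Complex.exp_pi_mul_I]
        congr 1
        simp only [map_mul, Complex.conj_ofReal, Complex.conj_I]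
        push_cast
        field_simp
        ring
      have h2 : ∀ w : ℂ, (rotation a w) ^ j * (starRingEnd ℂ (rotation a w)) ^ k *
          (Real.exp (-‖rotation a w‖ ^ 2) : ℝ) =
          -(w ^ j * (starRingEnd ℂ w) ^ k * (Real.exp (-‖w‖ ^ 2) : ℝ)) := fun w => by
        rw [LinearIsometryEquiv.norm_map, rotation_apply, map_mul, mul_pow, mul_pow]
        linear_combination (w ^ j * (starRingEnd ℂ w) ^ k * (Real.exp (-‖w‖ ^ 2) : ℝ)) * hconst
      simp_rw [h2] at h
      rw [integral_neg] at h
      exact self_eq_neg.1 h.symm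

theorem Polynomial.integral_norm_sq_gaussian {P : ℂ[X]} {D : ℕ} (hP : P.natDegree ≤ D) :
    ∫ w : ℂ, ‖P.eval w‖ ^ 2 * Real.exp (-‖w‖ ^ 2) =
      Real.pi * ∑ k ∈ Finset.range (D + 1), ‖P.coeff k‖ ^ 2 * k.factorial := by
  have h1 : ∀ w : ℂ, ((‖P.eval w‖ ^ 2 * Real.exp (-‖w‖ ^ 2) : ℝ) : ℂ) =
      ∑ j ∈ Finset.range (D + 1), ∑ k ∈ Finset.range (D + 1),
        P.coeff j * starRingEnd ℂ (P.coeff k) *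
          (w ^ j * (starRingEnd ℂ w) ^ k * (Real.exp (-‖w‖ ^ 2) : ℝ)) := fun w => by
    have h2 : ((‖P.eval w‖ ^ 2 : ℝ) : ℂ) = P.eval w * starRingEnd ℂ (P.eval w) := by
      rw [Complex.mul_conj, Complex.normSq_eq_norm_sq]
    rw [Complex.ofReal_mul, h2, Polynomial.eval_eq_sum_range' (Nat.lt_succ_of_le hP), map_sum,
      Finset.sum_mul_sum, Finset.sum_mul]
    refine Finset.sum_congr rfl fun j _ => ?_
    rw [Finset.sum_mul]
    refine Finset.sum_congr rfl fun k _ => ?_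
    rw [map_mul, map_pow]
    ring
  have h3 : ((∫ w : ℂ, ‖P.eval w‖ ^ 2 * Real.exp (-‖w‖ ^ 2) : ℝ) : ℂ) =
      ((Real.pi * ∑ k ∈ Finset.range (D + 1), ‖P.coeff k‖ ^ 2 * k.factorial : ℝ) : ℂ) := by
    rw [← integral_complex_ofReal]
    simp_rw [h1]
    rw [integral_finsetSum _ fun j _ => integrable_finsetSum _ fun k _ =>
      (integral_monomial_gaussian j k).1.const_mul _]
    have h4 : ∀ j ∈ Finset.range (D + 1), ∫ w : ℂ, ∑ k ∈ Finset.range (D + 1),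
        P.coeff j * starRingEnd ℂ (P.coeff k) *
          (w ^ j * (starRingEnd ℂ w) ^ k * (Real.exp (-‖w‖ ^ 2) : ℝ)) =
        Real.pi * ((‖P.coeff j‖ ^ 2 * j.factorial : ℝ) : ℂ) := fun j hj => by
      rw [integral_finsetSum _ fun k _ => (integral_monomial_gaussian j k).1.const_mul _]
      simp_rw [integral_const_mul, (integral_monomial_gaussian j _).2]
      simp only [mul_ite, mul_zero, Finset.sum_ite_eq, hj, if_true]
      rw [Complex.mul_conj, Complex.normSq_eq_norm_sq]
      push_cast
      ring
    rw [Finset.sum_congr rfl h4, ← Finset.mul_sum]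
    push_cast
    ring
  exact_mod_cast h3

/-- A polynomial of degree at most `D` is pointwise bounded by its Gaussian `L²` norm. -/
theorem Polynomial.norm_sq_eval_mul_gaussian_le {P : ℂ[X]} {D : ℕ} (hP : P.natDegree ≤ D)
    (z : ℂ) : ‖P.eval z‖ ^ 2 * Real.exp (-‖z‖ ^ 2) ≤
      Real.pi⁻¹ * 2 ^ D * Real.exp (-‖z‖ ^ 2 / 2) *
        ∫ w : ℂ, ‖P.eval w‖ ^ 2 * Real.exp (-‖w‖ ^ 2) := by
  rw [Polynomial.integral_norm_sq_gaussian hP]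
  obtain ⟨A, hA⟩ : ∃ A, A = ∑ k ∈ Finset.range (D + 1), ‖P.coeff k‖ ^ 2 * k.factorial := ⟨_, rfl⟩
  rw [← hA]
  have h1 : ‖P.eval z‖ ^ 2 ≤ A * ∑ k ∈ Finset.range (D + 1), ‖z‖ ^ (2 * k) / k.factorial := by
    have h2 : ‖P.eval z‖ ≤ ∑ k ∈ Finset.range (D + 1), ‖P.coeff k‖ * ‖z‖ ^ k := by
      rw [Polynomial.eval_eq_sum_range' (Nat.lt_succ_of_le hP)]
      refine (norm_sum_le _ _).trans (Finset.sum_le_sum fun k _ => ?_)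
      rw [norm_mul, norm_pow]
    have h3 : (∑ k ∈ Finset.range (D + 1), ‖P.coeff k‖ * ‖z‖ ^ k) ^ 2 ≤
        (∑ k ∈ Finset.range (D + 1), ‖P.coeff k‖ ^ 2 * k.factorial) *
          ∑ k ∈ Finset.range (D + 1), ‖z‖ ^ (2 * k) / k.factorial := by
      refine Finset.sum_sq_le_sum_mul_sum_of_sq_le_mul _ (fun k _ => by positivity)
        (fun k _ => by positivity) fun k _ => le_of_eq ?_
      have : (k.factorial : ℝ) ≠ 0 := by positivity
      field_simp
      ring
    rw [hA]
    exact (pow_le_pow_left₀ (norm_nonneg _) h2 2).trans h3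
  -- Paying 2^D to replace ‖z‖² by ‖z‖²/2 in the exponential series leaves half of the Gaussian
  -- factor as decay.
  have h4 : ∑ k ∈ Finset.range (D + 1), ‖z‖ ^ (2 * k) / (k.factorial : ℝ) ≤
      2 ^ D * Real.exp (‖z‖ ^ 2 / 2) := by
    refine le_trans ?_ (mul_le_mul_of_nonneg_left (Real.sum_le_exp_of_nonneg
      (by positivity : 0 ≤ ‖z‖ ^ 2 / 2) (D + 1)) (by positivity))
    rw [Finset.mul_sum]
    refine Finset.sum_le_sum fun k hk => ?_
    have hk' : k ≤ D := Nat.lt_succ_iff.1 (Finset.mem_range.1 hk)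
    have h5 : (2 : ℝ) ^ k ≤ 2 ^ D := pow_le_pow_right₀ (by norm_num) hk'
    rw [div_pow, ← pow_mul, ← mul_div_assoc, div_le_div_iff_of_pos_right (by positivity),
      ← mul_div_assoc, le_div_iff₀ (by positivity), mul_comm]
    exact mul_le_mul_of_nonneg_right h5 (by positivity)
  have hA0 : 0 ≤ A := hA ▸ Finset.sum_nonneg fun k _ => by positivity
  have h6 : Real.exp (-‖z‖ ^ 2 / 2) = Real.exp (‖z‖ ^ 2 / 2) * Real.exp (-‖z‖ ^ 2) := by
    rw [← Real.exp_add]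
    congr 1
    ring
  calc ‖P.eval z‖ ^ 2 * Real.exp (-‖z‖ ^ 2)
      ≤ A * (2 ^ D * Real.exp (‖z‖ ^ 2 / 2)) * Real.exp (-‖z‖ ^ 2) := by
        refine mul_le_mul_of_nonneg_right (h1.trans ?_) (Real.exp_pos _).le
        exact mul_le_mul_of_nonneg_left h4 hA0
    _ = _ := by
        rw [h6]
        field_simp

section Decay

variable {ℓ n : ℕ}

theorem exists_polynomial_laughlinAmplitude (f : ℂ[X]) (w : Fin n → ℂ) :
    ∃ P : ℂ[X], P.natDegree ≤ f.natDegree + ℓ * n ∧ ∃ K : ℝ, ∀ z : ℂ,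
      ‖laughlinAmplitude ℓ (n + 1) f (Fin.cons z w : Fin (n + 1) → ℂ)‖ ^ 2 =
        K * (‖P.eval z‖ ^ 2 * Real.exp (-‖z‖ ^ 2)) := by
  refine ⟨f * ∏ j, (Polynomial.X - Polynomial.C (w j)) ^ ℓ, ?_,
    ‖laughlinAmplitude ℓ n f w‖ ^ 2, fun z => ?_⟩
  · refine Polynomial.natDegree_mul_le.trans (add_le_add le_rfl
      ((Polynomial.natDegree_prod_le _ _).trans ?_))
    refine (Finset.sum_le_sum (g := fun _ => ℓ) fun j _ => ?_).trans (by simp [mul_comm])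
    refine Polynomial.natDegree_pow_le.trans ?_
    rw [Polynomial.natDegree_X_sub_C, mul_one]
  · have h : laughlinAmplitude ℓ (n + 1) f (Fin.cons z w : Fin (n + 1) → ℂ) =
        laughlinAmplitude ℓ n f w * (Polynomial.eval z
          (f * ∏ j, (Polynomial.X - Polynomial.C (w j)) ^ ℓ) *
          ((Real.exp (-‖z‖ ^ 2 / 2) : ℝ) : ℂ)) := by
      unfold laughlinAmplitude
      rw [Fin.prod_univ_succ, Fin.prod_univ_succ, Fin.sum_univ_succ, Fin.prod_Ioi_zero]
      simp only [Fin.cons_zero, Fin.cons_succ, Fin.prod_Ioi_succ, Polynomial.eval_mul,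
        Polynomial.eval_prod, Polynomial.eval_pow, Polynomial.eval_sub, Polynomial.eval_X,
        Polynomial.eval_C]
      have e : Real.exp (-(‖z‖ ^ 2 + ∑ i, ‖w i‖ ^ 2) / 2) =
          Real.exp (-(∑ i, ‖w i‖ ^ 2) / 2) * Real.exp (-‖z‖ ^ 2 / 2) := by
        rw [← Real.exp_add]
        congr 1
        ring
      rw [e]
      push_cast
      ring
    have e2 : Real.exp (-‖z‖ ^ 2 / 2) ^ 2 = Real.exp (-‖z‖ ^ 2) := by
      rw [← Real.exp_nat_mul]
      congr 1
      push_cast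
      ring
    rw [h, norm_mul, norm_mul, mul_pow, mul_pow, Complex.norm_real,
      Real.norm_of_nonneg (Real.exp_pos _).le, e2]

theorem scaledOneParticleDensity_nonneg (N : ℕ) (f : ℂ[X]) (x : ℂ) :
    0 ≤ scaledOneParticleDensity ℓ N f x := by
  cases N with
  | zero => exact le_rfl
  | succ n =>
    exact mul_nonneg (Nat.cast_nonneg _) (integral_nonneg fun w => by positivity)

theorem integral_cons_swap {G : (Fin (n + 1) → ℂ) → ℝ} (hG : Integrable G) :
    (Integrable fun w : Fin n → ℂ => ∫ x : ℂ, G (Fin.cons x w : Fin (n + 1) → ℂ)) ∧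
    ∫ w : Fin n → ℂ, ∫ x : ℂ, G (Fin.cons x w : Fin (n + 1) → ℂ) = ∫ z, G z := by
  have hi := integrable_comp_cons hG
  refine ⟨hi.integral_prod_right, ?_⟩
  rw [← (integral_cons hG).2]
  exact integral_integral_swap hi.swap

/-- With the other particles frozen, the first variable enters through a polynomial times a
Gaussian. The pointwise bound for these is integrated over the frozen variables, and the norm of the
wave function cancels. -/
theorem scaledOneParticleDensity_le {f : ℂ[X]}
    (hi : Integrable fun z => ‖laughlinAmplitude ℓ (n + 1) f z‖ ^ 2) (x : ℂ) :
    scaledOneParticleDensity ℓ (n + 1) f x ≤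
      (n + 1 : ℕ) * (Real.pi⁻¹ * 2 ^ (f.natDegree + ℓ * n) *
        Real.exp (-((n + 1 : ℕ) * ‖x‖ ^ 2 / 2))) := by
  rw [scaledOneParticleDensity_eq]
  obtain ⟨Z, hZ⟩ : ∃ Z, Z = ∫ w, ‖laughlinAmplitude ℓ (n + 1) f w‖ ^ 2 := ⟨_, rfl⟩
  have hZ0 : 0 ≤ Z := hZ ▸ integral_nonneg fun _ => by positivity
  obtain ⟨k1, k2⟩ := integral_cons_swap hi
  obtain ⟨z, hz⟩ : ∃ z : ℂ, z = √((n + 1 : ℕ) : ℝ) * x := ⟨_, rfl⟩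
  have hzn : ‖z‖ ^ 2 = (n + 1 : ℕ) * ‖x‖ ^ 2 := by
    rw [hz, norm_mul, mul_pow, Complex.norm_real, Real.norm_of_nonneg (Real.sqrt_nonneg _),
      Real.sq_sqrt (Nat.cast_nonneg _)]
  rw [← hZ, ← hz, ← hzn]
  have h1 : ∫ w : Fin n → ℂ, ‖laughlinAmplitude ℓ (n + 1) f
      (Fin.cons z w : Fin (n + 1) → ℂ)‖ ^ 2 ≤
      Real.pi⁻¹ * 2 ^ (f.natDegree + ℓ * n) * Real.exp (-‖z‖ ^ 2 / 2) * Z := by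
    rw [hZ, ← k2, ← integral_const_mul]
    refine integral_mono_of_nonneg (Eventually.of_forall fun w => by positivity) (k1.const_mul _)
      (Eventually.of_forall fun w => ?_)
    obtain ⟨P, hP, K, hK⟩ := exists_polynomial_laughlinAmplitude (ℓ := ℓ) f w
    simp only
    simp_rw [hK]
    rw [integral_const_mul]
    -- The factorization does not record the sign of K; if K < 0, nonnegativity of the left side
    -- forces the polynomial term to vanish identically.
    rcases le_or_gt 0 K with hK0 | hK0
    · have := mul_le_mul_of_nonneg_left (Polynomial.norm_sq_eval_mul_gaussian_le hP z) hK0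
      refine this.trans_eq ?_
      ring
    · have h0 : ∀ u : ℂ, ‖P.eval u‖ ^ 2 * Real.exp (-‖u‖ ^ 2) = 0 := fun u => by
        have h2 := hK u
        have h3 : 0 ≤ ‖P.eval u‖ ^ 2 * Real.exp (-‖u‖ ^ 2) := by positivity
        have h4 : 0 ≤ K * (‖P.eval u‖ ^ 2 * Real.exp (-‖u‖ ^ 2)) := h2 ▸ by positivity
        exact le_antisymm (nonpos_of_mul_nonneg_right h4 hK0) h3
      simp [h0]
  have hneg : -‖z‖ ^ 2 / 2 = -(‖z‖ ^ 2 / 2) := by ring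
  rw [hneg] at h1
  rw [div_mul_eq_mul_div, mul_div_assoc]
  refine mul_le_mul_of_nonneg_left ?_ (Nat.cast_nonneg _)
  exact div_le_of_le_mul₀ hZ0 (by positivity) h1

end Decay

/-! ### Quasi-holes -/

theorem roots_rootPolynomial (N : ℕ) (S : Finset ℂ) :
    (rootPolynomial N S).roots = S.val.map fun a => (√(N : ℝ) : ℂ) * a := by
  have h : rootPolynomial N S =
      ((S.val.map fun a => (√(N : ℝ) : ℂ) * a).map fun a => Polynomial.X - Polynomial.C a).prod := by
    rw [Multiset.map_map]
    rfl
  rw [h, Polynomial.roots_multiset_prod_X_sub_C]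

theorem natDegree_rootPolynomial_le (N : ℕ) (S : Finset ℂ) :
    (rootPolynomial N S).natDegree ≤ S.card := by
  refine (Polynomial.natDegree_prod_le _ _).trans ?_
  simp only [Polynomial.natDegree_X_sub_C, Finset.sum_const, smul_eq_mul,
    mul_one, le_refl]

theorem quasiHolePotential_rootPolynomial {N : ℕ} (hN : 1 ≤ N) (S : Finset ℂ) (x : ℂ) :
    quasiHolePotential N (rootPolynomial N S) x + ‖x‖ ^ 2 = extPotential (2 / N) S x := by
  have hs : (√(N : ℝ) : ℂ) ≠ 0 := by
    exact_mod_cast (Real.sqrt_pos.2 (by exact_mod_cast hN : (0 : ℝ) < N)).ne'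
  unfold quasiHolePotential extPotential
  rw [roots_rootPolynomial, Multiset.map_map]
  congr 1
  refine Finset.sum_congr rfl fun a _ => ?_
  simp only [logKernel, Function.comp_apply]
  rw [mul_div_cancel_left₀ _ hs]

theorem isFiniteEnergyDensity_rootPolynomial_iff {N : ℕ} (hN : 1 ≤ N) (S : Finset ℂ)
    (σ : ℂ → ℝ) :
    IsFiniteEnergyDensity N (rootPolynomial N S) σ ↔ HasFiniteEnergy (2 / N) S σ := by
  constructor
  · intro h
    refine ⟨h.nonneg, h.integrable, h.integral_eq_one, ?_, h.integrable_interaction⟩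
    simpa only [quasiHolePotential_rootPolynomial hN] using h.integrable_potential
  · intro h
    refine ⟨h.nonneg, h.integrable, h.integral_eq_one, ?_, h.integrable_interaction⟩
    simpa only [quasiHolePotential_rootPolynomial hN] using h.integrable_potential

theorem electrostaticEnergy_rootPolynomial (ℓ : ℕ) {N : ℕ} (hN : 1 ≤ N) (S : Finset ℂ)
    (σ : ℂ → ℝ) : electrostaticEnergy ℓ N (rootPolynomial N S) σ =
      chargeEnergy ℓ (extPotential (2 / N) S) σ := by
  unfold electrostaticEnergy
  simp only [quasiHolePotential_rootPolynomial hN]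
  rfl

theorem gridSpacing_le_dist {δ : ℝ} (hδ : 0 ≤ δ) {b u : ℂ} (hu : ‖u‖ = 1) {m n m' n' : ℤ}
    (h : cellCenter δ b u m n ≠ cellCenter δ b u m' n') :
    δ ≤ dist (cellCenter δ b u m n) (cellCenter δ b u m' n') := by
  have e : cellCenter δ b u m n - cellCenter δ b u m' n' =
      δ * u * (((m - m' : ℤ) : ℂ) + ((n - n' : ℤ) : ℂ) * Complex.I) := by
    unfold cellCenter
    push_cast
    ring
  have h1 : 1 ≤ ‖((m - m' : ℤ) : ℂ) + ((n - n' : ℤ) : ℂ) * Complex.I‖ := by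
    by_cases hm : m - m' = 0
    · have hn : n - n' ≠ 0 := fun hn => h (by
        rw [sub_eq_zero.1 hm, sub_eq_zero.1 hn])
      have h2 := Complex.abs_im_le_norm (((m - m' : ℤ) : ℂ) + ((n - n' : ℤ) : ℂ) * Complex.I)
      have h3 : (1 : ℝ) ≤ |((n - n' : ℤ) : ℝ)| := by exact_mod_cast Int.one_le_abs hn
      refine h3.trans (le_trans (le_of_eq ?_) h2)
      simp
    · have h2 := Complex.abs_re_le_norm (((m - m' : ℤ) : ℂ) + ((n - n' : ℤ) : ℂ) * Complex.I)
      have h3 : (1 : ℝ) ≤ |((m - m' : ℤ) : ℝ)| := by exact_mod_cast Int.one_le_abs hm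
      refine h3.trans (le_trans (le_of_eq ?_) h2)
      simp
  rw [dist_eq_norm, e, norm_mul, norm_mul, hu, mul_one, Complex.norm_real,
    Real.norm_of_nonneg hδ]
  exact le_mul_of_one_le_right hδ h1

/-- Area comparison: the discs of radius δ/2 about the points are disjoint and lie in a disc of
radius r + δ. -/
theorem card_mul_sq_le_of_separated {S : Finset ℂ} {r δ : ℝ} (hr : 0 ≤ r) (hδ : 0 < δ)
    (hS : ∀ a ∈ S, ‖a‖ ≤ r) (hsep : ∀ a ∈ S, ∀ a' ∈ S, a ≠ a' → δ ≤ dist a a') :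
    S.card * (δ / 2) ^ 2 ≤ (r + δ) ^ 2 := by
  have hd : Set.PairwiseDisjoint (S : Set ℂ) fun a => Metric.ball a (δ / 2) := by
    intro a ha a' ha' hne
    refine Metric.ball_disjoint_ball ?_
    have := hsep a ha a' ha' hne
    linarith
  have h1 := measureReal_biUnion_finset (μ := volume) hd (fun a _ => measurableSet_ball)
    (fun a _ => measure_ball_lt_top.ne)
  have h2 : (⋃ a ∈ S, Metric.ball a (δ / 2)) ⊆ Metric.ball (0 : ℂ) (r + δ) := by
    refine Set.iUnion₂_subset fun a ha x hx => ?_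
    rw [Metric.mem_ball, dist_eq_norm] at hx
    rw [mem_ball_zero_iff]
    have h3 := norm_le_norm_add_norm_sub' x a
    linarith [hS a ha]
  have h3 := measureReal_mono (μ := volume) h2 measure_ball_lt_top.ne
  rw [h1, volume_real_ball _ (by positivity),
    Finset.sum_congr rfl fun a _ => volume_real_ball a (by positivity : 0 ≤ δ / 2),
    Finset.sum_const, nsmul_eq_mul] at h3
  refine le_of_mul_le_mul_left ?_ Real.pi_pos
  linarith

/-- The number of quasi-holes is at most proportional to the number of particles. -/
theorem card_quasiHoleSet_le {N : ℕ} (hN : 1 ≤ N) (R : ℝ) (Ω : Set ℂ) (b u : ℂ) (hu : ‖u‖ = 1) :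
    ((quasiHoleSet_finite N R Ω b u).toFinset.card : ℝ) ≤ 2 * (|R| + 2) ^ 2 * N := by
  have hN1 : (1 : ℝ) ≤ N := by exact_mod_cast hN
  have hN' : (0 : ℝ) < N := by linarith
  have hpi := Real.pi_pos
  have hδ : 0 < gridSpacing N := Real.sqrt_pos.2 (by positivity)
  have hδ2 : gridSpacing N ^ 2 = Real.pi / N := Real.sq_sqrt (by positivity)
  have hδ1 : gridSpacing N ≤ 2 := by
    refine Real.sqrt_le_iff.2 ⟨by norm_num, ?_⟩
    rw [div_le_iff₀ hN']
    linarith [Real.pi_lt_four]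
  have h := card_mul_sq_le_of_separated (S := (quasiHoleSet_finite N R Ω b u).toFinset)
    (r := |R|) (abs_nonneg R) hδ (fun a ha => by
      have := quasiHoleSet_subset_closedBall N R Ω b u ((Set.Finite.mem_toFinset _).1 ha)
      exact (mem_closedBall_zero_iff.1 this).trans (le_abs_self R))
    (fun a ha a' ha' hne => by
      obtain ⟨⟨m, n, rfl⟩, -⟩ := (Set.Finite.mem_toFinset _).1 ha
      obtain ⟨⟨m', n', rfl⟩, -⟩ := (Set.Finite.mem_toFinset _).1 ha'
      exact gridSpacing_le_dist hδ.le hu hne)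
  obtain ⟨k, hk⟩ : ∃ k : ℝ, k = ((quasiHoleSet_finite N R Ω b u).toFinset.card : ℝ) := ⟨_, rfl⟩
  rw [← hk] at h ⊢
  have hk0 : 0 ≤ k := hk ▸ Nat.cast_nonneg _
  have h1 : (|R| + gridSpacing N) ^ 2 ≤ (|R| + 2) ^ 2 := by gcongr
  have h2 : k * (Real.pi / N) / 4 ≤ (|R| + 2) ^ 2 := by
    rw [← hδ2]
    linarith
  have h3 : k * Real.pi ≤ (|R| + 2) ^ 2 * 4 * N := by
    have : k * (Real.pi / N) / 4 = k * Real.pi / (4 * N) := by field_simp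
    rw [this, div_le_iff₀ (by positivity)] at h2
    linarith
  have h4 := mul_le_mul_of_nonneg_left Real.two_le_pi hk0
  linarith

/-! ### Norms of gradients -/

theorem integral_norm_sq_fderiv_eq {χ : ℂ → ℝ} (hχ : ContDiff ℝ 1 χ) (hs : HasCompactSupport χ) :
    ∫ x, ‖fderiv ℝ χ x‖ ^ 2 = (eLpNorm (fderiv ℝ χ) 2 volume).toReal ^ 2 := by
  have hm : MemLp (fderiv ℝ χ) 2 volume :=
    (hχ.continuous_fderiv one_ne_zero).memLp_of_hasCompactSupport (hs.fderiv ℝ)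
  have h0 : 0 ≤ ∫ x, ‖fderiv ℝ χ x‖ ^ 2 := integral_nonneg fun _ => by positivity
  rw [hm.eLpNorm_eq_integral_rpow_norm two_ne_zero ENNReal.ofNat_ne_top]
  simp only [ENNReal.toReal_ofNat, Real.rpow_two]
  rw [ENNReal.toReal_ofReal (by positivity), ← Real.rpow_natCast, ← Real.rpow_mul h0]
  norm_num

/-- The essential bound on the continuous gradient holds on a closed set of full measure, hence
everywhere, and the mean value inequality applies. -/
theorem abs_sub_le_eLpNorm_top {χ : ℂ → ℝ} (hχ : ContDiff ℝ 1 χ) (hs : HasCompactSupport χ)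
    (x y : ℂ) : |χ x - χ y| ≤ (eLpNorm (fderiv ℝ χ) ⊤ volume).toReal * ‖x - y‖ := by
  have hc := hχ.continuous_fderiv one_ne_zero
  have hm : MemLp (fderiv ℝ χ) ⊤ volume := hc.memLp_of_hasCompactSupport (hs.fderiv ℝ)
  have hae : ∀ᵐ z, ‖fderiv ℝ χ z‖ ≤ (eLpNorm (fderiv ℝ χ) ⊤ volume).toReal := by
    filter_upwards [ae_le_eLpNormEssSup (f := fderiv ℝ χ) (μ := volume)] with z hz
    rw [← eLpNorm_exponent_top] at hz
    rw [← toReal_enorm]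
    exact ENNReal.toReal_mono hm.eLpNorm_ne_top hz
  have hcl : IsClosed {z | ‖fderiv ℝ χ z‖ ≤ (eLpNorm (fderiv ℝ χ) ⊤ volume).toReal} :=
    isClosed_le hc.norm continuous_const
  have hall : ∀ z, ‖fderiv ℝ χ z‖ ≤ (eLpNorm (fderiv ℝ χ) ⊤ volume).toReal := fun z => by
    have hd := (Measure.dense_of_ae hae).closure_eq
    rw [hcl.closure_eq] at hd
    exact (hd ▸ Set.mem_univ z : z ∈ {z | ‖fderiv ℝ χ z‖ ≤ _})
  have := convex_univ.norm_image_sub_le_of_norm_fderiv_le (𝕜 := ℝ) (f := χ) (x := y) (y := x)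
    (fun z _ => (hχ.differentiable one_ne_zero) z) (fun z _ => hall z) trivial trivial
  simpa only [Real.norm_eq_abs] using this

/-! ### The density estimates -/

section Estimates

variable {ℓ n : ℕ} {S : Finset ℂ} {Λ T e A : ℝ} {ρ : ℂ → ℝ}

theorem IsEquilibrium.scaledOneParticleDensity_le_exp (h : IsEquilibrium ℓ (2 / (n + 1 : ℕ)) S Λ T e ρ)
    (hA : S.card + ℓ * n + (n + 1 : ℕ) ≤ A * (n + 1 : ℕ)) (x : ℂ) :
    scaledOneParticleDensity ℓ (n + 1) (rootPolynomial (n + 1) S) x ≤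
      Real.exp (A * (n + 1 : ℕ)) * Real.exp (-((n + 1 : ℕ) * ‖x‖ ^ 2 / 2)) := by
  have hi := integrable_norm_sq_laughlinAmplitude (by omega)
    (h.integrable_exp_neg_gibbsEnergy (N := n + 1) (Nat.cast_nonneg ℓ) (by positivity) (by omega))
  refine (scaledOneParticleDensity_le hi x).trans ?_
  rw [← mul_assoc]
  refine mul_le_mul_of_nonneg_right ?_ (Real.exp_pos _).le
  have hpi : Real.pi⁻¹ ≤ 1 := inv_le_one_of_one_le₀ (by linarith [Real.pi_gt_three])
  have h2 : (2 : ℝ) ^ ((rootPolynomial (n + 1) S).natDegree + ℓ * n) ≤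
      Real.exp (S.card + ℓ * n) := by
    have h3 : (2 : ℝ) ≤ Real.exp 1 := by linarith [Real.exp_one_gt_d9]
    refine (pow_le_pow_left₀ (by norm_num) h3 _).trans ?_
    rw [← Real.exp_nat_mul]
    refine Real.exp_le_exp.2 ?_
    have : ((rootPolynomial (n + 1) S).natDegree : ℝ) ≤ S.card := by
      exact_mod_cast natDegree_rootPolynomial_le _ S
    push_cast
    linarith
  have h4 : ((n + 1 : ℕ) : ℝ) ≤ Real.exp (n + 1 : ℕ) := by
    linarith [Real.add_one_le_exp ((n + 1 : ℕ) : ℝ)]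
  calc ((n + 1 : ℕ) : ℝ) * (Real.pi⁻¹ * 2 ^ ((rootPolynomial (n + 1) S).natDegree + ℓ * n))
      ≤ Real.exp (n + 1 : ℕ) * (1 * Real.exp (S.card + ℓ * n)) := by gcongr
    _ = Real.exp (S.card + ℓ * n + (n + 1 : ℕ)) := by
        rw [one_mul, ← Real.exp_add]
        congr 1
        ring
    _ ≤ _ := Real.exp_le_exp.2 hA

/-- The constant absorbs exponential prefactors. -/
theorem exp_mul_le_exp_mul_exp {A N : ℝ} (hA : 0 ≤ A) (hN : 1 ≤ N) (t : ℝ) :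
    Real.exp (A * N) * Real.exp (-(N * t / 2)) ≤
      Real.exp (A * Real.exp (2 * A)) * Real.exp (-(N * (1 / 2) * (t - Real.log N))) := by
  rw [← Real.exp_add, ← Real.exp_add]
  refine Real.exp_le_exp.2 ?_
  have hN0 : 0 < N := by linarith
  -- If log N ≥ 2A, then A N ≤ (N/2) log N is absorbed by the logarithm on the right; otherwise N ≤
  -- exp(2A) and the prefactor is bounded.
  by_cases h : 2 * A ≤ Real.log N
  · have h1 := mul_le_mul_of_nonneg_left h hN0.le
    have h2 : 0 ≤ A * Real.exp (2 * A) := by positivity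
    linarith
  · push Not at h
    have h1 : N ≤ Real.exp (2 * A) := ((Real.log_lt_iff_lt_exp hN0).1 h).le
    have h2 := mul_le_mul_of_nonneg_left h1 hA
    have h3 : 0 ≤ N * Real.log N := mul_nonneg hN0.le (Real.log_nonneg hN)
    linarith

theorem IsEquilibrium.integral_sub_mul_eq (h : IsEquilibrium ℓ (2 / (n + 1 : ℕ)) S Λ T e ρ)
    {φ : ℂ → ℝ} (hφ : Continuous φ) {M : ℝ} (hM : ∀ x, |φ x| ≤ M) :
    (∫ x, (scaledOneParticleDensity ℓ (n + 1) (rootPolynomial (n + 1) S) x - ρ x) * φ x) *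
        ∫ X : Fin (n + 1) → ℂ, Real.exp (-gibbsEnergy ℓ (2 / (n + 1 : ℕ)) S X) =
      ∫ X : Fin (n + 1) → ℂ, (((n + 1 : ℕ) : ℝ)⁻¹ * ∑ i, φ (X i) - ∫ x, φ x * ρ x) *
        Real.exp (-gibbsEnergy ℓ (2 / (n + 1 : ℕ)) S X) := by
  have hi := h.integrable_exp_neg_gibbsEnergy (N := n + 1) (Nat.cast_nonneg ℓ) (by positivity)
    (by omega)
  obtain ⟨k1, k2⟩ := integral_scaledOneParticleDensity_mul hi hφ hM
  have k3 := h.integrable_mul hφ.locallyIntegrable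
  have hN : (0 : ℝ) < ((n + 1 : ℕ) : ℝ) := by positivity
  have i1 : Integrable fun X : Fin (n + 1) → ℂ => (((n + 1 : ℕ) : ℝ)⁻¹ * ∑ i, φ (X i)) *
      Real.exp (-gibbsEnergy ℓ (2 / (n + 1 : ℕ)) S X) := by
    refine hi.bdd_mul (c := M) (by fun_prop : Continuous fun X : Fin (n + 1) → ℂ =>
      ((n + 1 : ℕ) : ℝ)⁻¹ * ∑ i, φ (X i)).aestronglyMeasurable (Eventually.of_forall fun X => ?_)
    rw [norm_mul, norm_inv, RCLike.norm_natCast, inv_mul_le_iff₀ hN]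
    refine (norm_sum_le _ _).trans ((Finset.sum_le_sum fun i _ => hM (X i)).trans_eq ?_)
    simp
  simp_rw [sub_mul]
  rw [integral_sub i1 (hi.const_mul _), integral_const_mul, ← k2]
  have e1 : ∫ x, (scaledOneParticleDensity ℓ (n + 1) (rootPolynomial (n + 1) S) x * φ x -
      ρ x * φ x) = (∫ x, scaledOneParticleDensity ℓ (n + 1) (rootPolynomial (n + 1) S) x * φ x) -
      ∫ x, φ x * ρ x := by
    rw [← integral_sub k1 k3]
    exact integral_congr_ae (Eventually.of_forall fun x => by simp only; ring)
  rw [e1, sub_mul]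

theorem IsEquilibrium.abs_integral_sub_mul_le (h : IsEquilibrium ℓ (2 / (n + 1 : ℕ)) S Λ T e ρ)
    (hℓ : 1 ≤ ℓ) (hΛ : 1 ≤ Λ) (hT : 0 ≤ T) {χ : ℂ → ℝ} (hχ : ContDiff ℝ 1 χ)
    (hs : HasCompactSupport χ) :
    |∫ x, (scaledOneParticleDensity ℓ (n + 1) (rootPolynomial (n + 1) S) x - ρ x) * χ x| ≤
      √(gibbsConstant ℓ Λ T * (1 + Real.log (n + 1 : ℕ)) / (n + 1 : ℕ)) *
        (eLpNorm (fderiv ℝ χ) 2 volume).toReal +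
      (eLpNorm (fderiv ℝ χ) ⊤ volume).toReal * (1 / √((n + 1 : ℕ) : ℝ)) := by
  obtain ⟨M, hM⟩ := hχ.continuous.bounded_above_of_compact_support hs
  have hi := h.integrable_exp_neg_gibbsEnergy (N := n + 1) (Nat.cast_nonneg ℓ) (by positivity)
    (by omega)
  have hZ : 0 < ∫ X : Fin (n + 1) → ℂ, Real.exp (-gibbsEnergy ℓ (2 / (n + 1 : ℕ)) S X) :=
    integral_exp_pos hi
  have h1 := h.abs_integral_fluctuation_le (N := n + 1) (by exact_mod_cast hℓ) (by positivity) hΛ hT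
    (by omega) hχ hs (abs_sub_le_eLpNorm_top hχ hs) ENNReal.toReal_nonneg
  rw [← h.integral_sub_mul_eq hχ.continuous hM, abs_mul, abs_of_pos hZ,
    integral_norm_sq_fderiv_eq hχ hs] at h1
  have h2 := le_of_mul_le_mul_right h1 hZ
  rwa [Real.sqrt_mul' _ (sq_nonneg _), Real.sqrt_sq ENNReal.toReal_nonneg] at h2

theorem integral_exp_neg_quarter_sq :
    (Integrable fun x : ℂ => Real.exp (-(1 / 4) * ‖x‖ ^ 2)) ∧
      ∫ x : ℂ, Real.exp (-(1 / 4) * ‖x‖ ^ 2) = 4 * Real.pi := by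
  have h : ∫ x : ℂ, Real.exp (-(1 / 4) * ‖x‖ ^ 2) = 4 * Real.pi := by
    rw [GaussianFourier.integral_rexp_neg_mul_sq_norm (by norm_num)]
    simp [mul_comm]
  exact ⟨Integrable.of_integral_ne_zero (by rw [h]; positivity), h⟩

/-- For one particle the densities are compared through their first moments. -/
theorem IsEquilibrium.abs_integral_sub_mul_le_one (h : IsEquilibrium ℓ (2 / (0 + 1 : ℕ)) S Λ T e ρ)
    (hA : S.card + ℓ * (0 : ℕ) + (0 + 1 : ℕ) ≤ A * (0 + 1 : ℕ)) {χ : ℂ → ℝ}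
    (hχ : ContDiff ℝ 1 χ) (hs : HasCompactSupport χ) :
    |∫ x, (scaledOneParticleDensity ℓ (0 + 1) (rootPolynomial (0 + 1) S) x - ρ x) * χ x| ≤
      (Real.exp A * (4 * Real.pi) + T) * (eLpNorm (fderiv ℝ χ) ⊤ volume).toReal := by
  obtain ⟨B, hB⟩ : ∃ B, B = (eLpNorm (fderiv ℝ χ) ⊤ volume).toReal := ⟨_, rfl⟩
  have hB0 : 0 ≤ B := hB ▸ ENNReal.toReal_nonneg
  have hlip := abs_sub_le_eLpNorm_top hχ hs
  rw [← hB] at hlip ⊢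
  obtain ⟨M, hM⟩ := hχ.continuous.bounded_above_of_compact_support hs
  have hi := h.integrable_exp_neg_gibbsEnergy (N := 0 + 1) (Nat.cast_nonneg ℓ) (by positivity)
    (by omega)
  have hZ : 0 < ∫ X : Fin (0 + 1) → ℂ, Real.exp (-gibbsEnergy ℓ (2 / (0 + 1 : ℕ)) S X) :=
    integral_exp_pos hi
  have hdec := h.scaledOneParticleDensity_le_exp hA
  have hnn := fun x => scaledOneParticleDensity_nonneg (ℓ := ℓ) (0 + 1) (rootPolynomial (0 + 1) S) x
  obtain ⟨k1, k2⟩ := integral_scaledOneParticleDensity_mul hi (φ := fun _ => 1)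
    continuous_const (M := 1) (fun _ => by simp)
  obtain ⟨k3, -⟩ := integral_scaledOneParticleDensity_mul hi hχ.continuous hM
  obtain ⟨μ, hμ⟩ : ∃ μ : ℂ → ℝ, μ = scaledOneParticleDensity ℓ (0 + 1) (rootPolynomial (0 + 1) S) :=
    ⟨_, rfl⟩
  rw [← hμ] at k1 k2 k3 hdec hnn ⊢
  simp only [mul_one] at k1 k2
  have hmass : ∫ x, μ x = 1 := by
    refine mul_right_cancel₀ hZ.ne' (k2.trans ?_)
    simp
  obtain ⟨hgi, hge⟩ := integral_exp_neg_quarter_sq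
  have hpt : ∀ x, ‖x‖ * μ x ≤ Real.exp A * Real.exp (-(1 / 4) * ‖x‖ ^ 2) := by
    intro x
    have h1 := hdec x
    simp only [zero_add, Nat.cast_one, mul_one, one_mul] at h1
    have h2 : ‖x‖ ≤ Real.exp (1 / 4 * ‖x‖ ^ 2) := by
      have h3 := Real.add_one_le_exp (1 / 4 * ‖x‖ ^ 2)
      nlinarith [sq_nonneg (‖x‖ - 2)]
    calc ‖x‖ * μ x ≤ Real.exp (1 / 4 * ‖x‖ ^ 2) * (Real.exp A * Real.exp (-(‖x‖ ^ 2 / 2))) :=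
          mul_le_mul h2 h1 (hnn x) (Real.exp_pos _).le
      _ = _ := by
          rw [← Real.exp_add, ← Real.exp_add, ← Real.exp_add]
          congr 1
          ring
  have i1 : Integrable fun x => ‖x‖ * μ x := by
    refine (hgi.const_mul (Real.exp A)).mono'
      (continuous_norm.aestronglyMeasurable.mul k1.aestronglyMeasurable)
      (Eventually.of_forall fun x => ?_)
    rw [Real.norm_of_nonneg (mul_nonneg (norm_nonneg _) (hnn x))]
    exact hpt x
  have m1 : ∫ x, ‖x‖ * μ x ≤ Real.exp A * (4 * Real.pi) := by
    rw [← hge, ← integral_const_mul]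
    exact integral_mono i1 (hgi.const_mul _) hpt
  have i2 := h.integrable_norm_mul
  have m2 : ∫ x, ‖x‖ * ρ x ≤ T := by
    have h1 : ∫ x, ‖x‖ * ρ x ≤ ∫ x, T * ρ x := by
      refine integral_mono i2 (h.integrable.const_mul T) fun x => ?_
      by_cases hx : T < ‖x‖
      · simp [h.eq_zero x hx]
      · exact mul_le_mul_of_nonneg_right (not_lt.1 hx) (h.nonneg' x)
    rwa [integral_const_mul, h.integral_eq_one, mul_one] at h1
  have i3 : Integrable fun x => (μ x - ρ x) * χ x := by
    simp_rw [sub_mul]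
    refine k3.sub ((h.integrable_mul hχ.continuous.locallyIntegrable).congr
      (Eventually.of_forall fun x => mul_comm _ _))
  have i4 : Integrable fun x => (μ x - ρ x) * χ 0 := (k1.sub h.integrable).mul_const _
  -- Both densities have mass 1, so χ 0 may be subtracted; then |χ x − χ 0| ≤ B‖x‖ leaves only first
  -- moments.
  have e1 : ∫ x, (μ x - ρ x) * χ x = ∫ x, ((μ x - ρ x) * χ x - (μ x - ρ x) * χ 0) := by
    rw [integral_sub i3 i4, integral_mul_const, integral_sub k1 h.integrable, hmass,
      h.integral_eq_one]
    ring
  have hb : ∫ x, B * (‖x‖ * μ x + ‖x‖ * ρ x) ≤ (Real.exp A * (4 * Real.pi) + T) * B := by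
    rw [integral_const_mul, integral_add i1 i2, mul_comm]
    exact mul_le_mul_of_nonneg_right (add_le_add m1 m2) hB0
  rw [e1]
  refine le_trans ?_ hb
  rw [← Real.norm_eq_abs]
  refine norm_integral_le_of_norm_le ((i1.add i2).const_mul B) (Eventually.of_forall fun x => ?_)
  rw [← mul_sub, norm_mul, Real.norm_eq_abs, Real.norm_eq_abs]
  have h1 := hlip x 0
  rw [sub_zero] at h1
  have h2 : |μ x - ρ x| ≤ μ x + ρ x := by
    refine (abs_sub _ _).trans_eq ?_
    rw [abs_of_nonneg (hnn x), abs_of_nonneg (h.nonneg' x)]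
  have h3 := mul_le_mul h2 h1 (abs_nonneg _) (add_nonneg (hnn x) (h.nonneg' x))
  refine h3.trans_eq ?_
  ring

end Estimates

/-! ### The minimizer and the main theorem. -/

theorem IsEquilibrium.isElectrostaticMinimizer {ℓ N : ℕ} (hN : 1 ≤ N) {S : Finset ℂ} {Λ T e : ℝ}
    {ρ : ℂ → ℝ} (h : IsEquilibrium ℓ (2 / N) S Λ T e ρ) :
    IsElectrostaticMinimizer ℓ N (rootPolynomial N S) ρ := by
  refine ⟨(isFiniteEnergyDensity_rootPolynomial_iff hN S ρ).2 h.hasFiniteEnergy, fun σ hσ => ?_⟩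
  rw [electrostaticEnergy_rootPolynomial ℓ hN, electrostaticEnergy_rootPolynomial ℓ hN]
  exact h.chargeEnergy_le (Nat.cast_nonneg ℓ) (by positivity)
    ((isFiniteEnergyDensity_rootPolynomial_iff hN S σ).1 hσ)

theorem IsEquilibrium.ae_eq_of_isElectrostaticMinimizer {ℓ N : ℕ} (hℓ : 1 ≤ ℓ) (hN : 1 ≤ N)
    {S : Finset ℂ} {Λ T e : ℝ} {ρ σ : ℂ → ℝ} (h : IsEquilibrium ℓ (2 / N) S Λ T e ρ)
    (hσ : IsElectrostaticMinimizer ℓ N (rootPolynomial N S) σ) : σ =ᵐ[volume] ρ := by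
  have h1 := hσ.2 ρ (h.isElectrostaticMinimizer hN).1
  rw [electrostaticEnergy_rootPolynomial ℓ hN, electrostaticEnergy_rootPolynomial ℓ hN] at h1
  exact h.ae_eq_of_chargeEnergy_le (by exact_mod_cast hℓ) (by positivity)
    ((isFiniteEnergyDensity_rootPolynomial_iff hN S σ).1 hσ.1) h1

/-- Absorbs the constant into the logarithm because log 2 > 1/2; it fails at N = 1. -/
theorem one_add_log_le {N : ℕ} (hN : 2 ≤ N) : 1 + Real.log N ≤ 3 * Real.log N := by
  have h1 : Real.log 2 ≤ Real.log N :=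
    Real.log_le_log (by norm_num) (by exact_mod_cast hN)
  linarith [Real.log_two_gt_d9]

theorem mainTheorem5 (ℓ : ℕ) (hℓ : 1 ≤ ℓ) (U : ℂ → ℝ) (hU : IsTrappingPotential U) (R : ℝ) :
    ∃ C c : ℝ, 0 < C ∧ 0 < c ∧
      ∀ Ω₀ : Set ℂ, IsBathtubSet ℓ U Ω₀ → Ω₀ ⊆ Metric.closedBall 0 R →
      ∀ N : ℕ, 1 ≤ N → ∀ b u : ℂ, ‖u‖ = 1 →
        (∃ ρel : ℂ → ℝ,
          IsElectrostaticMinimizer ℓ N (quasiHolePolynomial N R Ω₀ b u) ρel ∧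
          (∀ σ : ℂ → ℝ,
            IsElectrostaticMinimizer ℓ N (quasiHolePolynomial N R Ω₀ b u) σ →
              σ =ᵐ[volume] ρel) ∧
          ∀ χ : ℂ → ℝ, ContDiff ℝ 1 χ → HasCompactSupport χ →
            |∫ x : ℂ,
                (scaledOneParticleDensity ℓ N (quasiHolePolynomial N R Ω₀ b u) x - ρel x) * χ x| ≤
              C * √(Real.log N / N) * (eLpNorm (fderiv ℝ χ) 2 volume).toReal +
                C * (1 / √(N : ℝ)) * (eLpNorm (fderiv ℝ χ) ⊤ volume).toReal) ∧
        ∀ x : ℂ,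
          0 ≤ scaledOneParticleDensity ℓ N (quasiHolePolynomial N R Ω₀ b u) x ∧
          scaledOneParticleDensity ℓ N (quasiHolePolynomial N R Ω₀ b u) x ≤
            C * Real.exp (-(N * c * (‖x‖ ^ 2 - Real.log N))) := by
  obtain ⟨K, hKd⟩ : ∃ K : ℝ, K = 2 * (|R| + 2) ^ 2 := ⟨_, rfl⟩
  have hK0 : 0 ≤ K := hKd ▸ by positivity
  have hℓ' : (1 : ℝ) ≤ ℓ := by exact_mod_cast hℓ
  -- At most K N holes of charge 2/N have total charge at most 2K, so Λ and T are uniform in N and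
  -- in the grid.
  obtain ⟨Λ, T, hΛ, hT, heq⟩ := exists_equilibrium hℓ' (mul_nonneg zero_le_two hK0) (abs_nonneg R)
  obtain ⟨A, hAd⟩ : ∃ A : ℝ, A = K + ℓ + 1 := ⟨_, rfl⟩
  have hA0 : 0 ≤ A := by linarith
  obtain ⟨G, hG⟩ : ∃ G : ℝ, G = gibbsConstant ℓ Λ T := ⟨_, rfl⟩
  have hG0 : 0 ≤ G := by
    have h1 : 0 ≤ Real.log Λ := Real.log_nonneg hΛ
    have h2 : 0 ≤ Real.log (2 * Real.pi) := Real.log_nonneg (by linarith [Real.pi_gt_three])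
    have hJ := nearMass_pos
    rw [hG]
    unfold gibbsConstant
    positivity
  obtain ⟨C₁, hC₁⟩ : ∃ C₁ : ℝ, C₁ = √(3 * G) := ⟨_, rfl⟩
  obtain ⟨C₂, hC₂⟩ : ∃ C₂ : ℝ, C₂ = Real.exp A * (4 * Real.pi) + T := ⟨_, rfl⟩
  obtain ⟨C₃, hC₃⟩ : ∃ C₃ : ℝ, C₃ = Real.exp (A * Real.exp (2 * A)) := ⟨_, rfl⟩
  have hC₁0 : 0 ≤ C₁ := hC₁ ▸ Real.sqrt_nonneg _
  have hC₂0 : 0 ≤ C₂ := by rw [hC₂]; positivity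
  have hC₃0 : 0 ≤ C₃ := hC₃ ▸ (Real.exp_pos _).le
  -- C₁ is for the energy estimate when N ≥ 2, C₂ for N = 1, C₃ for the decay; the summand 1 covers
  -- the cost of smearing.
  refine ⟨C₁ + C₂ + C₃ + 1, 1 / 2, by positivity, by norm_num, ?_⟩
  intro Ω₀ _ _ N hN b u hu
  obtain ⟨S, hS⟩ : ∃ S : Finset ℂ, S = (quasiHoleSet_finite N R Ω₀ b u).toFinset := ⟨_, rfl⟩
  have hf : quasiHolePolynomial N R Ω₀ b u = rootPolynomial N S := by rw [hS]; rfl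
  have hcard : (S.card : ℝ) ≤ K * N := by rw [hS, hKd]; exact card_quasiHoleSet_le hN R Ω₀ b u hu
  have hSR : ∀ a ∈ S, ‖a‖ ≤ |R| := fun a ha => by
    rw [hS, Set.Finite.mem_toFinset] at ha
    exact (mem_closedBall_zero_iff.1 (quasiHoleSet_subset_closedBall N R Ω₀ b u ha)).trans
      (le_abs_self R)
  have hN1 : (1 : ℝ) ≤ N := by exact_mod_cast hN
  have hN0 : (0 : ℝ) < N := by linarith
  obtain ⟨e, ρ, h⟩ := heq (2 / N) S (by positivity) (by
    rw [div_mul_eq_mul_div, div_le_iff₀ hN0]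
    linarith) hSR
  rw [hf]
  clear hf hS
  obtain ⟨n, rfl⟩ : ∃ n, N = n + 1 := ⟨N - 1, by omega⟩
  have hA : S.card + ℓ * n + (n + 1 : ℕ) ≤ A * (n + 1 : ℕ) := by
    rw [hAd]
    push_cast at hcard ⊢
    nlinarith
  refine ⟨⟨ρ, h.isElectrostaticMinimizer hN, fun σ hσ =>
    h.ae_eq_of_isElectrostaticMinimizer hℓ hN hσ, fun χ hχ hs => ?_⟩, fun x =>
    ⟨scaledOneParticleDensity_nonneg _ _ x, ?_⟩⟩
  · obtain ⟨a, ha⟩ : ∃ a, a = (eLpNorm (fderiv ℝ χ) 2 volume).toReal := ⟨_, rfl⟩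
    obtain ⟨B, hB⟩ : ∃ B, B = (eLpNorm (fderiv ℝ χ) ⊤ volume).toReal := ⟨_, rfl⟩
    have ha0 : 0 ≤ a := ha ▸ ENNReal.toReal_nonneg
    have hB0 : 0 ≤ B := hB ▸ ENNReal.toReal_nonneg
    -- For N = 1 the Dirichlet term has coefficient 0, so the whole bound must come from the
    -- Lipschitz term.
    rcases Nat.eq_zero_or_pos n with hn | hn
    · subst hn
      have h1 := h.abs_integral_sub_mul_le_one hA hχ hs
      rw [← hB, ← hC₂] at h1
      rw [← ha, ← hB]
      refine h1.trans ?_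
      simp only [zero_add, Nat.cast_one, Real.log_one, Real.sqrt_zero, mul_zero,
        zero_mul, Real.sqrt_one, div_one, mul_one]
      exact mul_le_mul_of_nonneg_right (by linarith) hB0
    · have h1 := h.abs_integral_sub_mul_le hℓ hΛ (by linarith) hχ hs
      rw [← hB, ← ha, ← hG] at h1
      rw [← ha, ← hB]
      have h2 : √(G * (1 + Real.log (n + 1 : ℕ)) / (n + 1 : ℕ)) ≤
          C₁ * √(Real.log (n + 1 : ℕ) / (n + 1 : ℕ)) := by
        rw [hC₁, ← Real.sqrt_mul (by positivity)]
        refine Real.sqrt_le_sqrt ?_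
        rw [mul_div_assoc', div_le_div_iff_of_pos_right hN0]
        have := mul_le_mul_of_nonneg_left (one_add_log_le (N := n + 1) (by omega)) hG0
        linarith
      refine h1.trans (add_le_add ?_ ?_)
      · refine mul_le_mul_of_nonneg_right (h2.trans ?_) ha0
        exact mul_le_mul_of_nonneg_right (by linarith) (Real.sqrt_nonneg _)
      · rw [mul_comm B]
        refine mul_le_mul_of_nonneg_right ?_ hB0
        exact le_mul_of_one_le_left (by positivity) (by linarith)
  · refine (h.scaledOneParticleDensity_le_exp hA x).trans
      ((exp_mul_le_exp_mul_exp hA0 hN1 (‖x‖ ^ 2)).trans ?_)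
    rw [← hC₃]
    exact mul_le_mul_of_nonneg_right (by linarith) (Real.exp_pos _).le
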